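/- Let $\mathbb N=\{1,2,\dots\}$ and let $(e_n)$ be the standard basis of the space $c_{00}$ of finitely supported real sequences. For finite sets $A,B\subset\mathbb N$, $A<B$ means that every element of $A$ is smaller than every element of $B$, and $n\le A$ means that every element of $A$ is at least $n$. The Schreier families are $$\mathcal F_0=\{\emptyset\}\cup\{\{n\}:n\in\mathbb N\},\qquad \mathcal F_{k+1}=\{\emptyset\}\cup\Big\{\bigcup_{i=1}^nA_i: n\ge 1,\ \emptyset\ne A_i\in\mathcal F_k,\ n\le A_1<A_2<\dots<A_n\Big\}.$$ A sequence $(E_i)_{i=1}^n$ of non-empty finite subsets of $\mathbb N$ with $\{\min E_1,\dots,\min E_n\}\in\mathcal F_k$ is called $\mathcal F_k$-admissible if $E_1<\dots<E_n$, and $\mathcal F_k$-allowable if the $E_i$ are pairwise disjoint. A sequence in $c_{00}$ is called admissible (allowable) if the sequence of its supports is. Let $(\theta_n)_{n\ge1}$ be a regular sequence, that is, $\theta_n\in(0,1)$, $\theta_n$ decreases to $0$, and $\theta_{n+m}\ge\theta_n\theta_m$ for all $n,m\ge 1$. The mixed Tsirelson space $T[(\mathcal F_k,\theta_k)_{k=1}^\infty]$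 is the completion of $c_{00}$ under the norm $\|x\|=\sup_{f\in K}\langle x,f\rangle$, where $K\subset c_{00}$ is the smallest set that contains $\pm e_n$ for all $n$ and contains $\theta_k(f_1+\dots+f_n)$ whenever $k,n\ge1$, $f_1,\dots,f_n\in K$ and $(f_i)_{i=1}^n$ is $\mathcal F_k$-admissible. Equivalently, this is the norm that satisfies $$\|x\|=\max\Big\{\|x\|_\infty,\ \sup_k\theta_k\sup\Big\{\sum_{i=1}^n\|E_ix\|:(E_i)_{i=1}^n\text{ is }\mathcal F_k\text{-admissible}\Big\}\Big\},$$ where $E_ix$ is the restriction of $x$ to $E_i$. The modified mixed Tsirelson space $T_M[(\mathcal F_k,\theta_k)_{k=1}^\infty]$ is defined from $K$ in the same way, with "allowable" in place of "admissible" for all $k$. For $m\in\mathbb N$ the boundedly modified mixed Tsirelson space $T_{M(m)}[(\mathcal F_k,\theta_k)_{k=1}^\infty]$ is defined with "allowable" for $k\le m$ and "admissible" for $k\ge m+1$. **Corollary 1.26.** Let $(\theta_n)_{n\ge1}$ be a regular sequence with $\lim_{n\to\infty}\theta_n^{1/n}=1$. Let $X=T_M[(\mathcal F_k,\theta_k)_{k=1}^\infty]$,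 or $X=T_{M(m)}[(\mathcal F_k,\theta_k)_{k=1}^\infty]$ for some $m\in\mathbb N$. Then $X$ and $T[(\mathcal F_k,\theta_k)_{k=1}^\infty]$ are totally incomparable: no infinite-dimensional closed subspace of $X$ is linearly homeomorphic to a closed subspace of $T[(\mathcal F_k,\theta_k)_{k=1}^\infty]$. -/

import Mathlib

namespace Tsirelson

open Filter Topology

/-! ### Families of finite sets. The set of positive integers is `ℕ+`. -/

/-- `E 0 < E 1 < ⋯ < E (n - 1)`: every element of an earlier set is smaller than every element
of a later one. -/
def Successive {n : ℕ} (E : Fin n → Finset ℕ+) : Prop :=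
  ∀ i j, i < j → ∀ a ∈ E i, ∀ b ∈ E j, a < b

/-- The set `{min E 0, …, min E (n - 1)}` of a sequence of non-empty sets. -/
def minSet {n : ℕ} (E : Fin n → Finset ℕ+) (h : ∀ i, (E i).Nonempty) : Finset ℕ+ :=
  Finset.univ.image fun i => (E i).min' (h i)

/-- `E` is a sequence of non-empty successive sets whose minima form a member of `M`. -/
def Admissible (M : Set (Finset ℕ+)) {n : ℕ} (E : Fin n → Finset ℕ+) : Prop :=
  ∃ h : ∀ i, (E i).Nonempty, Successive E ∧ minSet E h ∈ M

/-- `E` is a sequence of non-empty pairwise disjoint sets whose minima form a member of `M`. -/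
def Allowable (M : Set (Finset ℕ+)) {n : ℕ} (E : Fin n → Finset ℕ+) : Prop :=
  ∃ h : ∀ i, (E i).Nonempty, Pairwise (fun i j => Disjoint (E i) (E j)) ∧ minSet E h ∈ M

/-- The Schreier families of finite order: the zeroth one consists of the empty set and the
singletons, and the members of the next one are the empty set and the unions `A₁ ∪ ⋯ ∪ Aₙ` of
non-empty members of the previous one with `n ≤ A₁ < A₂ < ⋯ < Aₙ`. -/
def schreier : ℕ → Set (Finset ℕ+)
  | 0 => {∅} ∪ {A | ∃ n, A = {n}}
  | k + 1 => {∅} ∪ {A | ∃ (n : ℕ) (B : Fin n → Finset ℕ+), 0 < n ∧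
      (∀ i, B i ∈ schreier k) ∧ (∀ i, (B i).Nonempty) ∧ (∀ i, ∀ a ∈ B i, n ≤ (a : ℕ)) ∧
      Successive B ∧ A = Finset.univ.biUnion B}

/-! ### Norms on finitely supported sequences given by norming sets -/

/-- The action `⟨f, x⟩ = ∑ f n * x n` of a finitely supported functional. -/
def pairing (f x : ℕ+ →₀ ℝ) : ℝ := ∑ n ∈ f.support, f n * x n

/-- A set of finitely supported functionals with coordinates of absolute value at most one that
contains all `± eₙ`. -/
structure NormingSet where
  carrier : Set (ℕ+ →₀ ℝ)
  basis_mem : ∀ n, Finsupp.single n 1 ∈ carrier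
  neg_basis_mem : ∀ n, Finsupp.single n (-1) ∈ carrier
  neg_mem : ∀ f ∈ carrier, -f ∈ carrier
  abs_le_one : ∀ f ∈ carrier, ∀ n, |f n| ≤ 1

/-- The linear space of finitely supported sequences, normed by
`‖x‖ = sup {⟨f, x⟩ : f ∈ K}`. -/
def C00 (_K : NormingSet) : Type := ℕ+ →₀ ℝ

noncomputable instance (K : NormingSet) : AddCommGroup (C00 K) :=
  inferInstanceAs (AddCommGroup (ℕ+ →₀ ℝ))

noncomputable instance (K : NormingSet) : Module ℝ (C00 K) :=
  inferInstanceAs (Module ℝ (ℕ+ →₀ ℝ))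

/-- `sup {⟨f, x⟩ : f ∈ K}`; the supremum is finite by `NormingSet.bddAbove`. -/
noncomputable def NormingSet.norm (K : NormingSet) (x : ℕ+ →₀ ℝ) : ℝ :=
  ⨆ f : K.carrier, pairing f x

theorem pairing_eq {f : ℕ+ →₀ ℝ} {s : Finset ℕ+} (h : f.support ⊆ s) (x : ℕ+ →₀ ℝ) :
    pairing f x = ∑ n ∈ s, f n * x n := by
  refine Finset.sum_subset h fun n _ hn => ?_
  rw [Finsupp.notMem_support_iff.1 hn, zero_mul]

theorem pairing_eq_right {x : ℕ+ →₀ ℝ} {s : Finset ℕ+} (h : x.support ⊆ s) (f : ℕ+ →₀ ℝ) :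
    pairing f x = ∑ n ∈ s, f n * x n := by
  rw [pairing_eq (Finset.subset_union_left (s₂ := s))]
  symm
  refine Finset.sum_subset Finset.subset_union_right fun n _ hn => ?_
  rw [Finsupp.notMem_support_iff.1 fun h' => hn (h h'), mul_zero]

theorem pairing_add (f x y : ℕ+ →₀ ℝ) : pairing f (x + y) = pairing f x + pairing f y := by
  simp [pairing, mul_add, Finset.sum_add_distrib]

theorem pairing_smul (f x : ℕ+ →₀ ℝ) (c : ℝ) : pairing f (c • x) = c * pairing f x := by
  simp only [pairing, Finset.mul_sum]
  exact Finset.sum_congr rfl fun n _ => by simp; ring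

theorem pairing_neg (f x : ℕ+ →₀ ℝ) : pairing (-f) x = -pairing f x := by
  simp [pairing, Finsupp.support_neg]

theorem pairing_single (n : ℕ+) (c : ℝ) (x : ℕ+ →₀ ℝ) :
    pairing (Finsupp.single n c) x = c * x n := by
  rw [pairing_eq (s := {n}) Finsupp.support_single_subset]; simp

theorem NormingSet.abs_pairing_le (K : NormingSet) {f : ℕ+ →₀ ℝ} (hf : f ∈ K.carrier)
    (x : ℕ+ →₀ ℝ) : |pairing f x| ≤ ∑ n ∈ x.support, |x n| := by
  rw [pairing_eq_right subset_rfl]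
  refine (Finset.abs_sum_le_sum_abs _ _).trans (Finset.sum_le_sum fun n _ => ?_)
  rw [abs_mul]
  exact mul_le_of_le_one_left (abs_nonneg _) (K.abs_le_one f hf n)

theorem NormingSet.bddAbove (K : NormingSet) (x : ℕ+ →₀ ℝ) :
    BddAbove (Set.range fun f : K.carrier => pairing f x) :=
  ⟨_, by rintro _ ⟨f, rfl⟩; exact (le_abs_self _).trans (K.abs_pairing_le f.2 x)⟩

theorem NormingSet.pairing_le (K : NormingSet) {f : ℕ+ →₀ ℝ} (hf : f ∈ K.carrier)
    (x : ℕ+ →₀ ℝ) : pairing f x ≤ K.norm x :=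
  le_ciSup (K.bddAbove x) (⟨f, hf⟩ : K.carrier)

theorem NormingSet.norm_le (K : NormingSet) {x : ℕ+ →₀ ℝ} {u : ℝ}
    (h : ∀ f ∈ K.carrier, pairing f x ≤ u) : K.norm x ≤ u :=
  have : Nonempty K.carrier := ⟨⟨_, K.basis_mem 1⟩⟩
  ciSup_le fun f => h f f.2

theorem NormingSet.abs_apply_le (K : NormingSet) (x : ℕ+ →₀ ℝ) (n : ℕ+) :
    |x n| ≤ K.norm x := by
  refine abs_le'.2 ⟨?_, ?_⟩
  · simpa [pairing_single] using K.pairing_le (K.basis_mem n) x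
  · have := K.pairing_le (K.neg_basis_mem n) x
    rwa [pairing_single, neg_one_mul] at this

theorem NormingSet.norm_nonneg (K : NormingSet) (x : ℕ+ →₀ ℝ) : 0 ≤ K.norm x :=
  (abs_nonneg _).trans (K.abs_apply_le x 1)

theorem NormingSet.norm_smul (K : NormingSet) (c : ℝ) (x : ℕ+ →₀ ℝ) :
    K.norm (c • x) = |c| * K.norm x := by
  have key : ∀ (c : ℝ) (x : ℕ+ →₀ ℝ), K.norm (c • x) ≤ |c| * K.norm x := by
    intro c x
    refine K.norm_le fun f hf => ?_
    rw [pairing_smul]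
    rcases le_total 0 c with hc | hc
    · rw [abs_of_nonneg hc]
      exact mul_le_mul_of_nonneg_left (K.pairing_le hf x) hc
    · rw [abs_of_nonpos hc]
      have := mul_le_mul_of_nonneg_left (K.pairing_le (K.neg_mem f hf) x) (neg_nonneg.2 hc)
      rwa [pairing_neg, neg_mul_neg] at this
  refine le_antisymm (key c x) ?_
  rcases eq_or_ne c 0 with rfl | hc
  · simpa using K.norm_nonneg _
  · have := key c⁻¹ (c • x)
    rw [smul_smul, inv_mul_cancel₀ hc, one_smul, abs_inv] at this
    have hc' : 0 < |c| := abs_pos.2 hc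
    calc |c| * K.norm x ≤ |c| * (|c|⁻¹ * K.norm (c • x)) :=
          mul_le_mul_of_nonneg_left this hc'.le
      _ = K.norm (c • x) := by rw [← mul_assoc, mul_inv_cancel₀ hc'.ne', one_mul]

theorem NormingSet.norm_add_le (K : NormingSet) (x y : ℕ+ →₀ ℝ) :
    K.norm (x + y) ≤ K.norm x + K.norm y :=
  K.norm_le fun f hf => by
    rw [pairing_add]; exact add_le_add (K.pairing_le hf x) (K.pairing_le hf y)

noncomputable instance (K : NormingSet) : Norm (C00 K) := ⟨fun x => K.norm x⟩

theorem C00.core (K : NormingSet) : NormedSpace.Core ℝ (C00 K) where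
  norm_nonneg x := K.norm_nonneg x
  norm_smul c x := K.norm_smul c x
  norm_triangle x y := K.norm_add_le x y
  norm_eq_zero_iff x := by
    refine ⟨fun h => ?_, fun h => ?_⟩
    · refine Finsupp.ext fun n => abs_nonpos_iff.1 ?_
      exact (K.abs_apply_le x n).trans (le_of_eq h)
    · rw [h]
      have := K.norm_smul 0 0
      rw [zero_smul, abs_zero, zero_mul] at this
      exact this

noncomputable instance (K : NormingSet) : NormedAddCommGroup (C00 K) :=
  NormedAddCommGroup.ofCore (C00.core K)

noncomputable instance (K : NormingSet) : NormedSpace ℝ (C00 K) :=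
  NormedSpace.ofCore (C00.core K)

/-! ### The norming sets of mixed Tsirelson type -/

/-- The smallest set that contains `± eₙ` for all `n` and contains `θ k • (f₁ + ⋯ + fₙ)` whenever
it contains `f₁, …, fₙ` (`n ≥ 1`) and the sequence of the supports of the `fᵢ` satisfies `R k`. -/
inductive Norming (R : ℕ+ → ∀ n : ℕ, (Fin n → Finset ℕ+) → Prop) (θ : ℕ+ → ℝ) :
    (ℕ+ →₀ ℝ) → Prop
  | basis (n : ℕ+) : Norming R θ (Finsupp.single n 1)
  | neg_basis (n : ℕ+) : Norming R θ (Finsupp.single n (-1))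
  | sum (k : ℕ+) (n : ℕ) (f : Fin n → (ℕ+ →₀ ℝ)) : 0 < n → (∀ i, Norming R θ (f i)) →
      R k n (fun i => (f i).support) → Norming R θ (θ k • ∑ i, f i)

theorem Norming.neg {R : ℕ+ → ∀ n : ℕ, (Fin n → Finset ℕ+) → Prop} {θ : ℕ+ → ℝ}
    {f : ℕ+ →₀ ℝ} (hf : Norming R θ f) : Norming R θ (-f) := by
  induction hf with
  | basis n => rw [← Finsupp.single_neg]; exact .neg_basis n
  | neg_basis n => rw [← Finsupp.single_neg, neg_neg]; exact .basis n
  | sum k n f hn _ hR ih =>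
    rw [← smul_neg, ← Finset.sum_neg_distrib]
    refine .sum k n _ hn ih ?_
    simpa only [Finsupp.support_neg] using hR

theorem Norming.abs_le_one {R : ℕ+ → ∀ n : ℕ, (Fin n → Finset ℕ+) → Prop} {θ : ℕ+ → ℝ}
    (hθ : ∀ k, θ k ∈ Set.Ioo (0 : ℝ) 1)
    (hR : ∀ k n E, R k n E → Pairwise fun i j => Disjoint (E i) (E j))
    {f : ℕ+ →₀ ℝ} (hf : Norming R θ f) (m : ℕ+) : |f m| ≤ 1 := by
  induction hf with
  | basis n => rw [Finsupp.single_apply]; split_ifs <;> simp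
  | neg_basis n => rw [Finsupp.single_apply]; split_ifs <;> simp
  | sum k n f hn _ h ih =>
    have hd := hR _ _ _ h
    have h1 : |∑ i, f i m| ≤ 1 := by
      by_cases hm : ∃ i, m ∈ (f i).support
      · obtain ⟨i, hi⟩ := hm
        rw [Finset.sum_eq_single i]
        · exact ih i
        · intro j _ hj
          exact Finsupp.notMem_support_iff.1 (Finset.disjoint_left.1 (hd hj.symm) hi)
        · simp
      · push Not at hm
        rw [Finset.sum_eq_zero fun i _ => Finsupp.notMem_support_iff.1 (hm i)]
        simp
    rw [Finsupp.smul_apply, Finsupp.finsetSum_apply, smul_eq_mul, abs_mul,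
      abs_of_pos (hθ k).1]
    exact mul_le_one₀ (hθ k).2.le (abs_nonneg _) h1

/-- The set `Norming R θ` as a norming set. -/
def normingSet (R : ℕ+ → ∀ n : ℕ, (Fin n → Finset ℕ+) → Prop) (θ : ℕ+ → ℝ)
    (hθ : ∀ k, θ k ∈ Set.Ioo (0 : ℝ) 1)
    (hR : ∀ k n E, R k n E → Pairwise fun i j => Disjoint (E i) (E j)) : NormingSet where
  carrier := {f | Norming R θ f}
  basis_mem := .basis
  neg_basis_mem := .neg_basis
  neg_mem _ hf := hf.neg
  abs_le_one _ hf := hf.abs_le_one hθ hR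

theorem Admissible.disjoint {M : Set (Finset ℕ+)} {n : ℕ} {E : Fin n → Finset ℕ+}
    (h : Admissible M E) : Pairwise fun i j => Disjoint (E i) (E j) := by
  intro i j hij
  refine Finset.disjoint_left.2 fun a hi hj => ?_
  rcases lt_or_gt_of_ne hij with h' | h'
  · exact lt_irrefl _ (h.2.1 _ _ h' _ hi _ hj)
  · exact lt_irrefl _ (h.2.1 _ _ h' _ hj _ hi)

/-- The norming set of the mixed Tsirelson space: all families are admissible. For hereditary and
spreading families the resulting norm is the unique norm that satisfies the implicit equation of
mixed Tsirelson spaces, see `mixedNormingSet_isLUB` and `mixedNormingSet_unique`. -/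
def mixedNormingSet (M : ℕ+ → Set (Finset ℕ+)) (θ : ℕ+ → ℝ)
    (hθ : ∀ k, θ k ∈ Set.Ioo (0 : ℝ) 1) : NormingSet :=
  normingSet (fun k _ E => Admissible (M k) E) θ hθ fun _ _ _ h => h.disjoint

/-- The norming set of the modified mixed Tsirelson space: all families are allowable. -/
def modifiedNormingSet (M : ℕ+ → Set (Finset ℕ+)) (θ : ℕ+ → ℝ)
    (hθ : ∀ k, θ k ∈ Set.Ioo (0 : ℝ) 1) : NormingSet :=
  normingSet (fun k _ E => Allowable (M k) E) θ hθ fun _ _ _ h => h.2.1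

/-- The norming set of the boundedly modified mixed Tsirelson space: the families are allowable
for `k ≤ m` and admissible for `k > m`. -/
def boundedlyModifiedNormingSet (m : ℕ+) (M : ℕ+ → Set (Finset ℕ+)) (θ : ℕ+ → ℝ)
    (hθ : ∀ k, θ k ∈ Set.Ioo (0 : ℝ) 1) : NormingSet :=
  normingSet (fun k _ E => (k ≤ m ∧ Allowable (M k) E) ∨ (m < k ∧ Admissible (M k) E)) θ hθ
    fun _ _ _ h => h.elim (fun h => h.2.2.1) fun h => h.2.disjoint

/-- The mixed Tsirelson space `T[(M k, θ k)]`. -/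
abbrev Mixed (M : ℕ+ → Set (Finset ℕ+)) (θ : ℕ+ → ℝ)
    (hθ : ∀ k, θ k ∈ Set.Ioo (0 : ℝ) 1) : Type :=
  UniformSpace.Completion (C00 (mixedNormingSet M θ hθ))

/-- The modified mixed Tsirelson space `T_M[(M k, θ k)]`. -/
abbrev Modified (M : ℕ+ → Set (Finset ℕ+)) (θ : ℕ+ → ℝ)
    (hθ : ∀ k, θ k ∈ Set.Ioo (0 : ℝ) 1) : Type :=
  UniformSpace.Completion (C00 (modifiedNormingSet M θ hθ))

/-- The boundedly modified mixed Tsirelson space `T_{M(m)}[(M k, θ k)]`. -/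
abbrev BoundedlyModified (m : ℕ+) (M : ℕ+ → Set (Finset ℕ+)) (θ : ℕ+ → ℝ)
    (hθ : ∀ k, θ k ∈ Set.Ioo (0 : ℝ) 1) : Type :=
  UniformSpace.Completion (C00 (boundedlyModifiedNormingSet m M θ hθ))

/-! ### The implicit equation of the mixed Tsirelson norm -/

/-- Closed under subsets. -/
def Hereditary (M : Set (Finset ℕ+)) : Prop := ∀ A ∈ M, ∀ B ⊆ A, B ∈ M

/-- Closed under moving the elements of a set to the right in an order-preserving way. -/
def Spreading (M : Set (Finset ℕ+)) : Prop :=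
  ∀ A ∈ M, ∀ φ : ℕ+ → ℕ+, StrictMonoOn φ A → (∀ a ∈ A, a ≤ φ a) → A.image φ ∈ M

/-- The set of numbers whose supremum is the right-hand side of the implicit equation
`N x = max {‖x‖_∞, sup_k θ_k sup {∑ N (E_i x) : (E_i) is M_k-admissible}}`. -/
def implicitSet (M : ℕ+ → Set (Finset ℕ+)) (θ : ℕ+ → ℝ) (N : (ℕ+ →₀ ℝ) → ℝ)
    (x : ℕ+ →₀ ℝ) : Set ℝ :=
  {r | ∃ n, r = |x n|} ∪ {r | ∃ (k : ℕ+) (n : ℕ) (E : Fin n → Finset ℕ+), 0 < n ∧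
    Admissible (M k) E ∧ r = θ k * ∑ i, N (x.filter (· ∈ E i))}

theorem exists_reindex {n : ℕ} (p : Fin n → Prop) (hp : ∃ i, p i) :
    ∃ (m : ℕ) (e : Fin m → Fin n), 0 < m ∧ StrictMono e ∧ (∀ j, p (e j)) ∧
      ∀ i, p i → ∃ j, e j = i := by
  classical
  refine ⟨(Finset.univ.filter p).card, (Finset.univ.filter p).orderEmbOfFin rfl, ?_,
    OrderEmbedding.strictMono _, fun j => ?_, fun i hi => ?_⟩
  · obtain ⟨i, hi⟩ := hp
    exact Finset.card_pos.2 ⟨i, by simpa using hi⟩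
  · exact (Finset.mem_filter.1 ((Finset.univ.filter p).orderEmbOfFin_mem rfl j)).2
  · have : i ∈ Set.range ((Finset.univ.filter p).orderEmbOfFin rfl) := by
      rw [Finset.range_orderEmbOfFin]; simpa using hi
    exact this

theorem schreier_empty (k : ℕ) : ∅ ∈ schreier k := by
  cases k <;> exact Or.inl rfl

theorem schreier_hereditary (k : ℕ) : Hereditary (schreier k) := by
  induction k with
  | zero =>
    rintro A (hA | ⟨n, rfl⟩) B hB
    · rw [Set.mem_singleton_iff.1 hA, Finset.subset_empty] at hB
      exact Or.inl hB
    · rcases Finset.subset_singleton_iff.1 hB with h | h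
      · exact Or.inl h
      · exact Or.inr ⟨n, h⟩
  | succ k ih =>
    rintro A (hA | ⟨n, C, hn, hC, hne, hge, hs, rfl⟩) B hB
    · rw [Set.mem_singleton_iff.1 hA, Finset.subset_empty] at hB
      exact Or.inl hB
    rcases B.eq_empty_or_nonempty with hB0 | ⟨b, hb⟩
    · exact Or.inl hB0
    obtain ⟨m, e, hm, he, h1, h2⟩ := exists_reindex (fun i => (C i ∩ B).Nonempty) (by
      obtain ⟨i, -, hi⟩ := Finset.mem_biUnion.1 (hB hb)
      exact ⟨i, b, Finset.mem_inter.2 ⟨hi, hb⟩⟩)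
    have hmn : m ≤ n := by simpa using Fintype.card_le_of_injective e he.injective
    refine Or.inr ⟨m, fun j => C (e j) ∩ B, hm, fun j => ih _ (hC _) _ Finset.inter_subset_left,
      h1, fun j a ha => hmn.trans (hge _ _ (Finset.mem_inter.1 ha).1), fun i j hij a ha b hb =>
      hs _ _ (he hij) _ (Finset.mem_inter.1 ha).1 _ (Finset.mem_inter.1 hb).1, ?_⟩
    ext a
    simp only [Finset.mem_biUnion, Finset.mem_univ, true_and, Finset.mem_inter]
    refine ⟨fun ha => ?_, fun ⟨_, h⟩ => h.2⟩
    obtain ⟨i, -, hi⟩ := Finset.mem_biUnion.1 (hB ha)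
    obtain ⟨j, rfl⟩ := h2 i ⟨a, Finset.mem_inter.2 ⟨hi, ha⟩⟩
    exact ⟨j, hi, ha⟩

theorem schreier_spreading (k : ℕ) : Spreading (schreier k) := by
  induction k with
  | zero =>
    rintro A (hA | ⟨n, rfl⟩) φ _ _
    · rw [Set.mem_singleton_iff.1 hA]; exact Or.inl rfl
    · exact Or.inr ⟨φ n, by simp⟩
  | succ k ih =>
    rintro A (hA | ⟨n, C, hn, hC, hne, hge, hs, rfl⟩) φ hφ hle
    · rw [Set.mem_singleton_iff.1 hA]; exact Or.inl rfl
    have hsub : ∀ i, C i ⊆ Finset.univ.biUnion C := fun i =>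
      Finset.subset_biUnion_of_mem C (Finset.mem_univ i)
    refine Or.inr ⟨n, fun i => (C i).image φ, hn, fun i => ih _ (hC i) φ
      (hφ.mono (Finset.coe_subset.2 (hsub i))) fun a ha => hle a (hsub i ha),
      fun i => (hne i).image φ, ?_, ?_, ?_⟩
    · intro i a ha
      obtain ⟨b, hb, rfl⟩ := Finset.mem_image.1 ha
      exact (hge i b hb).trans (PNat.coe_le_coe _ _ |>.2 (hle b (hsub i hb)))
    · intro i j hij a ha b hb
      obtain ⟨a', ha', rfl⟩ := Finset.mem_image.1 ha
      obtain ⟨b', hb', rfl⟩ := Finset.mem_image.1 hb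
      exact hφ (hsub i ha') (hsub j hb') (hs i j hij a' ha' b' hb')
    · rw [Finset.biUnion_image]

theorem Admissible.sub {M : Set (Finset ℕ+)} (hh : Hereditary M) (hs : Spreading M) {n m : ℕ}
    {E : Fin n → Finset ℕ+} (hE : Admissible M E) {e : Fin m → Fin n} (he : StrictMono e)
    {G : Fin m → Finset ℕ+} (hG : ∀ j, G j ⊆ E (e j)) (hne : ∀ j, (G j).Nonempty) :
    Admissible M G := by
  obtain ⟨hE0, hEs, hEM⟩ := hE
  refine ⟨hne, fun i j hij a ha b hb => hEs _ _ (he hij) _ (hG i ha) _ (hG j hb), ?_⟩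
  set p : Fin m → ℕ+ := fun j => (E (e j)).min' (hE0 _) with hp
  set q : Fin m → ℕ+ := fun j => (G j).min' (hne _) with hq
  have hpmono : StrictMono p := fun i j hij =>
    hEs _ _ (he hij) _ (Finset.min'_mem _ _) _ (Finset.min'_mem _ _)
  have hqmono : StrictMono q := fun i j hij =>
    hEs _ _ (he hij) _ (hG _ (Finset.min'_mem _ _)) _ (hG _ (Finset.min'_mem _ _))
  have hpq : ∀ j, p j ≤ q j := fun j => Finset.min'_le _ _ (hG _ (Finset.min'_mem _ _))
  have hpM : Finset.univ.image p ∈ M := by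
    refine hh _ hEM _ fun a ha => ?_
    obtain ⟨j, -, rfl⟩ := Finset.mem_image.1 ha
    exact Finset.mem_image.2 ⟨e j, Finset.mem_univ _, rfl⟩
  let φ : ℕ+ → ℕ+ := Function.extend p q id
  have hφ : ∀ j, φ (p j) = q j := fun j => hpmono.injective.extend_apply q id j
  have := hs _ hpM φ (by
      intro a ha b hb hab
      obtain ⟨i, -, rfl⟩ := Finset.mem_image.1 (Finset.mem_coe.1 ha)
      obtain ⟨j, -, rfl⟩ := Finset.mem_image.1 (Finset.mem_coe.1 hb)
      rw [hφ, hφ]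
      exact hqmono (hpmono.lt_iff_lt.1 hab)) (by
      intro a ha
      obtain ⟨i, -, rfl⟩ := Finset.mem_image.1 ha
      rw [hφ]; exact hpq i)
  rw [Finset.image_image] at this
  convert this using 1
  exact Finset.image_congr fun j _ => (hφ j).symm

theorem Norming.sum_or_zero {M : ℕ+ → Set (Finset ℕ+)} {θ : ℕ+ → ℝ}
    (hh : ∀ k, Hereditary (M k)) (hs : ∀ k, Spreading (M k)) (k : ℕ+) {n : ℕ}
    {E : Fin n → Finset ℕ+} (hE : Admissible (M k) E) (g : Fin n → (ℕ+ →₀ ℝ))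
    (hsub : ∀ i, (g i).support ⊆ E i)
    (hg : ∀ i, g i = 0 ∨ Norming (fun k _ E => Admissible (M k) E) θ (g i)) :
    θ k • ∑ i, g i = 0 ∨ Norming (fun k _ E => Admissible (M k) E) θ (θ k • ∑ i, g i) := by
  by_cases h0 : ∃ i, g i ≠ 0
  · obtain ⟨m, e, hm, he, h1, h2⟩ := exists_reindex (fun i => g i ≠ 0) h0
    have hsum : ∑ i, g i = ∑ j, g (e j) := by
      classical
      rw [← Finset.sum_image (f := g) (s := Finset.univ) (g := e) fun _ _ _ _ h =>
        he.injective h]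
      symm
      refine Finset.sum_subset (Finset.subset_univ _) fun i _ hi => ?_
      by_contra hne
      obtain ⟨j, rfl⟩ := h2 i hne
      exact hi (Finset.mem_image_of_mem _ (Finset.mem_univ _))
    rw [hsum]
    exact Or.inr (.sum k m _ hm (fun j => (hg _).resolve_left (h1 j))
      (hE.sub (hh k) (hs k) he (fun j => hsub _) fun j => Finsupp.support_nonempty_iff.2 (h1 j)))
  · push Not at h0
    left
    rw [Finset.sum_eq_zero fun i _ => h0 i, smul_zero]

theorem Norming.filter {M : ℕ+ → Set (Finset ℕ+)} {θ : ℕ+ → ℝ}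
    (hh : ∀ k, Hereditary (M k)) (hs : ∀ k, Spreading (M k)) {f : ℕ+ →₀ ℝ}
    (hf : Norming (fun k _ E => Admissible (M k) E) θ f) (F : Finset ℕ+) :
    f.filter (· ∈ F) = 0 ∨
      Norming (fun k _ E => Admissible (M k) E) θ (f.filter (· ∈ F)) := by
  induction hf with
  | basis n =>
    by_cases h : n ∈ F
    · right; rw [Finsupp.filter_single_of_pos _ h]; exact .basis n
    · left; exact Finsupp.filter_single_of_neg _ h
  | neg_basis n =>
    by_cases h : n ∈ F
    · right; rw [Finsupp.filter_single_of_pos _ h]; exact .neg_basis n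
    · left; exact Finsupp.filter_single_of_neg _ h
  | sum k n f hn _ hR ih =>
    have : (θ k • ∑ i, f i).filter (· ∈ F) = θ k • ∑ i, (f i).filter (· ∈ F) := by
      ext a
      by_cases ha : a ∈ F <;> simp [ha]
    rw [this]
    exact sum_or_zero hh hs k hR _
      (fun i => by rw [Finsupp.support_filter]; exact Finset.filter_subset _ _) ih

theorem pairing_filter (f x : ℕ+ →₀ ℝ) (F : Finset ℕ+) :
    pairing (f.filter (· ∈ F)) x = pairing f (x.filter (· ∈ F)) := by
  rw [pairing_eq (s := f.support)
    (by rw [Finsupp.support_filter]; exact Finset.filter_subset _ _), pairing]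
  refine Finset.sum_congr rfl fun n _ => ?_
  by_cases h : n ∈ F <;> simp [h]

theorem pairing_smul_sum {n : ℕ} (c : ℝ) (f : Fin n → (ℕ+ →₀ ℝ)) (x : ℕ+ →₀ ℝ) :
    pairing (c • ∑ i, f i) x = c * ∑ i, pairing (f i) x := by
  simp only [fun f : ℕ+ →₀ ℝ => pairing_eq_right (x := x) subset_rfl f]
  rw [Finset.sum_comm, Finset.mul_sum]
  refine Finset.sum_congr rfl fun a _ => ?_
  rw [Finsupp.smul_apply, Finsupp.finsetSum_apply, smul_eq_mul, mul_assoc, Finset.sum_mul]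

/-- For hereditary and spreading families, the norm given by the norming set satisfies the implicit
equation of the mixed Tsirelson norm. -/
theorem mixedNormingSet_isLUB (M : ℕ+ → Set (Finset ℕ+)) (θ : ℕ+ → ℝ)
    (hθ : ∀ k, θ k ∈ Set.Ioo (0 : ℝ) 1) (hh : ∀ k, Hereditary (M k))
    (hs : ∀ k, Spreading (M k)) (x : ℕ+ →₀ ℝ) :
    IsLUB (implicitSet M θ (mixedNormingSet M θ hθ).norm x) ((mixedNormingSet M θ hθ).norm x) := by
  set K := mixedNormingSet M θ hθ with hK
  refine ⟨?_, fun u hu => K.norm_le fun f hf => ?_⟩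
  · rintro r (⟨n, rfl⟩ | ⟨k, n, E, hn, hE, rfl⟩)
    · exact K.abs_apply_le x n
    · refine le_of_forall_pos_le_add fun ε hε => ?_
      have hn' : (0 : ℝ) < n := by exact_mod_cast hn
      have hex : ∀ i, ∃ f, Norming (fun k _ E => Admissible (M k) E) θ f ∧
          K.norm (x.filter (· ∈ E i)) < pairing f (x.filter (· ∈ E i)) + ε / n := by
        intro i
        have : Nonempty K.carrier := ⟨⟨_, K.basis_mem 1⟩⟩
        obtain ⟨f, hf⟩ := exists_lt_of_lt_ciSup
          (show K.norm (x.filter (· ∈ E i)) - ε / n <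
            ⨆ f : K.carrier, pairing f (x.filter (· ∈ E i)) from
            sub_lt_self _ (div_pos hε hn'))
        exact ⟨f, f.2, by linarith⟩
      choose f hfK hf using hex
      have h1 : pairing (θ k • ∑ i, (f i).filter (· ∈ E i)) x ≤ K.norm x := by
        rcases Norming.sum_or_zero hh hs k hE (fun i => (f i).filter (· ∈ E i))
          (fun i => by rw [Finsupp.support_filter]; intro a ha; exact (Finset.mem_filter.1 ha).2)
          (fun i => (hfK i).filter hh hs (E i)) with h | h
        · rw [h]; simpa [pairing] using K.norm_nonneg x
        · exact K.pairing_le h x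
      rw [pairing_smul_sum] at h1
      have h2 : ∑ i, K.norm (x.filter (· ∈ E i)) ≤
          ∑ i, pairing ((f i).filter (· ∈ E i)) x + ε := by
        calc ∑ i, K.norm (x.filter (· ∈ E i))
            ≤ ∑ i : Fin n, (pairing ((f i).filter (· ∈ E i)) x + ε / n) :=
              Finset.sum_le_sum fun i _ => by rw [pairing_filter]; exact (hf i).le
          _ = _ := by
              rw [Finset.sum_add_distrib]
              simp [mul_div_cancel₀ _ hn'.ne']
      have h3 := mul_le_mul_of_nonneg_left h2 (hθ k).1.le
      have h4 := mul_le_mul_of_nonneg_right (hθ k).2.le hε.le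
      linarith
  · have hf' : Norming (fun k _ E => Admissible (M k) E) θ f := hf
    cases hf' with
    | basis n =>
      rw [pairing_single, one_mul]
      exact (le_abs_self _).trans (hu (Or.inl ⟨n, rfl⟩))
    | neg_basis n =>
      rw [pairing_single, neg_one_mul]
      exact (neg_le_abs _).trans (hu (Or.inl ⟨n, rfl⟩))
    | sum k n f hn hfK hR =>
      refine le_trans ?_ (hu (Or.inr ⟨k, n, _, hn, hR, rfl⟩))
      rw [pairing_smul_sum]
      refine mul_le_mul_of_nonneg_left (Finset.sum_le_sum fun i _ => ?_) (hθ k).1.le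
      rw [show pairing (f i) x = pairing (f i) (x.filter (· ∈ (f i).support)) by
        rw [← pairing_filter]
        congr 1
        exact (Finsupp.filter_eq_self_iff _ _ |>.2 fun a ha =>
          Finsupp.mem_support_iff.2 ha).symm]
      exact K.pairing_le (hfK i) _

/-- A seminorm is determined by the implicit equation, if `θ k → 0`. -/
theorem implicit_unique (M : ℕ+ → Set (Finset ℕ+)) (θ : ℕ+ → ℝ)
    (hθ : ∀ k, θ k ∈ Set.Ioo (0 : ℝ) 1) (hlim : Tendsto θ atTop (𝓝 0))
    (N N' : Seminorm ℝ (ℕ+ →₀ ℝ)) (hN : ∀ x, IsLUB (implicitSet M θ N x) (N x))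
    (hN' : ∀ x, IsLUB (implicitSet M θ N' x) (N' x)) : N = N' := by
  obtain ⟨c, hc1, hc⟩ : ∃ c < 1, ∀ k, θ k ≤ c := by
    obtain ⟨k₀, hk₀⟩ := eventually_atTop.1
      (hlim.eventually_le_const (show (0 : ℝ) < 1 / 2 by norm_num))
    obtain ⟨j, -, hj⟩ := Finset.exists_max_image (Finset.Iic k₀) θ ⟨k₀, by simp⟩
    refine ⟨max (1 / 2) (θ j), max_lt (by norm_num) (hθ j).2, fun k => ?_⟩
    rcases le_total k k₀ with h | h
    · exact (hj k (by simpa using h)).trans (le_max_right _ _)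
    · exact (hk₀ k h).trans (le_max_left _ _)
  have key : ∀ (N N' : Seminorm ℝ (ℕ+ →₀ ℝ)) (_ : ∀ x, IsLUB (implicitSet M θ N x) (N x))
      (_ : ∀ x, IsLUB (implicitSet M θ N' x) (N' x)) (x : ℕ+ →₀ ℝ)
      (_ : ∀ y : ℕ+ →₀ ℝ, y.support.card < x.support.card → N y = N' y), N x ≤ N' x := by
    intro N N' hN hN' x ih
    have hmax : N x ≤ max (N' x) (c * N x) := by
      refine (hN x).2 ?_
      rintro r (⟨n, rfl⟩ | ⟨k, n, E, hn, hE, rfl⟩)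
      · exact ((hN' x).1 (Or.inl ⟨n, rfl⟩)).trans (le_max_left _ _)
      by_cases h : ∃ i, x.filter (· ∈ E i) = x
      · obtain ⟨i, hi⟩ := h
        refine le_trans ?_ (le_max_right _ _)
        rw [Finset.sum_eq_single i, hi]
        · exact mul_le_mul_of_nonneg_right (hc k) (apply_nonneg N x)
        · intro j _ hj
          have : x.filter (· ∈ E j) = 0 := by
            ext a
            by_cases ha : a ∈ E j
            · have ha' : a ∉ E i := Finset.disjoint_left.1 (hE.disjoint hj) ha
              have hz : x a = 0 := by
                rw [← hi]; exact Finsupp.filter_apply_neg _ _ ha'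
              simp [Finsupp.filter_apply, hz]
            · simp [ha]
          rw [this, map_zero]
        · simp
      · push Not at h
        refine le_trans ?_ (le_max_left _ _)
        have : ∀ i, N (x.filter (· ∈ E i)) = N' (x.filter (· ∈ E i)) := by
          intro i
          refine ih _ (Finset.card_lt_card (Finset.ssubset_iff_subset_ne.2 ⟨?_, fun he => ?_⟩))
          · rw [Finsupp.support_filter]; exact Finset.filter_subset _ _
          · refine h i (Finsupp.filter_eq_self_iff _ _ |>.2 fun a ha => ?_)
            have : a ∈ (x.filter (· ∈ E i)).support := by
              rw [he]; exact Finsupp.mem_support_iff.2 ha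
            rw [Finsupp.support_filter] at this
            exact (Finset.mem_filter.1 this).2
        simp only [this]
        exact (hN' x).1 (Or.inr ⟨k, n, E, hn, hE, rfl⟩)
    rcases le_max_iff.1 hmax with h | h
    · exact h
    · have h0 : 0 ≤ N x := apply_nonneg N x
      have : N x ≤ 0 := by nlinarith
      exact this.trans (apply_nonneg N' x)
  have : ∀ (m : ℕ) (x : ℕ+ →₀ ℝ), x.support.card = m → N x = N' x := by
    intro m
    induction m using Nat.strong_induction_on with
    | _ m ih =>
      rintro x rfl
      exact le_antisymm (key N N' hN hN' x fun y hy => ih _ hy y rfl)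
        (key N' N hN' hN x fun y hy => (ih _ hy y rfl).symm)
  exact Seminorm.ext fun x => this _ x rfl

/-- The mixed Tsirelson norm is the only seminorm that satisfies the implicit equation. -/
theorem mixedNormingSet_unique (M : ℕ+ → Set (Finset ℕ+)) (θ : ℕ+ → ℝ)
    (hθ : ∀ k, θ k ∈ Set.Ioo (0 : ℝ) 1) (hlim : Tendsto θ atTop (𝓝 0))
    (hh : ∀ k, Hereditary (M k)) (hs : ∀ k, Spreading (M k))
    (N : Seminorm ℝ (ℕ+ →₀ ℝ)) (hN : ∀ x, IsLUB (implicitSet M θ N x) (N x)) (x : ℕ+ →₀ ℝ) :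
    N x = (mixedNormingSet M θ hθ).norm x := by
  have h := implicit_unique M θ hθ hlim N
    (Seminorm.of (mixedNormingSet M θ hθ).norm (NormingSet.norm_add_le _) fun c x =>
      NormingSet.norm_smul _ c x) hN
    (mixedNormingSet_isLUB M θ hθ hh hs)
  rw [h]; rfl

/-! ### Regular sequences and total incomparability -/

/-- `θ k ∈ (0, 1)`, `θ` decreases to zero, and `θ (n + m) ≥ θ n * θ m`. -/
structure RegularSequence (θ : ℕ+ → ℝ) : Prop where
  mem_Ioo : ∀ k, θ k ∈ Set.Ioo (0 : ℝ) 1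
  antitone : Antitone θ
  tendsto_zero : Tendsto θ atTop (𝓝 0)
  mul_le : ∀ n m, θ n * θ m ≤ θ (n + m)

/-- No infinite-dimensional closed subspace of `X` is isomorphic to a closed subspace of `Y`. -/
def TotallyIncomparable (X Y : Type*) [NormedAddCommGroup X] [NormedSpace ℝ X]
    [NormedAddCommGroup Y] [NormedSpace ℝ Y] : Prop :=
  ∀ (V : Submodule ℝ X) (W : Submodule ℝ Y), IsClosed (V : Set X) → IsClosed (W : Set Y) →
    ¬ FiniteDimensional ℝ V → IsEmpty (V ≃L[ℝ] W)

end Tsirelson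

namespace Tsirelson

open Filter Topology

/-! ### Combinatorics of the Schreier families -/

/-! Two properties clash. In X, any n disjointly supported vectors living beyond n satisfy a lower
ℓ₁-estimate with constant θ₁, because their supports form an F₁-allowable family
(`disjointLower_normingSet`). In T only successive sets may be added, and every block subspace
contains, for each n, n disjointly supported vectors of norm at least 1 whose sum has norm at most
18 (`exists_disjoint_bounded`). An isomorphism of infinite-dimensional subspaces yields, by a
gliding hump and a perturbation, equivalent block sequences in the two spaces
(`exists_equivalent_blocks`). Transporting the n vectors keeps their supports disjoint, which is
impossible for large n.

The work lies in T. The root condition says that the weights decay more slowly than any geometric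
sequence, and it enters twice. First, every block subspace contains normalized vectors with bounded
admissible splittings up to a given order j (`exists_splitBound`): otherwise repeated averaging and
normalizing would double a lower ℓ₁-estimate each time the order grows by j, which forces geometric
decay. Such vectors form rapidly increasing sequences (y_i). Second, there are orders σ₀ < σ₁ < …
with θ_{σ_{g+1}} ≤ θ_{σ_g}/n and θ_{σ_{g+1}-σ_g} ≤ 2θ_{σ_{g+1}} (`exists_orders`).

The vectors are u_s = θ_{σ_s}⁻¹ ∑ b_s(i) y_i, where the b_s are special convex combinations of order
σ_s with disjoint supports. They are interlaced: the indices fall into successive cells, and all b_s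
give the same mass c_p to the cell p (`IsBlock.exists_cell_averages`). The lower bound for u_s is
the F_{σ_s}-estimate. For the upper bound a functional is followed along its tree
(`Norming.cellAnalysis`). Since the sets at each node are successive, outside a negligible set of
cells the chains of weights leading to the vectors of a cell share an initial part of total order τ
≥ σ₀. Up to small errors u_s then contributes at most 4c_p θ_τ θ_{σ_s-τ}/θ_{σ_s} on that cell. The
quotient is at most 1 for the two indices s next to τ and at most 2/n for the others
(`sum_weight_div_le`), so on each cell a functional can be efficient for two of the n vectors only.
-/

theorem singleton_mem_schreier_zero (n : ℕ+) : {n} ∈ schreier 0 := Or.inr ⟨n, rfl⟩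

/-- Dropping the empty sets only lowers their number, so the bound by `n` still suffices. Later
constructions need not check non-emptiness. -/
theorem biUnion_mem_schreier_succ {k n : ℕ} {B : Fin n → Finset ℕ+} (hB : ∀ i, B i ∈ schreier k)
    (hle : ∀ i, ∀ a ∈ B i, n ≤ (a : ℕ)) (hs : Successive B) :
    Finset.univ.biUnion B ∈ schreier (k + 1) := by
  by_cases h : ∃ i, (B i).Nonempty
  · obtain ⟨m, e, hm, he, h1, h2⟩ := exists_reindex (fun i => (B i).Nonempty) h
    have hmn : m ≤ n := by simpa using Fintype.card_le_of_injective e he.injective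
    refine Or.inr ⟨m, fun j => B (e j), hm, fun j => hB _, h1, fun j a ha => hmn.trans (hle _ _ ha),
      fun i j hij => hs _ _ (he hij), ?_⟩
    ext a
    simp only [Finset.mem_biUnion, Finset.mem_univ, true_and]
    refine ⟨fun ⟨i, hi⟩ => ?_, fun ⟨j, hj⟩ => ⟨_, hj⟩⟩
    obtain ⟨j, rfl⟩ := h2 i ⟨a, hi⟩
    exact ⟨j, hi⟩
  · push Not at h
    left
    exact Finset.eq_empty_of_forall_notMem fun a ha => by
      obtain ⟨i, -, hi⟩ := Finset.mem_biUnion.1 ha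
      simp [h i] at hi

theorem schreier_subset_succ (k : ℕ) : schreier k ⊆ schreier (k + 1) := by
  intro A hA
  -- One set is enough, because every element of `ℕ+` is at least 1.
  have := biUnion_mem_schreier_succ (k := k) (n := 1) (B := fun _ => A) (fun _ => hA)
    (fun _ a _ => a.2) (fun i j hij => absurd hij (by simp [Subsingleton.elim i j]))
  simpa using this

theorem schreier_mono : Monotone schreier := monotone_nat_of_le_succ schreier_subset_succ

theorem singleton_mem_schreier (k : ℕ) (n : ℕ+) : {n} ∈ schreier k :=
  schreier_mono (Nat.zero_le k) (singleton_mem_schreier_zero n)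

/-- The members of the convolution of two Schreier families. -/
theorem biUnion_mem_schreier_add {k r : ℕ} {A : Finset ℕ+} (hA : A ∈ schreier k)
    {G : ℕ+ → Finset ℕ+} (hG : ∀ a ∈ A, G a ∈ schreier r) (hle : ∀ a ∈ A, ∀ x ∈ G a, a ≤ x)
    (hs : ∀ a ∈ A, ∀ b ∈ A, a < b → ∀ x ∈ G a, ∀ y ∈ G b, x < y) :
    A.biUnion G ∈ schreier (k + r) := by
  induction k generalizing A with
  | zero =>
    rw [zero_add]
    rcases hA with hA | ⟨n, rfl⟩
    · rw [Set.mem_singleton_iff.1 hA]; exact schreier_empty r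
    · simpa using hG n (by simp)
  | succ k ih =>
    rcases hA with hA | ⟨n, B, hn, hB, hne, hge, hsB, rfl⟩
    · rw [Set.mem_singleton_iff.1 hA]; exact schreier_empty _
    have hsub : ∀ i, ∀ a ∈ B i, a ∈ Finset.univ.biUnion B := fun i a ha =>
      Finset.mem_biUnion.2 ⟨i, Finset.mem_univ i, ha⟩
    -- The outermost union is kept: the elements of `G a` are at least `a`, so the bound from below
    -- on `B i` passes to the new sets.
    rw [Finset.biUnion_biUnion, show k + 1 + r = k + r + 1 by ring]
    refine biUnion_mem_schreier_succ (fun i => ih (hB i) (fun a ha => hG a (hsub i a ha))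
      (fun a ha => hle a (hsub i a ha)) fun a ha b hb => hs a (hsub i a ha) b (hsub i b hb)) ?_ ?_
    · intro i x hx
      obtain ⟨a, ha, hx⟩ := Finset.mem_biUnion.1 hx
      exact (hge i a ha).trans (PNat.coe_le_coe _ _ |>.2 (hle a (hsub i a ha) x hx))
    · intro i j hij x hx y hy
      obtain ⟨a, ha, hx⟩ := Finset.mem_biUnion.1 hx
      obtain ⟨b, hb, hy⟩ := Finset.mem_biUnion.1 hy
      exact hs a (hsub i a ha) b (hsub j b hb) (hsB i j hij a ha b hb) x hx y hy

/-- Transfers the convolution property to index sets whose elements are represented by increasing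
markers `Λ p`. -/
theorem biUnion_mem_schreier_add_of_strictMono {ι : Type*} [LinearOrder ι] {k r : ℕ} {Λ : ι → ℕ+}
    (hΛ : StrictMono Λ) {Q : Finset ι} (hQ : Q.image Λ ∈ schreier k) {G : ι → Finset ℕ+}
    (hG : ∀ p ∈ Q, G p ∈ schreier r) (hle : ∀ p ∈ Q, ∀ x ∈ G p, Λ p ≤ x)
    (hs : ∀ p ∈ Q, ∀ q ∈ Q, p < q → ∀ x ∈ G p, ∀ y ∈ G q, x < y) :
    Q.biUnion G ∈ schreier (k + r) := by
  classical
  let G' : ℕ+ → Finset ℕ+ := Function.extend Λ G fun _ => ∅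
  have hG' : ∀ p, G' (Λ p) = G p := fun p => hΛ.injective.extend_apply G _ p
  have key := biUnion_mem_schreier_add (G := G') (r := r) hQ ?_ ?_ ?_
  · rw [Finset.image_biUnion] at key
    simpa only [hG'] using key
  · intro a ha
    obtain ⟨p, hp, rfl⟩ := Finset.mem_image.1 ha
    rw [hG']; exact hG p hp
  · intro a ha x hx
    obtain ⟨p, hp, rfl⟩ := Finset.mem_image.1 ha
    rw [hG'] at hx
    exact hle p hp x hx
  · intro a ha b hb hab x hx y hy
    obtain ⟨p, hp, rfl⟩ := Finset.mem_image.1 ha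
    obtain ⟨q, hq, rfl⟩ := Finset.mem_image.1 hb
    rw [hG'] at hx hy
    exact hs p hp q hq (hΛ.lt_iff_lt.1 hab) x hx y hy

theorem Admissible.min'_strictMono {M : Set (Finset ℕ+)} {n : ℕ} {E : Fin n → Finset ℕ+}
    (hE : Admissible M E) : StrictMono fun i => (E i).min' (hE.1 i) := fun i j hij =>
  hE.2.1 i j hij _ (Finset.min'_mem _ _) _ (Finset.min'_mem _ _)

theorem Admissible.biUnion_mem_schreier {d k r : ℕ} {E G : Fin d → Finset ℕ+}
    (hE : Admissible (schreier k) E) (hG : ∀ l, G l ∈ schreier r)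
    (hle : ∀ l, ∀ x ∈ G l, ∃ a ∈ E l, a ≤ x) (hs : Successive G) :
    Finset.univ.biUnion G ∈ schreier (k + r) := by
  exact biUnion_mem_schreier_add_of_strictMono hE.min'_strictMono hE.2.2 (fun l _ => hG l)
    (fun l _ x hx => let ⟨a, ha, hax⟩ := hle l x hx; (Finset.min'_le _ _ ha).trans hax)
    fun i _ j _ => hs i j

/-! ### Sets covered by finitely many members of a Schreier family -/

/-- `A` is covered by `m` members of `schreier r`. -/
def Covered (m r : ℕ) (A : Finset ℕ+) : Prop :=
  ∃ B : Fin m → Finset ℕ+, (∀ a, B a ∈ schreier r) ∧ A ⊆ Finset.univ.biUnion B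

theorem Covered.of_mem {r : ℕ} {A : Finset ℕ+} (h : A ∈ schreier r) : Covered 1 r A :=
  ⟨fun _ => A, fun _ => h, fun a ha => by simpa using ha⟩

theorem Covered.empty (m r : ℕ) : Covered m r ∅ :=
  ⟨fun _ => ∅, fun _ => schreier_empty r, Finset.empty_subset _⟩

theorem Covered.subset {m r : ℕ} {A A' : Finset ℕ+} (h : Covered m r A) (hA : A' ⊆ A) :
    Covered m r A' :=
  let ⟨B, hB, hAB⟩ := h
  ⟨B, hB, hA.trans hAB⟩

theorem Covered.union {m m' r : ℕ} {A A' : Finset ℕ+} (h : Covered m r A)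
    (h' : Covered m' r A') : Covered (m + m') r (A ∪ A') := by
  obtain ⟨B, hB, hAB⟩ := h
  obtain ⟨B', hB', hAB'⟩ := h'
  refine ⟨Fin.append B B', fun a => ?_, Finset.union_subset ?_ ?_⟩
  · refine Fin.addCases (fun i => ?_) (fun i => ?_) a
    · rw [Fin.append_left]; exact hB i
    · rw [Fin.append_right]; exact hB' i
  · intro x hx
    obtain ⟨i, -, hi⟩ := Finset.mem_biUnion.1 (hAB hx)
    exact Finset.mem_biUnion.2 ⟨Fin.castAdd _ i, Finset.mem_univ _, by rwa [Fin.append_left]⟩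
  · intro x hx
    obtain ⟨i, -, hi⟩ := Finset.mem_biUnion.1 (hAB' hx)
    exact Finset.mem_biUnion.2 ⟨Fin.natAdd _ i, Finset.mem_univ _, by rwa [Fin.append_right]⟩

theorem Covered.mono {m m' r r' : ℕ} {A : Finset ℕ+} (h : Covered m r A) (hm : m ≤ m')
    (hr : r ≤ r') : Covered m' r' A := by
  have h' : Covered m r' A :=
    let ⟨B, hB, hAB⟩ := h
    ⟨B, fun a => schreier_mono hr (hB a), hAB⟩
  have := h'.union (Covered.empty (m' - m) r')
  rwa [Nat.add_sub_cancel' hm, Finset.union_empty] at this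

/-- The number `m` does not grow: for each `a`, the `a`-th covering sets for all `l` are merged into
one member of the convolution. -/
theorem Covered.iUnion_of_admissible {d k r m : ℕ} {E : Fin d → Finset ℕ+}
    (hE : Admissible (schreier k) E) {T : ℕ → ℕ+} (hT : StrictMono T) {H : Fin d → Finset ℕ}
    (hEH : ∀ l, ∀ o ∈ H l, ∃ a ∈ E l, a ≤ T o)
    (hH : ∀ l l', l < l' → ∀ o ∈ H l, ∀ o' ∈ H l', o < o')
    (hc : ∀ l, Covered m r ((H l).image T)) :
    Covered m (k + r) ((Finset.univ.biUnion H).image T) := by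
  choose B hB hsub using hc
  -- Covering sets for different `l` may overlap; cutting them down to the sets that they cover
  -- makes them successive.
  refine ⟨fun a => Finset.univ.biUnion fun l => B l a ∩ (H l).image T, fun a => ?_, ?_⟩
  · refine hE.biUnion_mem_schreier
      (fun l => schreier_hereditary r _ (hB l a) _ Finset.inter_subset_left) ?_ ?_
    · intro l x hx
      obtain ⟨o, ho, rfl⟩ := Finset.mem_image.1 (Finset.mem_inter.1 hx).2
      exact hEH l o ho
    · intro l l' hl x hx y hy
      obtain ⟨o, ho, rfl⟩ := Finset.mem_image.1 (Finset.mem_inter.1 hx).2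
      obtain ⟨o', ho', rfl⟩ := Finset.mem_image.1 (Finset.mem_inter.1 hy).2
      exact hT (hH l l' hl o ho o' ho')
  · intro x hx
    obtain ⟨o, ho, rfl⟩ := Finset.mem_image.1 hx
    obtain ⟨l, -, hl⟩ := Finset.mem_biUnion.1 ho
    have hx' := Finset.mem_image_of_mem T hl
    obtain ⟨a, -, ha⟩ := Finset.mem_biUnion.1 (hsub l hx')
    exact Finset.mem_biUnion.2 ⟨a, Finset.mem_univ a,
      Finset.mem_biUnion.2 ⟨l, Finset.mem_univ l, Finset.mem_inter.2 ⟨ha, hx'⟩⟩⟩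

/-- Of successive sets `D o`, those that are met by two members of an admissible family have
positions which form a member of the Schreier family. -/
theorem Covered.of_split {d k : ℕ} {E : Fin d → Finset ℕ+} (hE : Admissible (schreier k) E)
    {D : ℕ → Set ℕ+} (hD : ∀ o o', o < o' → ∀ a ∈ D o, ∀ b ∈ D o', a < b)
    {T : ℕ → ℕ+} (hT : StrictMono T) (hDT : ∀ o, ∀ a ∈ D o, a ≤ T o) {H : Finset ℕ}
    (hH : ∀ o ∈ H, ∃ l l', l < l' ∧ (∃ a ∈ E l, a ∈ D o) ∧ ∃ a ∈ E l', a ∈ D o) :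
    Covered 1 k (H.image T) := by
  classical
  rcases H.eq_empty_or_nonempty with rfl | ⟨o₀, ho₀⟩
  · exact Covered.empty _ _
  have : Nonempty (Fin d) := ⟨(hH o₀ ho₀).choose⟩
  choose! l l' hll hl hl' using hH
  -- The last common member can be shared with the next set only as its first one, so `l' o ≤ l o' <
  -- l' o'`. Hence each member of the family is charged with at most one position.
  have hmono : ∀ o ∈ H, ∀ o' ∈ H, o < o' → l' o < l' o' := by
    intro o ho o' ho' h
    refine lt_of_le_of_lt (not_lt.1 fun hlt => ?_) (hll o' ho')
    obtain ⟨a, ha, haD⟩ := hl' o ho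
    obtain ⟨b, hb, hbD⟩ := hl o' ho'
    exact lt_asymm (hD o o' h a haD b hbD) (hE.2.1 _ _ hlt b hb a ha)
  have key := Covered.iUnion_of_admissible (m := 1) (r := 0) hE hT
    (H := fun i => H.filter fun o => l' o = i) ?_ ?_ ?_
  · refine key.subset (Finset.image_subset_image fun o ho => ?_)
    exact Finset.mem_biUnion.2 ⟨l' o, Finset.mem_univ _, Finset.mem_filter.2 ⟨ho, rfl⟩⟩
  · intro i o ho
    obtain ⟨hoH, rfl⟩ := Finset.mem_filter.1 ho
    obtain ⟨a, ha, haD⟩ := hl' o hoH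
    exact ⟨a, ha, hDT o a haD⟩
  · intro i j hij o ho o' ho'
    obtain ⟨hoH, rfl⟩ := Finset.mem_filter.1 ho
    obtain ⟨hoH', rfl⟩ := Finset.mem_filter.1 ho'
    by_contra hlt
    rcases (not_lt.1 hlt).eq_or_lt with h | h
    · subst h; exact lt_irrefl _ hij
    · exact lt_asymm hij (hmono _ hoH' _ hoH h)
  · intro i
    have hsub : ∀ o ∈ H.filter (fun o => l' o = i), ∀ o' ∈ H.filter (fun o => l' o = i),
        o = o' := by
      intro o ho o' ho'
      obtain ⟨ho, h⟩ := Finset.mem_filter.1 ho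
      obtain ⟨ho', h'⟩ := Finset.mem_filter.1 ho'
      rcases lt_trichotomy o o' with hlt | heq | hlt
      · exact absurd (h.trans h'.symm) (hmono _ ho _ ho' hlt).ne
      · exact heq
      · exact absurd (h'.trans h.symm) (hmono _ ho' _ ho hlt).ne
    rcases (H.filter fun o => l' o = i).eq_empty_or_nonempty with h0 | ⟨o, ho⟩
    · rw [h0]; exact Covered.empty _ _
    · refine (Covered.of_mem (singleton_mem_schreier_zero (T o))).subset fun x hx => ?_
      obtain ⟨o', ho', rfl⟩ := Finset.mem_image.1 hx
      rw [hsub o' ho' o ho]; simp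

/-! ### Special convex combinations -/

/-- The sums of `μ` over members of Schreier families of order less than `r` are at most `η`. -/
def SmallOn (μ : ℕ+ →₀ ℝ) (r : ℕ) (η : ℝ) : Prop :=
  ∀ k < r, ∀ A ∈ schreier k, ∑ a ∈ A, μ a ≤ η

theorem sum_biUnion_le {ι κ : Type*} [DecidableEq κ] {f : κ → ℝ} (hf : ∀ a, 0 ≤ f a)
    (s : Finset ι) (B : ι → Finset κ) : ∑ a ∈ s.biUnion B, f a ≤ ∑ i ∈ s, ∑ a ∈ B i, f a := by
  classical
  induction s using Finset.induction_on with
  | empty => simp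
  | insert i s hi ih =>
    rw [Finset.biUnion_insert, Finset.sum_insert hi]
    have := Finset.sum_union_inter (s₁ := B i) (s₂ := s.biUnion B) (f := f)
    have h2 : 0 ≤ ∑ a ∈ B i ∩ s.biUnion B, f a := Finset.sum_nonneg fun a _ => hf a
    linarith

theorem SmallOn.covered {μ : ℕ+ →₀ ℝ} {r : ℕ} {η : ℝ} (h : SmallOn μ r η) (hμ : ∀ a, 0 ≤ μ a)
    {m k : ℕ} (hk : k < r) {A : Finset ℕ+} (hA : Covered m k A) : ∑ a ∈ A, μ a ≤ m * η := by
  obtain ⟨B, hB, hAB⟩ := hA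
  calc ∑ a ∈ A, μ a ≤ ∑ a ∈ Finset.univ.biUnion B, μ a :=
        Finset.sum_le_sum_of_subset_of_nonneg hAB fun a _ _ => hμ a
    _ ≤ ∑ i, ∑ a ∈ B i, μ a := sum_biUnion_le hμ _ _
    _ ≤ ∑ i : Fin m, η := Finset.sum_le_sum fun i _ => h k hk _ (hB i)
    _ = m * η := by simp

/-- At most one of the numbers exceeds `η`. -/
theorem sum_le_of_pairwise {n : ℕ} {x : ℕ → ℝ} {η : ℝ} (hη : 0 ≤ η) (h1 : ∀ g, x g ≤ 1)
    (h : ∀ g g', g < g' → η < x g → x g' ≤ η) : ∑ g ∈ Finset.range n, x g ≤ 1 + n * η := by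
  by_cases hx : ∃ g, g < n ∧ η < x g
  · obtain ⟨g, hg, hxg⟩ := hx
    rw [← Finset.add_sum_erase _ _ (Finset.mem_range.2 hg)]
    refine add_le_add (h1 g) ((Finset.sum_le_sum (g := fun _ => η) fun g' hg' => ?_).trans ?_)
    · rcases lt_or_gt_of_ne (Finset.ne_of_mem_erase hg') with hlt | hlt
      · by_contra hcon
        exact absurd (h g' g hlt (not_le.1 hcon)) (not_le.2 hxg)
      · exact h g g' hlt hxg
    · rw [Finset.sum_const, nsmul_eq_mul]
      refine mul_le_mul_of_nonneg_right ?_ hη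
      exact_mod_cast (Finset.card_le_card (Finset.erase_subset _ _)).trans (by simp)
  · push Not at hx
    have : ∑ g ∈ Finset.range n, x g ≤ ∑ g ∈ Finset.range n, η :=
      Finset.sum_le_sum fun g hg => hx g (Finset.mem_range.1 hg)
    simp at this
    linarith

/-- Iterated averaging. One step takes the mean of `n` successive averages of order `m`, each chosen
small relative to the positions already used. A set in a Schreier family that meets an early average
is a union of few sets of the lower order, few meaning at most the size of that position, so every
later average has small mass on it. The same coefficients `c` serve all families `β i` at once, each
gaining `m` orders. -/
theorem exists_average {ι : Type*} {Λ T : ℕ → ℕ+} (hΛT : ∀ p, Λ p ≤ T p)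
    (hTΛ : ∀ p, T p < Λ (p + 1)) (r : ι → ℕ) (β : ι → ℕ → ℕ+ →₀ ℝ) (hβ0 : ∀ i p a, 0 ≤ β i p a)
    (hβ1 : ∀ i p (A : Finset ℕ+), ∑ a ∈ A, β i p a ≤ 1)
    (hβs : ∀ i p a, β i p a ≠ 0 → Λ p ≤ a ∧ a ≤ T p)
    (hsmall : ∀ η > 0, ∃ p₀, ∀ p ≥ p₀, ∀ i, SmallOn (β i p) (r i) η) (m : ℕ) :
    ∀ η > 0, ∀ p₀ : ℕ, ∃ c : ℕ →₀ ℝ, (∀ p, 0 ≤ c p) ∧ c.sum (fun _ x => x) = 1 ∧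
      (∀ p ∈ c.support, p₀ ≤ p) ∧ c.support.image Λ ∈ schreier m ∧
      ∀ i, SmallOn (Finsupp.linearCombination ℝ (β i) c) (m + r i) η := by
  classical
  have hΛ : StrictMono Λ := strictMono_nat_of_lt_succ fun p => (hΛT p).trans_lt (hTΛ p)
  have hT : StrictMono T := strictMono_nat_of_lt_succ fun p => (hTΛ p).trans_le (hΛT _)
  have hTΛ' : ∀ p q, p < q → T p < Λ q := fun p q h => (hTΛ p).trans_le (hΛ.monotone h)
  have hΛge : ∀ p, p < (Λ p : ℕ) := fun p => by
    induction p with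
    | zero => exact (Λ 0).2
    | succ p ih => exact lt_of_le_of_lt ih (PNat.coe_lt_coe _ _ |>.2 (hΛ (Nat.lt_succ_self p)))
  induction m with
  | zero =>
    intro η hη p₀
    obtain ⟨p₁, hp₁⟩ := hsmall η hη
    refine ⟨Finsupp.single (max p₀ p₁) 1, fun p => ?_, by simp, ?_, ?_, fun i => ?_⟩
    · rw [Finsupp.single_apply]; split_ifs <;> norm_num
    · intro p hp
      rw [Finset.mem_singleton.1 (Finsupp.support_single_subset hp)]
      exact le_max_left _ _
    · rw [Finsupp.support_single _ one_ne_zero, Finset.image_singleton]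
      exact singleton_mem_schreier_zero _
    · rw [Finsupp.linearCombination_single, one_smul, zero_add]
      exact hp₁ _ (le_max_right _ _) i
  | succ m ih =>
    intro η hη p₀
    -- One average may have full mass on the given set and the others at most `η / 2`, so the mean
    -- is at most `1 / n + η / 2 ≤ η`.
    obtain ⟨n, hn⟩ := exists_nat_gt (2 / η)
    have hn0 : (0 : ℝ) < n := lt_trans (by positivity) hn
    have hnη : 1 + n * (η / 2) ≤ n * η := by
      rw [div_lt_iff₀ hη] at hn; linarith
    have hη' : ∀ P : ℕ, 0 < η / 2 / (T P : ℕ) := fun P => by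
      have : (0 : ℝ) < (T P : ℕ) := by exact_mod_cast (T P).2
      positivity
    choose F hF0 hF1 hFP hFΛ hFs using fun P => ih _ (hη' P) P
    -- Starting beyond `n` gives the Schreier condition for a union of `n` sets, since `p < Λ p`.
    let P : ℕ → ℕ := fun g => Nat.rec (max p₀ n) (fun _ P => (F P).support.sup id + 1) g
    have hPs : ∀ g, P (g + 1) = (F (P g)).support.sup id + 1 := fun g => rfl
    have hsupp : ∀ g, ∀ p ∈ (F (P g)).support, P g ≤ p ∧ p < P (g + 1) := fun g p hp =>
      ⟨hFP _ p hp, by rw [hPs]; exact Nat.lt_succ_of_le (Finset.le_sup (f := id) hp)⟩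
    have hne : ∀ g, (F (P g)).support.Nonempty := fun g => by
      rw [Finsupp.support_nonempty_iff]
      intro h0
      have := hF1 (P g)
      rw [h0] at this
      simp at this
    have hP : StrictMono P := strictMono_nat_of_lt_succ fun g => by
      obtain ⟨p, hp⟩ := hne g
      exact (hsupp g p hp).1.trans_lt (hsupp g p hp).2
    have hdisj : ∀ g g', g < g' → ∀ p ∈ (F (P g)).support, ∀ p' ∈ (F (P g')).support, p < p' :=
      fun g g' hg p hp p' hp' =>
        (hsupp g p hp).2.trans_le ((hP.monotone hg).trans (hsupp g' p' hp').1)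
    set c : ℕ →₀ ℝ := (n : ℝ)⁻¹ • ∑ g ∈ Finset.range n, F (P g) with hc
    have hcsub : ∀ p ∈ c.support, ∃ g < n, p ∈ (F (P g)).support := by
      intro p hp
      by_contra hcon
      push Not at hcon
      refine (Finsupp.mem_support_iff.1 hp) ?_
      rw [hc, Finsupp.smul_apply, Finsupp.finsetSum_apply, Finset.sum_eq_zero, smul_zero]
      exact fun g hg => Finsupp.notMem_support_iff.1 (hcon g (Finset.mem_range.1 hg))
    refine ⟨c, fun p => ?_, ?_, fun p hp => ?_, ?_, fun i => ?_⟩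
    · rw [hc, Finsupp.smul_apply, Finsupp.finsetSum_apply, smul_eq_mul]
      exact mul_nonneg (by positivity) (Finset.sum_nonneg fun g _ => hF0 _ p)
    · have hsum : ∀ d : ℕ →₀ ℝ, d.sum (fun _ x => x) =
          Finsupp.linearCombination ℝ (fun _ => (1 : ℝ)) d := fun d => by
        simp [Finsupp.linearCombination_apply]
      rw [hsum, hc, map_smul, map_sum]
      simp_rw [← hsum, hF1]
      simp [hn0.ne']
    · obtain ⟨g, -, hg⟩ := hcsub p hp
      exact (le_max_left _ _).trans ((hP.monotone (Nat.zero_le g)).trans (hsupp g p hg).1)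
    · refine schreier_hereditary _ _ (biUnion_mem_schreier_succ (n := n)
        (B := fun g => (F (P g)).support.image Λ) (fun g => hFΛ _) ?_ ?_) _ ?_
      · intro g a ha
        obtain ⟨p, hp, rfl⟩ := Finset.mem_image.1 ha
        have h1 : n ≤ p := (le_max_right p₀ n).trans
          ((hP.monotone (Nat.zero_le (g : ℕ))).trans (hsupp g p hp).1)
        exact h1.trans (hΛge p).le
      · intro g g' hg a ha b hb
        obtain ⟨p, hp, rfl⟩ := Finset.mem_image.1 ha
        obtain ⟨p', hp', rfl⟩ := Finset.mem_image.1 hb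
        exact hΛ (hdisj g g' hg p hp p' hp')
      · intro a ha
        obtain ⟨p, hp, rfl⟩ := Finset.mem_image.1 ha
        obtain ⟨g, hg, hpg⟩ := hcsub p hp
        exact Finset.mem_biUnion.2 ⟨⟨g, hg⟩, Finset.mem_univ _, Finset.mem_image_of_mem _ hpg⟩
    · intro k hk A hA
      set μ : ℕ → ℕ+ →₀ ℝ := fun g => Finsupp.linearCombination ℝ (β i) (F (P g)) with hμ
      have hμa : ∀ g a, μ g a = ∑ p ∈ (F (P g)).support, F (P g) p * β i p a := fun g a => by
        simp [hμ, Finsupp.linearCombination_apply, Finsupp.sum, Finsupp.finsetSum_apply]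
      have hμ0 : ∀ g a, 0 ≤ μ g a := fun g a => by
        rw [hμa]; exact Finset.sum_nonneg fun p _ => mul_nonneg (hF0 _ p) (hβ0 i p a)
      have hμs : ∀ g a, μ g a ≠ 0 → ∃ p ∈ (F (P g)).support, Λ p ≤ a ∧ a ≤ T p := fun g a h => by
        rw [hμa] at h
        obtain ⟨p, hp, hpa⟩ := Finset.exists_ne_zero_of_sum_ne_zero h
        exact ⟨p, hp, hβs i p a (right_ne_zero_of_mul hpa)⟩
      have hμ1 : ∀ g, ∑ a ∈ A, μ g a ≤ 1 := fun g => by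
        simp_rw [hμa]
        rw [Finset.sum_comm, ← hF1 (P g), Finsupp.sum]
        refine Finset.sum_le_sum fun p _ => ?_
        rw [← Finset.mul_sum]
        exact mul_le_of_le_one_right (hF0 _ p) (hβ1 i p A)
      have hlin : ∑ a ∈ A, (Finsupp.linearCombination ℝ (β i) c) a =
          (n : ℝ)⁻¹ * ∑ g ∈ Finset.range n, ∑ a ∈ A, μ g a := by
        rw [hc, map_smul, map_sum, Finset.sum_comm, Finset.mul_sum]
        exact Finset.sum_congr rfl fun a _ => by
          rw [Finsupp.smul_apply, Finsupp.finsetSum_apply, smul_eq_mul]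
      rw [hlin, inv_mul_le_iff₀ hn0]
      refine le_trans (sum_le_of_pairwise (half_pos hη).le hμ1 fun g g' hg hgA => ?_) hnη
      obtain ⟨a, haA, ha⟩ := Finset.exists_ne_zero_of_sum_ne_zero
        ((half_pos hη).trans hgA).ne'
      obtain ⟨p, hp, -, hap⟩ := hμs g a ha
      by_contra hcon
      rw [not_le] at hcon
      obtain ⟨b, hbA, hb⟩ := Finset.exists_ne_zero_of_sum_ne_zero
        ((half_pos hη).trans hcon).ne'
      obtain ⟨q, hq, hbq, -⟩ := hμs g' b hb
      have hab : a < b := hap.trans_lt ((hTΛ' p q (hdisj g g' hg p hp q hq)).trans_le hbq)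
      rcases k with _ | k
      · rcases hA with hA | ⟨x, rfl⟩
        · simp [Set.mem_singleton_iff.1 hA] at haA
        · rw [Finset.mem_singleton.1 haA, Finset.mem_singleton.1 hbA] at hab
          exact lt_irrefl _ hab
      · rcases hA with hA | ⟨d, B, hd, hB, -, hge, -, rfl⟩
        · simp [Set.mem_singleton_iff.1 hA] at haA
        refine absurd hcon (not_lt.2 ?_)
        -- The number of pieces is at most any element of the set, and one element lies in the
        -- earlier average `g`.
        have hda : d ≤ (T (P g') : ℕ) := by
          obtain ⟨e, -, he⟩ := Finset.mem_biUnion.1 haA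
          refine (hge e a he).trans (PNat.coe_le_coe _ _ |>.2 (hap.trans (hT.monotone ?_)))
          exact (hsupp g p hp).2.le.trans (hP.monotone hg)
        have hT0 : (0 : ℝ) < (T (P g') : ℕ) := by exact_mod_cast (T (P g')).2
        calc ∑ a ∈ Finset.univ.biUnion B, μ g' a ≤ ∑ e, ∑ a ∈ B e, μ g' a :=
              sum_biUnion_le (hμ0 g') _ _
          _ ≤ ∑ e : Fin d, η / 2 / (T (P g') : ℕ) :=
              Finset.sum_le_sum fun e _ => hFs (P g') i k (by omega) _ (hB e)
          _ = d * (η / 2 / (T (P g') : ℕ)) := by simp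
          _ ≤ (T (P g') : ℕ) * (η / 2 / (T (P g') : ℕ)) :=
              mul_le_mul_of_nonneg_right (by exact_mod_cast hda) (hη' _).le
          _ = η / 2 := by field_simp

/-! ### The weights -/

/-- The sequence `θ`, extended by `1` at zero. -/
noncomputable def weight (θ : ℕ+ → ℝ) (n : ℕ) : ℝ := if h : 0 < n then θ ⟨n, h⟩ else 1

section weight

variable {θ : ℕ+ → ℝ}

@[simp] theorem weight_zero : weight θ 0 = 1 := by simp [weight]

@[simp] theorem weight_coe (k : ℕ+) : weight θ k = θ k := by
  simp only [weight, k.pos, dif_pos]; rfl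

theorem weight_of_pos {n : ℕ} (h : 0 < n) : weight θ n = θ ⟨n, h⟩ := dif_pos h

theorem weight_pos (hθ : RegularSequence θ) (n : ℕ) : 0 < weight θ n := by
  unfold weight; split_ifs
  · exact (hθ.mem_Ioo _).1
  · exact one_pos

theorem weight_le_one (hθ : RegularSequence θ) (n : ℕ) : weight θ n ≤ 1 := by
  unfold weight; split_ifs
  · exact (hθ.mem_Ioo _).2.le
  · exact le_rfl

theorem weight_antitone (hθ : RegularSequence θ) : Antitone (weight θ) := by
  intro a b hab
  rcases Nat.eq_zero_or_pos a with rfl | ha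
  · rw [weight_zero]; exact weight_le_one hθ b
  · rw [weight_of_pos ha, weight_of_pos (ha.trans_le hab)]
    exact hθ.antitone (Subtype.mk_le_mk.2 hab)

theorem weight_mul_le (hθ : RegularSequence θ) (a b : ℕ) :
    weight θ a * weight θ b ≤ weight θ (a + b) := by
  rcases Nat.eq_zero_or_pos a with rfl | ha
  · simp
  rcases Nat.eq_zero_or_pos b with rfl | hb
  · simp
  rw [weight_of_pos ha, weight_of_pos hb, weight_of_pos (Nat.add_pos_left ha b)]
  exact hθ.mul_le ⟨a, ha⟩ ⟨b, hb⟩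

theorem exists_weight_lt (hθ : RegularSequence θ) {ε : ℝ} (hε : 0 < ε) (m : ℕ) :
    ∃ n ≥ m, weight θ n < ε := by
  obtain ⟨k, hk⟩ := eventually_atTop.1 (hθ.tendsto_zero.eventually_lt_const hε)
  obtain ⟨n, hn⟩ : ∃ n : ℕ, n = max m k := ⟨_, rfl⟩
  have hn0 : 0 < n := hn ▸ lt_max_of_lt_right k.2
  refine ⟨n, hn ▸ le_max_left _ _, ?_⟩
  lift n to ℕ+ using hn0
  rw [weight_coe]
  exact hk n (PNat.coe_le_coe _ _ |>.1 (hn ▸ le_max_right _ _))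

/-- The only form in which the root condition is used: the weights eventually exceed every geometric
sequence with ratio less than 1. -/
theorem eventually_pow_lt_weight
    (hlim : Tendsto (fun n : ℕ+ => θ n ^ (1 / ((n : ℕ) : ℝ))) atTop (𝓝 1))
    (hθ : RegularSequence θ) {x : ℝ} (hx0 : 0 ≤ x) (hx : x < 1) :
    ∃ m, ∀ n ≥ m, x ^ n < weight θ n := by
  obtain ⟨k, hk⟩ := eventually_atTop.1 (hlim.eventually_const_lt hx)
  refine ⟨k, fun n hn => ?_⟩
  have hn0 : 0 < n := k.pos.trans_le hn
  lift n to ℕ+ using hn0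
  rw [weight_coe]
  have h1 := hk n (PNat.coe_le_coe _ _ |>.1 hn)
  have h2 := pow_lt_pow_left₀ h1 hx0 n.ne_zero
  rwa [one_div, Real.rpow_inv_natCast_pow (hθ.mem_Ioo _).1.le n.ne_zero] at h2

/-- Bernoulli's inequality at `1 - 1 / (4 * r)`. Any bound above 1/2 would do, as it competes with a
factor 2 gained in every `r` steps. -/
theorem exists_three_quarters_le_pow {r : ℕ} (hr : 0 < r) :
    ∃ x : ℝ, 0 < x ∧ x < 1 ∧ 3 / 4 ≤ x ^ r := by
  have hr1 : (1 : ℝ) ≤ r := by exact_mod_cast hr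
  have hx4 : 1 / (4 * (r : ℝ)) ≤ 1 / 4 := by
    rw [div_le_div_iff₀ (by positivity) (by norm_num)]; linarith
  have hx0 : 0 < 1 / (4 * (r : ℝ)) := by positivity
  refine ⟨1 + -(1 / (4 * r)), by linarith, by linarith, ?_⟩
  calc (3 : ℝ) / 4 = 1 + r * -(1 / (4 * r)) := by field_simp; norm_num
    _ ≤ _ := one_add_mul_le_pow (by linarith) r

/-- The weights decrease slowly infinitely often. -/
theorem exists_weight_sub_le
    (hlim : Tendsto (fun n : ℕ+ => θ n ^ (1 / ((n : ℕ) : ℝ))) atTop (𝓝 1))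
    (hθ : RegularSequence θ) (r m : ℕ) : ∃ s ≥ m, weight θ (s - r) ≤ 2 * weight θ s := by
  rcases Nat.eq_zero_or_pos r with rfl | hr
  · exact ⟨m, le_rfl, by have := weight_pos hθ m; simp; linarith⟩
  -- Otherwise the weights are at least halved in every `r` steps from some point on, which is
  -- geometric decay.
  by_contra! hcon
  set M := m + r with hM
  have h1 : ∀ q : ℕ, weight θ (M + q * r) ≤ (1 / 2) ^ q := by
    intro q
    induction q with
    | zero => simpa using weight_le_one hθ M
    | succ q ih =>
      have := hcon (M + (q + 1) * r) (by omega)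
      rw [show M + (q + 1) * r - r = M + q * r by
        rw [add_one_mul]; omega] at this
      rw [pow_succ]; linarith
  obtain ⟨x, hx0, hx1, hxr⟩ := exists_three_quarters_le_pow hr
  obtain ⟨m', hm'⟩ := eventually_pow_lt_weight hlim hθ hx0.le hx1
  have h2 : ∀ q ≥ m', x ^ M * (3 / 2) ^ q < 1 := by
    intro q hq
    have h3 := hm' (M + q * r) (by nlinarith)
    have h4 : x ^ M * (3 / 4) ^ q < (1 / 2) ^ q := by
      refine lt_of_le_of_lt ?_ (h3.trans_le (h1 q))
      rw [pow_add _ M, mul_comm q r, pow_mul]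
      exact mul_le_mul_of_nonneg_left (pow_le_pow_left₀ (by norm_num) hxr q) (by positivity)
    have h5 : ((3 : ℝ) / 4) ^ q = (3 / 2) ^ q * (1 / 2) ^ q := by rw [← mul_pow]; norm_num
    have h6 : (0 : ℝ) < (1 / 2) ^ q := by positivity
    rw [h5, ← mul_assoc] at h4
    by_contra hc
    nlinarith [not_lt.1 hc]
  obtain ⟨q, hq⟩ := pow_unbounded_of_one_lt (1 / x ^ M) (show (1 : ℝ) < 3 / 2 by norm_num)
  have h3 := h2 (max q m') (le_max_right _ _)
  have h4 := hq.trans_le (pow_le_pow_right₀ (show (1 : ℝ) ≤ 3 / 2 by norm_num)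
    (le_max_left q m'))
  rw [div_lt_iff₀ (by positivity)] at h4
  linarith

end weight

/-! ### The norm of the mixed Tsirelson space -/

/-- The norm of `T[(schreier k, θ k)]` on finitely supported sequences. -/
noncomputable def tnorm {θ : ℕ+ → ℝ} (hθ : RegularSequence θ) (x : ℕ+ →₀ ℝ) : ℝ :=
  (mixedNormingSet (fun k : ℕ+ => schreier k) θ hθ.mem_Ioo).norm x

/-- Membership in the norming set of `T[(schreier k, θ k)]`. -/
abbrev TNorming (θ : ℕ+ → ℝ) : (ℕ+ →₀ ℝ) → Prop :=
  Norming (fun k _ E => Admissible (schreier k) E) θ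

section tnorm

variable {θ : ℕ+ → ℝ} (hθ : RegularSequence θ)

theorem tnorm_nonneg (x : ℕ+ →₀ ℝ) : 0 ≤ tnorm hθ x := NormingSet.norm_nonneg _ x

theorem abs_apply_le_tnorm (x : ℕ+ →₀ ℝ) (n : ℕ+) : |x n| ≤ tnorm hθ x :=
  NormingSet.abs_apply_le _ x n

theorem tnorm_smul (c : ℝ) (x : ℕ+ →₀ ℝ) : tnorm hθ (c • x) = |c| * tnorm hθ x :=
  NormingSet.norm_smul _ c x

theorem tnorm_add_le (x y : ℕ+ →₀ ℝ) : tnorm hθ (x + y) ≤ tnorm hθ x + tnorm hθ y :=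
  NormingSet.norm_add_le _ x y

@[simp] theorem tnorm_zero : tnorm hθ 0 = 0 := by simpa using tnorm_smul hθ 0 0

theorem tnorm_sum_le {ι : Type*} (s : Finset ι) (x : ι → ℕ+ →₀ ℝ) :
    tnorm hθ (∑ i ∈ s, x i) ≤ ∑ i ∈ s, tnorm hθ (x i) :=
  Finset.le_sum_of_subadditive _ (tnorm_zero hθ).le (tnorm_add_le hθ) s x

theorem tnorm_pos {x : ℕ+ →₀ ℝ} (hx : x ≠ 0) : 0 < tnorm hθ x := by
  obtain ⟨n, hn⟩ := Finsupp.ne_iff.1 hx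
  exact (abs_pos.2 hn).trans_le (abs_apply_le_tnorm hθ x n)

theorem abs_pairing_le_tnorm {f : ℕ+ →₀ ℝ} (hf : TNorming θ f) (x : ℕ+ →₀ ℝ) :
    |pairing f x| ≤ tnorm hθ x := by
  refine abs_le'.2 ⟨NormingSet.pairing_le _ hf x, ?_⟩
  rw [← pairing_neg]
  exact NormingSet.pairing_le _ hf.neg x

theorem abs_pairing_le_sum {θ : ℕ+ → ℝ} (hθ : RegularSequence θ) {f : ℕ+ →₀ ℝ}
    (hf : TNorming θ f) (x : ℕ+ →₀ ℝ) : |pairing f x| ≤ ∑ n ∈ x.support, |x n| :=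
  NormingSet.abs_pairing_le (mixedNormingSet (fun k : ℕ+ => schreier k) θ hθ.mem_Ioo) hf x

theorem tnorm_le {x : ℕ+ →₀ ℝ} {u : ℝ} (h : ∀ f, TNorming θ f → pairing f x ≤ u) :
    tnorm hθ x ≤ u := NormingSet.norm_le _ h

theorem tnorm_filter_le (x : ℕ+ →₀ ℝ) (F : Finset ℕ+) :
    tnorm hθ (x.filter (· ∈ F)) ≤ tnorm hθ x := by
  refine tnorm_le hθ fun f hf => ?_
  rw [← pairing_filter]
  rcases hf.filter (fun k : ℕ+ => schreier_hereditary k) (fun k : ℕ+ => schreier_spreading k) F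
    with h | h
  · rw [h]; simpa [pairing] using tnorm_nonneg hθ x
  · exact NormingSet.pairing_le _ h x

theorem abs_pairing_le_tnorm_filter {f : ℕ+ →₀ ℝ} (hf : TNorming θ f) (x : ℕ+ →₀ ℝ) :
    |pairing f x| ≤ tnorm hθ (x.filter (· ∈ f.support)) := by
  rw [show pairing f x = pairing f (x.filter (· ∈ f.support)) by
    rw [← pairing_filter]
    congr 1
    exact (Finsupp.filter_eq_self_iff _ _ |>.2 fun a ha => Finsupp.mem_support_iff.2 ha).symm]
  exact abs_pairing_le_tnorm hθ hf _

theorem weight_mul_sum_tnorm_le {k d : ℕ} {E : Fin d → Finset ℕ+} (hk : 0 < k)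
    (hE : Admissible (schreier k) E) (x : ℕ+ →₀ ℝ) :
    weight θ k * ∑ l, tnorm hθ (x.filter (· ∈ E l)) ≤ tnorm hθ x := by
  rcases Nat.eq_zero_or_pos d with rfl | hd
  · simpa using tnorm_nonneg hθ x
  · refine (mixedNormingSet_isLUB (fun k : ℕ+ => schreier k) θ hθ.mem_Ioo
      (fun k => schreier_hereditary k) (fun k => schreier_spreading k) x).1
      (Or.inr ⟨⟨k, hk⟩, d, E, hd, hE, ?_⟩)
    rw [weight_of_pos hk]; rfl

end tnorm

theorem pairing_sum {ι : Type*} (f : ℕ+ →₀ ℝ) (s : Finset ι) (x : ι → ℕ+ →₀ ℝ) :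
    pairing f (∑ i ∈ s, x i) = ∑ i ∈ s, pairing f (x i) := by
  classical
  induction s using Finset.induction_on with
  | empty => simp [pairing]
  | insert i s hi ih => rw [Finset.sum_insert hi, Finset.sum_insert hi, pairing_add, ih]

theorem pairing_eq_zero {f x : ℕ+ →₀ ℝ} (h : Disjoint f.support x.support) : pairing f x = 0 :=
  Finset.sum_eq_zero fun n hn => by
    rw [Finsupp.notMem_support_iff.1 (Finset.disjoint_left.1 h hn), mul_zero]

/-! ### Block sequences -/

/-- The supports of `w 0, w 1, …` lie in the successive intervals `[ℓ e, t e]`. -/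
structure IsBlock (w : ℕ → ℕ+ →₀ ℝ) (ℓ t : ℕ → ℕ+) : Prop where
  lower : ∀ e, ∀ a ∈ (w e).support, ℓ e ≤ a
  upper : ∀ e, ∀ a ∈ (w e).support, a ≤ t e
  le : ∀ e, ℓ e ≤ t e
  lt : ∀ e, t e < ℓ (e + 1)

namespace IsBlock

variable {w : ℕ → ℕ+ →₀ ℝ} {ℓ t : ℕ → ℕ+}

theorem lower_strictMono (h : IsBlock w ℓ t) : StrictMono ℓ :=
  strictMono_nat_of_lt_succ fun e => (h.le e).trans_lt (h.lt e)

theorem upper_strictMono (h : IsBlock w ℓ t) : StrictMono t :=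
  strictMono_nat_of_lt_succ fun e => (h.lt e).trans_le (h.le _)

theorem upper_lt_lower (h : IsBlock w ℓ t) {e e' : ℕ} (he : e < e') : t e < ℓ e' :=
  (h.lt e).trans_le (h.lower_strictMono.monotone he)

theorem lt_of_lt (h : IsBlock w ℓ t) {e e' : ℕ} (he : e < e') {a b : ℕ+}
    (ha : a ∈ (w e).support) (hb : b ∈ (w e').support) : a < b :=
  (h.upper e a ha).trans_lt ((h.upper_lt_lower he).trans_le (h.lower e' b hb))

theorem eq_of_mem (h : IsBlock w ℓ t) {e e' : ℕ} {a : ℕ+}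
    (ha : a ∈ (w e).support) (hb : a ∈ (w e').support) : e = e' := by
  rcases lt_trichotomy e e' with hlt | heq | hlt
  · exact absurd (h.lt_of_lt hlt ha hb) (lt_irrefl a)
  · exact heq
  · exact absurd (h.lt_of_lt hlt hb ha) (lt_irrefl a)

theorem le_of_le (h : IsBlock w ℓ t) {e e' : ℕ} {a b : ℕ+} (ha : a ∈ (w e).support)
    (hb : b ∈ (w e').support) (hab : a ≤ b) : e ≤ e' :=
  not_lt.1 fun hlt => absurd (h.lt_of_lt hlt hb ha) (not_lt.2 hab)

theorem linearCombination_apply (h : IsBlock w ℓ t) (c : ℕ →₀ ℝ) {e : ℕ} {a : ℕ+}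
    (ha : a ∈ (w e).support) : Finsupp.linearCombination ℝ w c a = c e * w e a := by
  rw [Finsupp.linearCombination_apply, Finsupp.sum, Finsupp.finsetSum_apply,
    Finset.sum_eq_single e]
  · rfl
  · intro e' _ he'
    rw [Finsupp.smul_apply, Finsupp.notMem_support_iff.1 fun ha' => he' (h.eq_of_mem ha' ha),
      smul_zero]
  · intro he
    rw [Finsupp.notMem_support_iff.1 he, zero_smul]; rfl

theorem exists_mem_of_ne_zero {c : ℕ →₀ ℝ} {a : ℕ+}
    (ha : a ∈ (Finsupp.linearCombination ℝ w c).support) :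
    ∃ e ∈ c.support, a ∈ (w e).support := by
  rw [Finsupp.mem_support_iff, Finsupp.linearCombination_apply, Finsupp.sum,
    Finsupp.finsetSum_apply] at ha
  obtain ⟨e, he, hea⟩ := Finset.exists_ne_zero_of_sum_ne_zero ha
  exact ⟨e, he, Finsupp.mem_support_iff.2 (right_ne_zero_of_mul hea)⟩

theorem filter_linearCombination (h : IsBlock w ℓ t) (c : ℕ →₀ ℝ) {e : ℕ} {S : Finset ℕ+}
    (hS : S ⊆ (w e).support) : (Finsupp.linearCombination ℝ w c).filter (· ∈ S) =
      c e • (w e).filter (· ∈ S) := by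
  ext a
  by_cases ha : a ∈ S
  · simp [ha, h.linearCombination_apply c (hS ha)]
  · simp [ha]

theorem filter_mem_support (h : IsBlock w ℓ t) (c : ℕ →₀ ℝ) (e : ℕ) :
    (Finsupp.linearCombination ℝ w c).filter (· ∈ (w e).support) = c e • w e := by
  rw [h.filter_linearCombination c subset_rfl]
  congr 1
  exact Finsupp.filter_eq_self_iff _ _ |>.2 fun a ha => Finsupp.mem_support_iff.2 ha

end IsBlock

theorem exists_seq_of_forall_exists {α : Type*} {R : α → α → Prop} (h : ∀ x, ∃ y, R x y)
    (x₀ : α) : ∃ s : ℕ → α, s 0 = x₀ ∧ ∀ n, R (s n) (s (n + 1)) := by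
  choose F hF using h
  exact ⟨fun n => Nat.rec x₀ (fun _ x => F x) n, rfl, fun n => hF _⟩

/-- The type `α` bundles vectors with the properties to be kept, and `R` links neighbours, for
instance by growth of their orders. -/
theorem exists_isBlock {α : Type*} {v : α → ℕ+ →₀ ℝ} (hv : ∀ x, v x ≠ 0) {R : α → α → Prop}
    (h : ∀ x p, ∃ y, R x y ∧ ∀ a ∈ (v y).support, p ≤ a) (x₀ : α) :
    ∃ (s : ℕ → α) (ℓ t : ℕ → ℕ+), s 0 = x₀ ∧ (∀ n, R (s n) (s (n + 1))) ∧
      IsBlock (fun n => v (s n)) ℓ t ∧ (∀ n, ℓ n ∈ (v (s n)).support) := by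
  have hne : ∀ x, (v x).support.Nonempty := fun x => Finsupp.support_nonempty_iff.2 (hv x)
  obtain ⟨s, hs0, hs⟩ := exists_seq_of_forall_exists
    (R := fun x y => R x y ∧ ∀ a ∈ (v y).support, (v x).support.max' (hne x) + 1 ≤ a)
    (fun x => h x _) x₀
  refine ⟨s, fun n => (v (s n)).support.min' (hne _), fun n => (v (s n)).support.max' (hne _),
    hs0, fun n => (hs n).1, ⟨fun e a ha => Finset.min'_le _ _ ha,
      fun e a ha => Finset.le_max' _ _ ha, fun e => Finset.min'_le _ _ (Finset.max'_mem _ _),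
      fun e => ?_⟩, fun n => Finset.min'_mem _ _⟩
  exact lt_of_lt_of_le (PNat.lt_add_right _ _) ((hs e).2 _ (Finset.min'_mem _ _))

/-! ### Averages with large lower estimates -/

section average

variable {θ : ℕ+ → ℝ} (hθ : RegularSequence θ)

/-- The minima arise from `A` by moving each element to the right; this is the convolution property
with singletons. -/
theorem admissible_of_mem_schreier {k : ℕ} {A : Finset ℕ+} (hA : A ∈ schreier k)
    {E : ℕ+ → Finset ℕ+} (hle : ∀ a ∈ A, ∀ x ∈ E a, a ≤ x)
    (hs : ∀ a ∈ A, ∀ b ∈ A, a < b → ∀ x ∈ E a, ∀ y ∈ E b, x < y) (hne : ∀ a ∈ A, (E a).Nonempty) :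
    Admissible (schreier k) (fun l => E (A.orderEmbOfFin rfl l)) := by
  classical
  have hmem : ∀ l, A.orderEmbOfFin rfl l ∈ A := fun l => A.orderEmbOfFin_mem rfl l
  refine ⟨fun l => hne _ (hmem l), fun i j hij => hs _ (hmem i) _ (hmem j)
    ((A.orderEmbOfFin rfl).strictMono hij), ?_⟩
  have key := biUnion_mem_schreier_add (r := 0) hA
    (G := fun a => if h : (E a).Nonempty then {(E a).min' h} else ∅) ?_ ?_ ?_
  · rw [add_zero] at key
    convert key using 1
    ext x
    simp only [minSet, Finset.mem_image, Finset.mem_univ, true_and, Finset.mem_biUnion]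
    refine ⟨?_, ?_⟩
    · rintro ⟨l, rfl⟩
      exact ⟨_, hmem l, by rw [dif_pos (hne _ (hmem l))]; simp⟩
    · rintro ⟨a, ha, hx⟩
      have : a ∈ Set.range (A.orderEmbOfFin rfl) := by rw [Finset.range_orderEmbOfFin]; exact ha
      obtain ⟨l, rfl⟩ := this
      rw [dif_pos (hne _ ha), Finset.mem_singleton] at hx
      exact ⟨l, hx.symm⟩
  · intro a ha
    rw [dif_pos (hne a ha)]; exact singleton_mem_schreier_zero _
  · intro a ha x hx
    rw [dif_pos (hne a ha), Finset.mem_singleton] at hx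
    rw [hx]; exact hle a ha _ (Finset.min'_mem _ _)
  · intro a ha b hb hab x hx y hy
    rw [dif_pos (hne a ha), Finset.mem_singleton] at hx
    rw [dif_pos (hne b hb), Finset.mem_singleton] at hy
    rw [hx, hy]; exact hs a ha b hb hab _ (Finset.min'_mem _ _) _ (Finset.min'_mem _ _)

/-- The lower estimate in the form needed for unions of families: indexed by the elements of a
Schreier set, with empty sets allowed. -/
theorem weight_mul_sum_tnorm_le_of_mem {k : ℕ} (hk : 0 < k) {A : Finset ℕ+}
    (hA : A ∈ schreier k) {E : ℕ+ → Finset ℕ+} (hle : ∀ a ∈ A, ∀ x ∈ E a, a ≤ x)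
    (hs : ∀ a ∈ A, ∀ b ∈ A, a < b → ∀ x ∈ E a, ∀ y ∈ E b, x < y) (x : ℕ+ →₀ ℝ) :
    weight θ k * ∑ a ∈ A, tnorm hθ (x.filter (· ∈ E a)) ≤ tnorm hθ x := by
  classical
  set A' := A.filter fun a => (E a).Nonempty with hA'
  have hsub : A' ⊆ A := Finset.filter_subset _ _
  have hsum : ∑ a ∈ A, tnorm hθ (x.filter (· ∈ E a)) =
      ∑ a ∈ A', tnorm hθ (x.filter (· ∈ E a)) := by
    symm
    refine Finset.sum_subset hsub fun a ha ha' => ?_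
    have : E a = ∅ := by
      by_contra h
      exact ha' (Finset.mem_filter.2 ⟨ha, Finset.nonempty_iff_ne_empty.2 h⟩)
    rw [this, show x.filter (· ∈ (∅ : Finset ℕ+)) = 0 by ext; simp, tnorm_zero]
  have hadm := admissible_of_mem_schreier (schreier_hereditary k _ hA _ hsub)
    (fun a ha => hle a (hsub ha)) (fun a ha b hb => hs a (hsub ha) b (hsub hb))
    (fun a ha => (Finset.mem_filter.1 ha).2)
  have := weight_mul_sum_tnorm_le hθ hk hadm x
  rw [hsum]
  convert this using 2
  refine Eq.trans ?_ (Finset.sum_map Finset.univ (A'.orderEmbOfFin rfl).toEmbedding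
    (fun a => tnorm hθ (x.filter (· ∈ E a))))
  congr 1
  ext a
  have : a ∈ A' ↔ a ∈ Set.range (A'.orderEmbOfFin rfl) := by
    rw [Finset.range_orderEmbOfFin]; rfl
  rw [this]; simp

/-- Sums of the norms of the restrictions of `y` to admissible families of order between `1` and
`j - 1` are at most `C`. -/
def SplitBound (j : ℕ) (C : ℝ) (y : ℕ+ →₀ ℝ) : Prop :=
  ∀ k, 0 < k → k < j → ∀ (d : ℕ) (E : Fin d → Finset ℕ+), Admissible (schreier k) E →
    ∑ l, tnorm hθ (y.filter (· ∈ E l)) ≤ C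

/-- `y` has a lower `ℓ₁`-estimate of size `ρ` on an admissible family of order `q`. -/
def SplitLarge (q : ℕ) (ρ : ℝ) (y : ℕ+ →₀ ℝ) : Prop :=
  ∃ (A : Finset ℕ+) (E : ℕ+ → Finset ℕ+), A ∈ schreier q ∧ A ⊆ y.support ∧
    (∀ a ∈ A, E a ⊆ y.support ∧ ∀ x ∈ E a, a ≤ x) ∧
    (∀ a ∈ A, ∀ b ∈ A, a < b → ∀ x ∈ E a, ∀ z ∈ E b, x < z) ∧
    ρ ≤ ∑ a ∈ A, tnorm hθ (y.filter (· ∈ E a))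

variable {w : ℕ → ℕ+ →₀ ℝ} {ℓ t : ℕ → ℕ+}

theorem SplitLarge.smul {q : ℕ} {ρ : ℝ} {y : ℕ+ →₀ ℝ} (h : SplitLarge hθ q ρ y) {c : ℝ}
    (hc : 0 < c) : SplitLarge hθ q (c * ρ) (c • y) := by
  obtain ⟨A, E, hA, hAy, hE, hs, hρ⟩ := h
  have hsupp : (c • y).support = y.support := Finsupp.support_smul_eq hc.ne'
  refine ⟨A, E, hA, by rwa [hsupp], by rwa [hsupp], hs, ?_⟩
  simp_rw [Finsupp.filter_smul, tnorm_smul, abs_of_pos hc, ← Finset.mul_sum]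
  exact mul_le_mul_of_nonneg_left hρ hc.le

/-- On subsets of the support of `w e` the combination is `c e • w e`, so the estimates average with
total weight 1, while the families are joined by convolution over the positions `ℓ e`. -/
theorem SplitLarge.linearCombination (hw : IsBlock w ℓ t) {c : ℕ →₀ ℝ} (hc : ∀ e, 0 ≤ c e)
    (hc1 : c.sum (fun _ x => x) = 1) {j q : ℕ} {ρ : ℝ} (hj : c.support.image ℓ ∈ schreier j)
    (h : ∀ e, SplitLarge hθ q ρ (w e)) :
    SplitLarge hθ (j + q) ρ (Finsupp.linearCombination ℝ w c) := by
  classical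
  choose A E hA hAw hE hs hρ using h
  have hsupp : ∀ e ∈ c.support, (w e).support ⊆ (Finsupp.linearCombination ℝ w c).support := by
    intro e he a ha
    rw [Finsupp.mem_support_iff, hw.linearCombination_apply c ha]
    exact mul_ne_zero (Finsupp.mem_support_iff.1 he) (Finsupp.mem_support_iff.1 ha)
  -- The index of the block that contains `a`; the default value 0 is never used.
  let idx : ℕ+ → ℕ := fun a => if h : ∃ e, a ∈ (w e).support then h.choose else 0
  have hidx : ∀ e, ∀ a ∈ (w e).support, idx a = e := fun e a ha => by
    have h : ∃ e, a ∈ (w e).support := ⟨e, ha⟩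
    simp only [idx, dif_pos h]
    exact hw.eq_of_mem h.choose_spec ha
  refine ⟨c.support.biUnion A, fun a => E (idx a) a, ?_, ?_, ?_, ?_, ?_⟩
  · exact biUnion_mem_schreier_add_of_strictMono hw.lower_strictMono hj (fun e _ => hA e)
      (fun e _ x hx => hw.lower e x (hAw e hx))
      fun e _ e' _ hee x hx z hz => hw.lt_of_lt hee (hAw e hx) (hAw e' hz)
  · intro a ha
    obtain ⟨e, he, hae⟩ := Finset.mem_biUnion.1 ha
    exact hsupp e he (hAw e hae)
  · intro a ha
    obtain ⟨e, he, hae⟩ := Finset.mem_biUnion.1 ha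
    simp only [hidx e a (hAw e hae)]
    exact ⟨(hE e a hae).1.trans (hsupp e he), (hE e a hae).2⟩
  · intro a ha b hb hab x hx y hy
    obtain ⟨e, he, hae⟩ := Finset.mem_biUnion.1 ha
    obtain ⟨e', he', hbe⟩ := Finset.mem_biUnion.1 hb
    simp only [hidx e a (hAw e hae)] at hx
    simp only [hidx e' b (hAw e' hbe)] at hy
    rcases (hw.le_of_le (hAw e hae) (hAw e' hbe) hab.le).eq_or_lt with rfl | hlt
    · exact hs e a hae b hbe hab x hx y hy
    · exact hw.lt_of_lt hlt ((hE e a hae).1 hx) ((hE e' b hbe).1 hy)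
  · rw [Finset.sum_biUnion]
    · calc ρ = ∑ e ∈ c.support, c e * ρ := by
            rw [← Finset.sum_mul]; rw [Finsupp.sum] at hc1; rw [hc1, one_mul]
        _ ≤ _ := Finset.sum_le_sum fun e _ => ?_
      refine (mul_le_mul_of_nonneg_left (hρ e) (hc e)).trans (le_of_eq ?_)
      rw [Finset.mul_sum]
      refine Finset.sum_congr rfl fun a ha => ?_
      simp only [hidx e a (hAw e ha)]
      rw [hw.filter_linearCombination c (hE e a ha).1, tnorm_smul,
        abs_of_nonneg (hc e)]
    · intro e _ e' _ hee
      refine Finset.disjoint_left.2 fun a ha ha' => hee (hw.eq_of_mem (hAw e ha) (hAw e' ha'))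

/-- A block met by one member of the family only contributes at most its coefficient, in total at
most 1. The blocks met by two members have positions in the family of order `k < j`, hence total
coefficient at most `weight θ j`; each costs at most `(weight θ k)⁻¹`, so these add at most 1 again.
-/
theorem SplitBound.linearCombination (hw : IsBlock w ℓ t) (hw1 : ∀ e, tnorm hθ (w e) ≤ 1)
    {c : ℕ →₀ ℝ} (hc : ∀ e, 0 ≤ c e) (hc1 : c.sum (fun _ x => x) = 1) {j : ℕ}
    (hsm : ∀ k < j, ∀ H : Finset ℕ, H.image t ∈ schreier k → ∑ e ∈ H, c e ≤ weight θ j) :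
    SplitBound hθ j 2 (Finsupp.linearCombination ℝ w c) := by
  classical
  intro k hk hkj d E hE
  have hwk := weight_pos hθ k
  set H := c.support.filter fun e => ∃ l l', l < l' ∧ (∃ a ∈ E l, a ∈ (w e).support) ∧
    ∃ a ∈ E l', a ∈ (w e).support with hH
  have hHs : ∑ e ∈ H, c e ≤ weight θ j := by
    obtain ⟨B, hB, hHB⟩ := Covered.of_split hE (D := fun e => {a | a ∈ (w e).support})
      (fun o o' h a ha b hb => hw.lt_of_lt h ha hb) hw.upper_strictMono
      (fun o a ha => hw.upper o a ha) (H := H) fun o ho => (Finset.mem_filter.1 ho).2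
    refine hsm k hkj H (schreier_hereditary k _ (hB 0) _ fun x hx => ?_)
    obtain ⟨i, -, hi⟩ := Finset.mem_biUnion.1 (hHB hx)
    rwa [Subsingleton.elim 0 i]
  have hbd : ∀ e, ∑ l, tnorm hθ ((w e).filter (· ∈ E l)) ≤ (weight θ k)⁻¹ := fun e => by
    rw [← one_div, le_div_iff₀' hwk]
    exact (weight_mul_sum_tnorm_le hθ hk hE (w e)).trans (hw1 e)
  have hone : ∀ e ∈ c.support, e ∉ H → ∑ l, tnorm hθ ((w e).filter (· ∈ E l)) ≤ 1 := by
    intro e he heH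
    have hzero : ∀ l, (¬ ∃ a ∈ E l, a ∈ (w e).support) →
        tnorm hθ ((w e).filter (· ∈ E l)) = 0 := by
      intro l hl
      rw [show (w e).filter (· ∈ E l) = 0 from ?_, tnorm_zero]
      ext a
      by_cases ha : a ∈ E l
      · rw [Finsupp.filter_apply_pos _ _ ha]
        exact Finsupp.notMem_support_iff.1 fun h => hl ⟨a, ha, h⟩
      · rw [Finsupp.filter_apply_neg _ _ ha]; rfl
    by_cases hex : ∃ l, ∃ a ∈ E l, a ∈ (w e).support
    · obtain ⟨l, hl⟩ := hex
      rw [Finset.sum_eq_single l]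
      · exact (tnorm_filter_le hθ _ _).trans (hw1 e)
      · intro l' _ hne
        refine hzero l' fun hl' => heH (Finset.mem_filter.2 ⟨he, ?_⟩)
        rcases lt_or_gt_of_ne hne with h | h
        · exact ⟨l', l, h, hl', hl⟩
        · exact ⟨l, l', h, hl, hl'⟩
      · simp
    · push Not at hex
      rw [Finset.sum_eq_zero fun l _ => hzero l (by push Not; exact hex l)]
      exact zero_le_one
  have hfil : ∀ l, tnorm hθ ((Finsupp.linearCombination ℝ w c).filter (· ∈ E l)) ≤
      ∑ e ∈ c.support, c e * tnorm hθ ((w e).filter (· ∈ E l)) := by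
    intro l
    have : (Finsupp.linearCombination ℝ w c).filter (· ∈ E l) =
        ∑ e ∈ c.support, c e • (w e).filter (· ∈ E l) := by
      ext a
      by_cases ha : a ∈ E l <;>
        simp [ha, Finsupp.linearCombination_apply, Finsupp.sum, Finsupp.finsetSum_apply]
    rw [this]
    refine (tnorm_sum_le hθ _ _).trans (le_of_eq (Finset.sum_congr rfl fun e _ => ?_))
    rw [tnorm_smul, abs_of_nonneg (hc e)]
  rw [Finsupp.sum] at hc1
  calc ∑ l, tnorm hθ ((Finsupp.linearCombination ℝ w c).filter (· ∈ E l))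
      ≤ ∑ l, ∑ e ∈ c.support, c e * tnorm hθ ((w e).filter (· ∈ E l)) :=
        Finset.sum_le_sum fun l _ => hfil l
    _ = ∑ e ∈ c.support, c e * ∑ l, tnorm hθ ((w e).filter (· ∈ E l)) := by
        rw [Finset.sum_comm]; simp_rw [Finset.mul_sum]
    _ ≤ ∑ e ∈ c.support, (c e + if e ∈ H then c e * (weight θ k)⁻¹ else 0) := by
        refine Finset.sum_le_sum fun e he => ?_
        split_ifs with heH
        · have := mul_le_mul_of_nonneg_left (hbd e) (hc e)
          linarith [hc e]
        · have := mul_le_mul_of_nonneg_left (hone e he heH) (hc e)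
          linarith
    _ = 1 + (∑ e ∈ H, c e) * (weight θ k)⁻¹ := by
        rw [Finset.sum_add_distrib, hc1, ← Finset.sum_filter, Finset.sum_mul]
        congr 2
        ext e
        simp only [hH, Finset.mem_filter]
        tauto
    _ ≤ 1 + 1 := by
        refine add_le_add_right ?_ 1
        rw [← div_eq_mul_inv, div_le_one hwk]
        exact hHs.trans (weight_antitone hθ hkj.le)
    _ = 2 := by norm_num

end average

theorem sum_image_mapDomain {t : ℕ → ℕ+} (ht : Function.Injective t) (c : ℕ →₀ ℝ)
    (H : Finset ℕ) : ∑ a ∈ H.image t, c.mapDomain t a = ∑ e ∈ H, c e := by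
  rw [Finset.sum_image fun _ _ _ _ h => ht h]
  exact Finset.sum_congr rfl fun e _ => Finsupp.mapDomain_apply ht c e

theorem linearCombination_single_eq_mapDomain (t : ℕ → ℕ+) (c : ℕ →₀ ℝ) :
    Finsupp.linearCombination ℝ (fun p => Finsupp.single (t p) (1 : ℝ)) c = c.mapDomain t := by
  simp [Finsupp.linearCombination_apply, Finsupp.mapDomain]

theorem sum_single_le_one (n : ℕ+) (A : Finset ℕ+) :
    ∑ a ∈ A, (Finsupp.single n (1 : ℝ)) a ≤ 1 := by
  classical
  simp only [Finsupp.single_apply, Finset.sum_ite_eq]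
  split_ifs <;> norm_num

/-- Special convex combinations are the case of point masses at `t p`. Smallness is measured at the
right ends `t`, membership at the left ends `ℓ`. -/
theorem IsBlock.exists_average {w : ℕ → ℕ+ →₀ ℝ} {ℓ t : ℕ → ℕ+} (hw : IsBlock w ℓ t) (j : ℕ)
    {η : ℝ} (hη : 0 < η) (p₀ : ℕ) :
    ∃ c : ℕ →₀ ℝ, (∀ e, 0 ≤ c e) ∧ c.sum (fun _ x => x) = 1 ∧ (∀ e ∈ c.support, p₀ ≤ e) ∧
      c.support.image ℓ ∈ schreier j ∧
      ∀ k < j, ∀ H : Finset ℕ, H.image t ∈ schreier k → ∑ e ∈ H, c e ≤ η := by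
  classical
  obtain ⟨c, hc0, hc1, hcp, hcℓ, hcs⟩ := Tsirelson.exists_average (ι := Unit) hw.le hw.lt
    (fun _ => 0) (fun _ p => Finsupp.single (t p) 1)
    (fun _ p a => by rw [Finsupp.single_apply]; split_ifs <;> norm_num)
    (fun _ p A => sum_single_le_one _ _)
    (fun _ p a h => by
      rw [Finsupp.single_apply_ne_zero] at h
      rw [h.1]; exact ⟨hw.le p, le_rfl⟩)
    -- Point masses have order 0, for which smallness is vacuous.
    (fun η _ => ⟨0, fun p _ _ k hk => absurd hk (Nat.not_lt_zero k)⟩) j η hη p₀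
  refine ⟨c, hc0, hc1, hcp, hcℓ, fun k hk H hH => ?_⟩
  have := hcs () k hk _ hH
  rwa [linearCombination_single_eq_mapDomain,
    sum_image_mapDomain hw.upper_strictMono.injective] at this

/-! ### Normalized vectors with bounded admissible splittings -/

section

variable {θ : ℕ+ → ℝ}

theorem filter_mem_support_self (x : ℕ+ →₀ ℝ) : x.filter (· ∈ x.support) = x :=
  Finsupp.filter_eq_self_iff _ _ |>.2 fun _ ha => Finsupp.mem_support_iff.2 ha

/-- Every subspace that contains vectors with supports arbitrarily far out contains normalized
vectors with a uniform upper bound for admissible splittings of a prescribed order. -/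
theorem exists_splitBound (hθ : RegularSequence θ)
    (hlim : Tendsto (fun n : ℕ+ => θ n ^ (1 / ((n : ℕ) : ℝ))) atTop (𝓝 1))
    {W : Submodule ℝ (ℕ+ →₀ ℝ)}
    (hW : ∀ p : ℕ+, ∃ w ∈ W, w ≠ 0 ∧ ∀ a ∈ w.support, p ≤ a) {j : ℕ} (hj : 0 < j) (p : ℕ+) :
    ∃ y ∈ W, tnorm hθ y = 1 ∧ (∀ a ∈ y.support, p ≤ a) ∧ SplitBound hθ j 4 y := by
  classical
  by_contra! hcon
  have hnormalize : ∀ y : ℕ+ →₀ ℝ, y ≠ 0 → tnorm hθ ((tnorm hθ y)⁻¹ • y) = 1 := fun y hy => by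
    have := tnorm_pos hθ hy
    rw [tnorm_smul, abs_of_pos (inv_pos.2 this), inv_mul_cancel₀ this.ne']
  have hsup : ∀ (c : ℝ) (y : ℕ+ →₀ ℝ), ∀ a ∈ (c • y).support, a ∈ y.support := fun c y a ha =>
    Finsupp.support_smul ha
  -- If no such vector exists, every round of averaging and normalizing raises the order by `j` and
  -- doubles the lower ℓ₁-estimate.
  have key : ∀ r : ℕ, ∀ q ≥ p, ∃ w ∈ W, tnorm hθ w = 1 ∧ (∀ a ∈ w.support, q ≤ a) ∧
      SplitLarge hθ (j * r) (2 ^ r) w := by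
    intro r
    induction r with
    | zero =>
      intro q _
      obtain ⟨w, hwW, hw0, hwq⟩ := hW q
      set y := (tnorm hθ w)⁻¹ • w with hy
      have hy1 : tnorm hθ y = 1 := hnormalize w hw0
      have hyne : y.support.Nonempty := by
        rw [Finsupp.support_nonempty_iff]
        intro h
        rw [h, tnorm_zero] at hy1
        exact zero_ne_one hy1
      refine ⟨y, W.smul_mem _ hwW, hy1, fun a ha => hwq a (hsup _ _ a ha),
        {y.support.min' hyne}, fun _ => y.support, singleton_mem_schreier_zero _, ?_, ?_, ?_, ?_⟩
      · exact Finset.singleton_subset_iff.2 (Finset.min'_mem _ _)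
      · intro a ha
        rw [Finset.mem_singleton.1 ha]
        exact ⟨subset_rfl, fun x hx => Finset.min'_le _ _ hx⟩
      · intro a ha b hb hab
        rw [Finset.mem_singleton.1 ha, Finset.mem_singleton.1 hb] at hab
        exact absurd hab (lt_irrefl _)
      · rw [Finset.sum_singleton, filter_mem_support_self, hy1, pow_zero]
    | succ r ih =>
      intro q hq
      obtain ⟨w₀, h₀⟩ := ih q hq
      obtain ⟨s, ℓ, t, hs0, -, hblk, hℓ⟩ := exists_isBlock
        (α := {w : ℕ+ →₀ ℝ // w ∈ W ∧ tnorm hθ w = 1 ∧ SplitLarge hθ (j * r) (2 ^ r) w})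
        (v := Subtype.val) (R := fun _ _ => True)
        (fun x hx => by have := x.2.2.1; rw [hx, tnorm_zero] at this; exact zero_ne_one this)
        (fun x p' => by
          obtain ⟨w, hwW, hw1, hwq, hwl⟩ := ih (max p p') (le_max_left _ _)
          exact ⟨⟨w, hwW, hw1, hwl⟩, trivial, fun a ha => (le_max_right _ _).trans (hwq a ha)⟩)
        ⟨w₀, h₀.1, h₀.2.1, h₀.2.2.2⟩
      set v : ℕ → ℕ+ →₀ ℝ := fun n => (s n).1 with hv
      obtain ⟨c, hc0, hc1, -, hcℓ, hcs⟩ := hblk.exists_average j (weight_pos hθ j) 0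
      set y := Finsupp.linearCombination ℝ v c with hy
      have hyW : y ∈ W := by
        rw [hy, Finsupp.linearCombination_apply]
        exact W.sum_mem fun e _ => W.smul_mem _ (s e).2.1
      have hyq : ∀ a ∈ y.support, q ≤ a := by
        intro a ha
        obtain ⟨e, -, hae⟩ := IsBlock.exists_mem_of_ne_zero ha
        refine le_trans ?_ ((hblk.lower_strictMono.monotone (Nat.zero_le e)).trans
          (hblk.lower e a hae))
        have := hℓ 0
        rw [hs0] at this
        exact h₀.2.2.1 _ this
      have hy0 : y ≠ 0 := by
        have hcne : c ≠ 0 := by rintro rfl; simp at hc1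
        obtain ⟨e, he⟩ := Finsupp.support_nonempty_iff.2 hcne
        intro h
        have := hblk.linearCombination_apply c (hℓ e)
        rw [← hy, h] at this
        exact mul_ne_zero (Finsupp.mem_support_iff.1 he) (Finsupp.mem_support_iff.1 (hℓ e))
          this.symm
      have hN := tnorm_pos hθ hy0
      have hbound : SplitBound hθ j 2 y :=
        SplitBound.linearCombination hθ hblk (fun e => (s e).2.2.1.le) hc0 hc1 hcs
      have hlarge : SplitLarge hθ (j + j * r) (2 ^ r) y :=
        SplitLarge.linearCombination hθ hblk hc0 hc1 hcℓ fun e => (s e).2.2.2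
      have hyp : ∀ a ∈ ((tnorm hθ y)⁻¹ • y).support, q ≤ a := fun a ha => hyq a (hsup _ _ a ha)
      -- The average has splitting constant 2. If its norm were at least 1/2, normalizing would give
      -- constant 4, which is excluded.
      have hhalf : tnorm hθ y < 1 / 2 := by
        by_contra hlt
        rw [not_lt] at hlt
        refine hcon _ (W.smul_mem _ hyW) (hnormalize y hy0) (fun a ha => hq.le.trans (hyp a ha)) ?_
        intro k hk hkj d E hE
        simp_rw [Finsupp.filter_smul, tnorm_smul, abs_of_pos (inv_pos.2 hN), ← Finset.mul_sum]
        rw [inv_mul_le_iff₀ hN]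
        linarith [hbound k hk hkj d E hE]
      refine ⟨_, W.smul_mem (tnorm hθ y)⁻¹ hyW, hnormalize y hy0, hyp, ?_⟩
      obtain ⟨A, E, hA, hAy, hE, hAE, hρ⟩ := hlarge.smul hθ (inv_pos.2 hN)
      refine ⟨A, E, by rwa [mul_add_one, add_comm], hAy, hE, hAE, le_trans ?_ hρ⟩
      rw [pow_succ, mul_comm]
      refine mul_le_mul_of_nonneg_right ?_ (by positivity)
      rw [← one_div, le_div_iff₀ hN]
      linarith
  -- A norm-one vector with estimate `2 ^ (m + 1)` at order `j * (m + 1)` forces `weight θ (j * (m +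
  -- 1)) * 2 ^ (m + 1) ≤ 1`, but that weight exceeds `(3 / 4) ^ (m + 1)`.
  obtain ⟨x, hx0, hx1, hxj⟩ := exists_three_quarters_le_pow hj
  obtain ⟨m, hm⟩ := eventually_pow_lt_weight hlim hθ hx0.le hx1
  obtain ⟨w, -, hw1, -, A, E, hA, -, hE, hs, hρ⟩ := key (m + 1) p le_rfl
  have h1 := weight_mul_sum_tnorm_le_of_mem hθ (Nat.mul_pos hj m.succ_pos) hA
    (fun a ha => (hE a ha).2) hs w
  rw [hw1] at h1
  have h2 := hm (j * (m + 1)) (by nlinarith)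
  have h3 : (3 / 4 : ℝ) ^ (m + 1) ≤ x ^ (j * (m + 1)) := by
    rw [pow_mul]; exact pow_le_pow_left₀ (by norm_num) hxj _
  have h4 : (3 / 4 : ℝ) ^ (m + 1) * 2 ^ (m + 1) ≤ 1 := by
    refine le_trans ?_ h1
    exact mul_le_mul (h3.trans h2.le) hρ (by positivity) (weight_pos hθ _).le
  rw [← mul_pow] at h4
  exact absurd h4 (not_le.2 (one_lt_pow₀ (by norm_num) (by omega)))

end

/-! ### The action of functionals on rapidly increasing sequences -/

/-- A block sequence of vectors with norms at most one such that `y i` has splitting constant `C`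
up to the order `j i`, and `j (i + 1)` is large in comparison with the `ℓ₁`-norm of `y i`. -/
structure IsRapid {θ : ℕ+ → ℝ} (hθ : RegularSequence θ) (y : ℕ → ℕ+ →₀ ℝ) (ℓ t : ℕ → ℕ+)
    (j : ℕ → ℕ) (C ε : ℝ) : Prop extends IsBlock y ℓ t where
  norm_le : ∀ i, tnorm hθ (y i) ≤ 1
  split : ∀ i, SplitBound hθ (j i) C (y i)
  mono : StrictMono j
  small : ∀ i, weight θ (j (i + 1)) * ∑ a ∈ (y i).support, |y i a| ≤ ε

theorem Covered.of_subsingleton {T : ℕ → ℕ+} {H : Finset ℕ} (h : ∀ i ∈ H, ∀ i' ∈ H, i = i')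
    (r : ℕ) : Covered 1 r (H.image T) := by
  rcases H.eq_empty_or_nonempty with rfl | ⟨o, ho⟩
  · exact Covered.empty _ _
  · refine (Covered.of_mem (singleton_mem_schreier r (T o))).subset fun x hx => ?_
    obtain ⟨o', ho', rfl⟩ := Finset.mem_image.1 hx
    rw [h o' ho' o ho]; simp

section rapid

variable {θ : ℕ+ → ℝ} {hθ : RegularSequence θ} {y : ℕ → ℕ+ →₀ ℝ} {ℓ t : ℕ → ℕ+}
  {j : ℕ → ℕ} {C ε : ℝ}

theorem abs_pairing_le_sum_inter (hθ : RegularSequence θ) {f : ℕ+ →₀ ℝ} (hf : TNorming θ f)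
    (x : ℕ+ →₀ ℝ) : |pairing f x| ≤ ∑ a ∈ x.support ∩ f.support, |x a| := by
  rw [show pairing f x = pairing f (x.filter (· ∈ f.support)) by
    rw [← pairing_filter, filter_mem_support_self]]
  refine (abs_pairing_le_sum hθ hf _).trans (le_of_eq ?_)
  rw [Finsupp.support_filter, Finset.filter_mem_eq_inter]
  exact Finset.sum_congr rfl fun a ha => by
    rw [Finsupp.filter_apply_pos _ _ (Finset.mem_inter.1 ha).2]

theorem abs_pairing_smul_sum_le {d : ℕ} (k : ℕ+) (hθ : RegularSequence θ) (f : Fin d → ℕ+ →₀ ℝ)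
    (x : ℕ+ →₀ ℝ) :
    |pairing (θ k • ∑ l, f l) x| ≤ weight θ k * ∑ l, |pairing (f l) x| := by
  rw [pairing_smul_sum, abs_mul, abs_of_pos (hθ.mem_Ioo k).1, weight_coe]
  exact mul_le_mul_of_nonneg_left (Finset.abs_sum_le_sum_abs _ _) (hθ.mem_Ioo k).1.le

/-- If `x` is met by at most one member of the family, then only this one acts on `x`. -/
theorem abs_pairing_smul_sum_le_of_unique {d : ℕ} (k : ℕ+) (hθ : RegularSequence θ)
    (f : Fin d → ℕ+ →₀ ℝ) (x : ℕ+ →₀ ℝ) (l : Fin d)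
    (h : ∀ l' ≠ l, ∀ a ∈ (f l').support, a ∉ x.support) :
    |pairing (θ k • ∑ l, f l) x| ≤ weight θ k * |pairing (f l) x| := by
  refine (abs_pairing_smul_sum_le k hθ f x).trans (le_of_eq ?_)
  rw [Finset.sum_eq_single l]
  · intro l' _ hl'
    rw [pairing_eq_zero (Finset.disjoint_left.2 (h l' hl')), abs_zero]
  · simp

theorem pairing_smul_sum_eq_zero {d : ℕ} (k : ℕ+) (f : Fin d → ℕ+ →₀ ℝ) (x : ℕ+ →₀ ℝ)
    (h : ∀ l, ∀ a ∈ (f l).support, a ∉ x.support) : pairing (θ k • ∑ l, f l) x = 0 := by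
  rw [pairing_smul_sum, Finset.sum_eq_zero, mul_zero]
  exact fun l _ => pairing_eq_zero (Finset.disjoint_left.2 (h l))

/-- The vectors of the sequence are evaluated by `f` through chains of weights of total order
`h i`, and small values of `h` occur on small sets only. -/
def Analysis (θ : ℕ+ → ℝ) (y : ℕ → ℕ+ →₀ ℝ) (t : ℕ → ℕ+) (C ε : ℝ) (L : ℕ) (f : ℕ+ →₀ ℝ) : Prop :=
  ∃ h : ℕ → ℕ, (∀ i, |pairing f (y i)| ≤ C * weight θ (h i) + ε) ∧
    ∀ r < L, ∀ H : Finset ℕ, (∀ i ∈ H, h i ≤ r) → Covered (2 * r + 1) r (H.image t)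

/-- The weight `θ k` at the root is compared with the orders `j i`. Vectors before `i₀` are so short
in ℓ₁ that `θ k` makes their value negligible; vectors after `i₀` have `k < j i`, so splitting them
costs only the constant `C`. Unsplit vectors are passed on to the one summand that meets them. The
exceptional vector `i₀` is left to the caller, and the bound keeps `weight θ k` as a separate factor
for use as the common initial part of chains. -/
theorem exists_analysis_of_sum (hy : IsRapid hθ y ℓ t j C ε) (hC : 0 ≤ C) (hε : 0 ≤ ε) {L d : ℕ}
    (k : ℕ+) {f : Fin d → ℕ+ →₀ ℝ} (hf : ∀ l, TNorming θ (f l))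
    (hE : Admissible (schreier k) fun l => (f l).support) (hU : ∀ l, Analysis θ y t C ε L (f l)) :
    ∃ (h : ℕ → ℕ) (i₀ : ℕ), (∀ i, i ≠ i₀ → (k : ℕ) ≤ h i ∧
        |pairing (θ k • ∑ l, f l) (y i)| ≤ C * (weight θ k * weight θ (h i - k)) + ε) ∧
      ∀ r < L, ∀ H : Finset ℕ, (∀ i ∈ H, i ≠ i₀ ∧ h i ≤ r) → Covered (2 * r) r (H.image t) := by
  classical
  choose hl hlb hlc using hU
  have hw0 := fun n => (weight_pos hθ n).le
  have hB := hy.toIsBlock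
  set M : Fin d → ℕ → Prop := fun l i => ∃ a ∈ (f l).support, a ∈ (y i).support with hM
  set S : ℕ → Prop := fun i => ∃ l l', l < l' ∧ M l i ∧ M l' i with hS
  obtain ⟨i₀, hi₀, hi₀'⟩ : ∃ i₀, (∀ i < i₀, j (i + 1) ≤ k) ∧ ∀ i > i₀, (k : ℕ) < j i := by
    have hex : ∃ n, (k : ℕ) < j n := ⟨k + 1, lt_of_lt_of_le (Nat.lt_succ_self _) hy.mono.le_apply⟩
    refine ⟨Nat.find hex - 1, fun i hi => ?_, fun i hi => ?_⟩
    · exact not_lt.1 (Nat.find_min hex (by omega))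
    · exact (Nat.find_spec hex).trans_le (hy.mono.monotone (by omega))
  have huniq : ∀ i, ¬ S i → ∀ l l', M l i → M l' i → l = l' := by
    intro i hi l l' h h'
    rcases lt_trichotomy l l' with hlt | heq | hlt
    · exact absurd ⟨l, l', hlt, h, h'⟩ hi
    · exact heq
    · exact absurd ⟨l', l, hlt, h', h⟩ hi
  have hex : ∀ i, ∃ v : ℕ, i ≠ i₀ → (k : ℕ) ≤ v ∧
      |pairing (θ k • ∑ l, f l) (y i)| ≤ C * (weight θ k * weight θ (v - k)) + ε ∧
      (v < L → S i ∨ ¬ S i ∧ ∃ l, M l i ∧ v = k + hl l i) := by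
    intro i
    by_cases hSi : S i
    · rcases lt_trichotomy i i₀ with hlt | heq | hlt
      -- A value of at least `L` acts as infinite order: such indices are never counted in the
      -- coverings.
      · refine ⟨k + L, fun _ => ⟨Nat.le_add_right _ _, ?_, fun h => absurd h (by omega)⟩⟩
        refine (abs_pairing_smul_sum_le k hθ f (y i)).trans ?_
        have h1 : ∑ l, |pairing (f l) (y i)| ≤ ∑ a ∈ (y i).support, |y i a| := by
          refine (Finset.sum_le_sum fun l _ => abs_pairing_le_sum_inter hθ (hf l) (y i)).trans ?_
          rw [← Finset.sum_biUnion]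
          · refine Finset.sum_le_sum_of_subset_of_nonneg ?_ fun a _ _ => abs_nonneg _
            exact Finset.biUnion_subset.2 fun l _ => Finset.inter_subset_left
          · intro l _ l' _ hll
            exact (hE.disjoint hll).mono Finset.inter_subset_right Finset.inter_subset_right
        have h2 : weight θ k * ∑ l, |pairing (f l) (y i)| ≤ ε :=
          (mul_le_mul (weight_antitone hθ (hi₀ i hlt)) h1
            (Finset.sum_nonneg fun _ _ => abs_nonneg _) (hw0 _)).trans (hy.small i)
        have := mul_nonneg hC (mul_nonneg (hw0 k) (hw0 (k + L - k)))
        linarith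
      · exact ⟨0, fun h => absurd heq h⟩
      · refine ⟨k, fun _ => ⟨le_rfl, ?_, fun _ => Or.inl hSi⟩⟩
        rw [Nat.sub_self, weight_zero, mul_one, mul_comm C]
        refine (abs_pairing_smul_sum_le k hθ f (y i)).trans ?_
        refine (mul_le_mul_of_nonneg_left ((Finset.sum_le_sum fun l _ =>
          abs_pairing_le_tnorm_filter hθ (hf l) (y i)).trans
            (hy.split i k k.pos (hi₀' i hlt) d _ hE)) (hw0 k)).trans ?_
        linarith
    · by_cases hMi : ∃ l, M l i
      · obtain ⟨l, hMl⟩ := hMi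
        refine ⟨k + hl l i, fun _ => ⟨Nat.le_add_right _ _, ?_,
          fun _ => Or.inr ⟨hSi, l, hMl, rfl⟩⟩⟩
        rw [Nat.add_sub_cancel_left]
        refine (abs_pairing_smul_sum_le_of_unique k hθ f (y i) l fun l' hl' a ha hay =>
          hl' (huniq i hSi l' l ⟨a, ha, hay⟩ hMl)).trans ?_
        calc weight θ k * |pairing (f l) (y i)| ≤ weight θ k * (C * weight θ (hl l i) + ε) :=
              mul_le_mul_of_nonneg_left (hlb l i) (hw0 _)
          _ = C * (weight θ k * weight θ (hl l i)) + weight θ k * ε := by ring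
          _ ≤ _ := by
              have := mul_le_of_le_one_left hε (weight_le_one hθ k)
              linarith
      · refine ⟨k + L, fun _ => ⟨Nat.le_add_right _ _, ?_, fun h => absurd h (by omega)⟩⟩
        rw [pairing_smul_sum_eq_zero k f (y i) fun l a ha hay => hMi ⟨l, a, ha, hay⟩, abs_zero]
        have := mul_nonneg hC (mul_nonneg (hw0 k) (hw0 (k + L - k)))
        linarith
  choose h hh using hex
  refine ⟨h, i₀, fun i hi => ⟨(hh i hi).1, (hh i hi).2.1⟩, fun r hr H hH => ?_⟩
  rcases lt_or_ge r (k : ℕ) with hrk | hkr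
  · have : H = ∅ := Finset.eq_empty_of_forall_notMem fun i hi => by
      have := (hh i (hH i hi).1).1
      have := (hH i hi).2
      omega
    rw [this]; exact Covered.empty _ _
  have h1 : Covered 1 k ((H.filter S).image t) :=
    Covered.of_split hE (D := fun e => {a | a ∈ (y e).support})
      (fun o o' h a ha b hb => hB.lt_of_lt h ha hb) hB.upper_strictMono
      (fun o a ha => hB.upper o a ha) fun o ho => (Finset.mem_filter.1 ho).2
  have h2 : Covered (2 * (r - k) + 1) (k + (r - k)) ((Finset.univ.biUnion fun l =>
      H.filter fun i => ¬ S i ∧ M l i ∧ h i = k + hl l i).image t) := by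
    refine Covered.iUnion_of_admissible hE hB.upper_strictMono ?_ ?_ ?_
    · intro l i hi
      obtain ⟨-, -, ⟨a, ha, hay⟩, -⟩ := Finset.mem_filter.1 hi
      exact ⟨a, ha, hB.upper i a hay⟩
    · intro l l' hll i hi i' hi'
      obtain ⟨-, hSi, ⟨a, ha, hay⟩, -⟩ := Finset.mem_filter.1 hi
      obtain ⟨-, -, ⟨a', ha', hay'⟩, -⟩ := Finset.mem_filter.1 hi'
      refine lt_of_le_of_ne (hB.le_of_le hay hay' (hE.2.1 l l' hll a ha a' ha').le) ?_
      rintro rfl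
      exact hSi ⟨l, l', hll, ⟨a, ha, hay⟩, ⟨a', ha', hay'⟩⟩
    · intro l
      refine hlc l (r - k) (by omega) _ fun i hi => ?_
      obtain ⟨hiH, -, -, hhi⟩ := Finset.mem_filter.1 hi
      have := (hH i hiH).2
      omega
  -- One set for the split vectors and `2 * (r - k) + 1` for the others: at most `2 * r` because `k
  -- ≥ 1`. This leaves room for one more set that covers `i₀`.
  have h3 := (h1.mono le_rfl hkr).union (h2.mono le_rfl (by omega : k + (r - k) ≤ r))
  have hk0 := k.pos
  refine (h3.mono (by omega) le_rfl).subset ?_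
  rw [← Finset.image_union]
  refine Finset.image_subset_image fun i hi => ?_
  rcases (hh i (hH i hi).1).2.2 ((hH i hi).2.trans_lt hr) with hS' | ⟨hS', l, hMl, hv⟩
  · exact Finset.mem_union_left _ (Finset.mem_filter.2 ⟨hi, hS'⟩)
  · exact Finset.mem_union_right _ (Finset.mem_biUnion.2 ⟨l, Finset.mem_univ _,
      Finset.mem_filter.2 ⟨hi, hS', hMl, hv⟩⟩)

theorem analysis_basis (hy : IsRapid hθ y ℓ t j C ε) (hC : 1 ≤ C) (hε : 0 ≤ ε) (L : ℕ)
    {f : ℕ+ →₀ ℝ} (hf : TNorming θ f) {n : ℕ+} (hn : f.support ⊆ {n}) :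
    Analysis θ y t C ε L f := by
  classical
  refine ⟨fun i => if n ∈ (y i).support then 0 else L, fun i => ?_, fun r hr H hH => ?_⟩
  · dsimp only
    split_ifs with h
    · rw [weight_zero]
      linarith [(abs_pairing_le_tnorm hθ hf (y i)).trans (hy.norm_le i)]
    · rw [pairing_eq_zero (Finset.disjoint_left.2 fun a ha => by
        rw [Finset.mem_singleton.1 (hn ha)]; exact h), abs_zero]
      have := mul_nonneg (zero_le_one.trans hC) (weight_pos hθ L).le
      linarith
  · have hmem : ∀ i ∈ H, n ∈ (y i).support := fun i hi => by
      by_contra h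
      have := hH i hi
      simp only [if_neg h] at this
      omega
    exact (Covered.of_subsingleton (fun i hi i' hi' =>
      hy.toIsBlock.eq_of_mem (hmem i hi) (hmem i' hi')) r).mono (by omega) le_rfl

theorem Norming.analysis (hy : IsRapid hθ y ℓ t j C ε) (hC : 1 ≤ C) (hε : 0 ≤ ε) (L : ℕ)
    {f : ℕ+ →₀ ℝ} (hf : TNorming θ f) : Analysis θ y t C ε L f := by
  classical
  induction hf with
  | basis n => exact analysis_basis hy hC hε L (.basis n) Finsupp.support_single_subset
  | neg_basis n => exact analysis_basis hy hC hε L (.neg_basis n) Finsupp.support_single_subset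
  | sum k d f hd hf hE ih =>
    obtain ⟨h, i₀, hb, hc⟩ := exists_analysis_of_sum hy (zero_le_one.trans hC) hε k hf hE ih
    -- Order 0 is always admissible for the exceptional vector, since its norm is at most `1 ≤ C`.
    refine ⟨Function.update h i₀ 0, fun i => ?_, fun r hr H hH => ?_⟩
    · rcases eq_or_ne i i₀ with rfl | hi
      · rw [Function.update_self, weight_zero]
        linarith [(abs_pairing_le_tnorm hθ (Norming.sum k d f hd hf hE) (y i)).trans
          (hy.norm_le i)]
      · rw [Function.update_of_ne hi]
        obtain ⟨h1, h2⟩ := hb i hi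
        have h3 := weight_mul_le hθ k (h i - k)
        rw [Nat.add_sub_cancel' h1] at h3
        have := mul_le_mul_of_nonneg_left h3 (zero_le_one.trans hC)
        linarith
    · have h1 := hc r hr (H.filter fun i => i ≠ i₀) fun i hi => by
        obtain ⟨hiH, hi⟩ := Finset.mem_filter.1 hi
        have := hH i hiH
        rw [Function.update_of_ne hi] at this
        exact ⟨hi, this⟩
      have h2 : Covered 1 r ((H.filter fun i => i = i₀).image t) :=
        Covered.of_subsingleton (fun i hi i' hi' =>
          (Finset.mem_filter.1 hi).2.trans (Finset.mem_filter.1 hi').2.symm) r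
      refine (h1.union h2).subset ?_
      rw [← Finset.image_union]
      refine Finset.image_subset_image fun i hi => ?_
      by_cases h : i = i₀
      · exact Finset.mem_union_right _ (Finset.mem_filter.2 ⟨hi, h⟩)
      · exact Finset.mem_union_left _ (Finset.mem_filter.2 ⟨hi, h⟩)

/-- A refinement of `Analysis` relative to a partition of the indices into successive cells:
outside of a small set of cells, the chains that lead to the vectors of a cell have a common
initial part of order `τ ≥ q`. -/
def CellAnalysis (θ : ℕ+ → ℝ) (y : ℕ → ℕ+ →₀ ℝ) (t : ℕ → ℕ+) (κ : ℕ → ℕ) (T : ℕ → ℕ+)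
    (C ε : ℝ) (L q : ℕ) (f : ℕ+ →₀ ℝ) : Prop :=
  ∃ (h : ℕ → ℕ) (B : Set ℕ), (∀ H : Finset ℕ, ↑H ⊆ B → Covered q (q - 1) (H.image T)) ∧
    (∀ p ∉ B, ∃ τ ≥ q, ∀ i, κ i = p → τ ≤ h i ∧
      |pairing f (y i)| ≤ C * (weight θ τ * weight θ (h i - τ)) + ε) ∧
    ∀ r < L, ∀ H : Finset ℕ, (∀ i ∈ H, κ i ∉ B ∧ h i ≤ r) → Covered (2 * r + 1) r (H.image t)

variable {κ : ℕ → ℕ} {T : ℕ → ℕ+}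

theorem cellAnalysis_basis (hy : IsRapid hθ y ℓ t j C ε) (hC : 1 ≤ C) (hε : 0 ≤ ε) (L : ℕ)
    {q : ℕ} (hq : 0 < q) {f : ℕ+ →₀ ℝ} {n : ℕ+} (hn : f.support ⊆ {n}) :
    CellAnalysis θ y t κ T C ε L q f := by
  -- A coordinate functional acts on at most one cell, which is declared bad; on all others it
  -- vanishes.
  refine ⟨fun _ => q + L, {p | ∃ i, κ i = p ∧ n ∈ (y i).support}, fun H hH => ?_,
    fun p hp => ⟨q, le_rfl, fun i hi => ⟨Nat.le_add_right _ _, ?_⟩⟩, fun r hr H hH => ?_⟩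
  · refine (Covered.of_subsingleton (fun p hp p' hp' => ?_) (q - 1)).mono hq le_rfl
    obtain ⟨i, rfl, hi⟩ := hH hp
    obtain ⟨i', rfl, hi'⟩ := hH hp'
    rw [hy.toIsBlock.eq_of_mem hi hi']
  · rw [pairing_eq_zero (Finset.disjoint_left.2 fun a ha => by
      rw [Finset.mem_singleton.1 (hn ha)]; exact fun h => hp ⟨i, hi, h⟩), abs_zero]
    have := mul_nonneg (zero_le_one.trans hC)
      (mul_nonneg (weight_pos hθ q).le (weight_pos hθ (q + L - q)).le)
    linarith
  · have : H = ∅ := Finset.eq_empty_of_forall_notMem fun i hi => by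
      have : q + L ≤ r := (hH i hi).2
      omega
    rw [this]; exact Covered.empty _ _

/-- Induction along the tree for all `q` at once. If the root has order `k ≥ q`, it is itself the
common initial part, and only the cell of the exceptional vector is bad. If `k < q`, a cell met by
two summands is bad; any other cell is met by at most one summand, whose analysis for `q - k` is
prolonged by `k`. -/
theorem Norming.cellAnalysis (hy : IsRapid hθ y ℓ t j C ε) (hC : 1 ≤ C) (hε : 0 ≤ ε) (L : ℕ)
    (hκ : Monotone κ) (hT : StrictMono T) (htT : ∀ i, t i ≤ T (κ i))
    {f : ℕ+ →₀ ℝ} (hf : TNorming θ f) :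
    ∀ q, 0 < q → CellAnalysis θ y t κ T C ε L q f := by
  classical
  have hw0 := fun n => (weight_pos hθ n).le
  have hC0 := zero_le_one.trans hC
  have hB := hy.toIsBlock
  induction hf with
  | basis n => exact fun q hq => cellAnalysis_basis hy hC hε L hq Finsupp.support_single_subset
  | neg_basis n =>
    exact fun q hq => cellAnalysis_basis hy hC hε L hq Finsupp.support_single_subset
  | sum k d f hd hf hE ih =>
    intro q hq
    have hk0 := k.pos
    rcases le_or_gt q k with hqk | hkq
    · obtain ⟨h, i₀, hb, hc⟩ := exists_analysis_of_sum hy hC0 hε (L := L) k hf hE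
        fun l => (hf l).analysis hy hC hε L
      refine ⟨h, {κ i₀}, fun H hH => ?_, fun p hp => ⟨k, hqk, fun i hi => hb i ?_⟩,
        fun r hr H hH => ?_⟩
      · exact (Covered.of_subsingleton (fun p hp p' hp' => (hH hp).trans (hH hp').symm)
          (q - 1)).mono hq le_rfl
      · rintro rfl; exact hp hi.symm
      · refine (hc r hr H fun i hi => ⟨?_, (hH i hi).2⟩).mono (Nat.le_succ _) le_rfl
        rintro rfl; exact (hH i hi).1 rfl
    choose hl Bl hlB hlb hlc using fun l => ih l (q - k) (by omega)
    set M : Fin d → ℕ → Prop := fun l i => ∃ a ∈ (f l).support, a ∈ (y i).support with hM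
    set N : Fin d → ℕ → Prop := fun l p => ∃ a ∈ (f l).support, ∃ i, κ i = p ∧ a ∈ (y i).support
      with hN
    set S : ℕ → Prop := fun p => ∃ l l', l < l' ∧ N l p ∧ N l' p with hS
    have hMN : ∀ l i, M l i → N l (κ i) := fun l i ⟨a, ha, hai⟩ => ⟨a, ha, i, rfl, hai⟩
    have huniq : ∀ p, ¬ S p → ∀ l l', N l p → N l' p → l = l' := by
      intro p hp l l' h h'
      rcases lt_trichotomy l l' with hlt | heq | hlt
      · exact absurd ⟨l, l', hlt, h, h'⟩ hp
      · exact heq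
      · exact absurd ⟨l', l, hlt, h', h⟩ hp
    set B : Set ℕ := {p | S p ∨ ¬ S p ∧ ∃ l, N l p ∧ p ∈ Bl l} with hBdef
    -- A vector missed by the summand that acts on its cell still needs an order above the common
    -- `τ`; adding `L` ensures this and keeps it out of the coverings. Cells met by no summand use
    -- `τ = q`.
    have hex : ∀ i, ∃ v : ℕ, κ i ∉ B → ((∃ l, N l (κ i) ∧
        ((M l i ∧ v = k + hl l i) ∨ (¬ M l i ∧ v = k + hl l i + L))) ∨
        ((∀ l, ¬ N l (κ i)) ∧ v = q + L)) := by
      intro i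
      by_cases hN' : ∃ l, N l (κ i)
      · obtain ⟨l, hl'⟩ := hN'
        by_cases hMl : M l i
        · exact ⟨_, fun _ => Or.inl ⟨l, hl', Or.inl ⟨hMl, rfl⟩⟩⟩
        · exact ⟨_, fun _ => Or.inl ⟨l, hl', Or.inr ⟨hMl, rfl⟩⟩⟩
      · push Not at hN'
        exact ⟨_, fun _ => Or.inr ⟨hN', rfl⟩⟩
    choose h hh using hex
    refine ⟨h, B, fun H hH => ?_, fun p hp => ?_, fun r hr H hH => ?_⟩
    · have h1 : Covered 1 k ((H.filter S).image T) := by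
        refine Covered.of_split hE (D := fun p => {a | ∃ i, κ i = p ∧ a ∈ (y i).support})
          ?_ hT ?_ fun o ho => (Finset.mem_filter.1 ho).2
        · rintro p p' hpp a ⟨i, rfl, ha⟩ b ⟨i', rfl, hb⟩
          exact hB.lt_of_lt (not_le.1 fun hle => absurd (hκ hle) (not_le.2 hpp)) ha hb
        · rintro p a ⟨i, rfl, ha⟩
          exact (hB.upper i a ha).trans (htT i)
      have h2 : Covered (q - k) (k + (q - k - 1)) ((Finset.univ.biUnion fun l =>
          H.filter fun p => ¬ S p ∧ N l p ∧ p ∈ Bl l).image T) := by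
        refine Covered.iUnion_of_admissible hE hT ?_ ?_ ?_
        · intro l p hp
          obtain ⟨-, -, ⟨a, ha, i, rfl, hai⟩, -⟩ := Finset.mem_filter.1 hp
          exact ⟨a, ha, (hB.upper i a hai).trans (htT i)⟩
        · intro l l' hll p hp p' hp'
          obtain ⟨-, hSp, hNp, -⟩ := Finset.mem_filter.1 hp
          obtain ⟨-, -, hNp', -⟩ := Finset.mem_filter.1 hp'
          refine lt_of_le_of_ne ?_ ?_
          · obtain ⟨a, ha, i, rfl, hai⟩ := hNp
            obtain ⟨a', ha', i', rfl, hai'⟩ := hNp'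
            exact hκ (hB.le_of_le hai hai' (hE.2.1 l l' hll a ha a' ha').le)
          · rintro rfl
            exact hSp ⟨l, l', hll, hNp, hNp'⟩
        · intro l
          exact hlB l _ fun p hp => (Finset.mem_filter.1 (Finset.mem_coe.1 hp)).2.2.2
      -- One set for the split cells and `q - k` sets from the summands: at most `q` sets of order
      -- `q - 1`, as `1 ≤ k < q`.
      refine (((h1.mono le_rfl (by omega : (k : ℕ) ≤ q - 1)).union
        (h2.mono le_rfl (by omega : k + (q - k - 1) ≤ q - 1))).mono (by omega) le_rfl).subset ?_
      rw [← Finset.image_union]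
      refine Finset.image_subset_image fun p hp => ?_
      rcases hH hp with hS' | ⟨hS', l, hNl, hBl⟩
      · exact Finset.mem_union_left _ (Finset.mem_filter.2 ⟨hp, hS'⟩)
      · exact Finset.mem_union_right _ (Finset.mem_biUnion.2 ⟨l, Finset.mem_univ _,
          Finset.mem_filter.2 ⟨hp, hS', hNl, hBl⟩⟩)
    · have hSp : ¬ S p := fun h => hp (Or.inl h)
      by_cases hNp : ∃ l, N l p
      · obtain ⟨l, hNl⟩ := hNp
        have hpB : p ∉ Bl l := fun h => hp (Or.inr ⟨hSp, l, hNl, h⟩)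
        obtain ⟨τ, hτ, hτb⟩ := hlb l p hpB
        refine ⟨k + τ, by omega, fun i hi => ?_⟩
        obtain ⟨hτh, hbd⟩ := hτb i hi
        subst hi
        rcases hh i hp with ⟨l', hNl', hcase⟩ | ⟨hno, -⟩
        swap
        · exact absurd hNl (hno l)
        obtain rfl := huniq _ hSp l' l hNl' hNl
        have hother : ∀ l ≠ l', ∀ a ∈ (f l).support, a ∉ (y i).support := fun l hl a ha hay =>
          hl (huniq _ hSp l l' (hMN l i ⟨a, ha, hay⟩) hNl)
        rcases hcase with ⟨hMi, hv⟩ | ⟨hMi, hv⟩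
        · refine ⟨by omega, (abs_pairing_smul_sum_le_of_unique k hθ f (y i) l' hother).trans ?_⟩
          rw [hv, Nat.add_sub_add_left]
          calc weight θ k * |pairing (f l') (y i)|
              ≤ weight θ k * (C * (weight θ τ * weight θ (hl l' i - τ)) + ε) :=
                mul_le_mul_of_nonneg_left hbd (hw0 _)
            _ = C * ((weight θ k * weight θ τ) * weight θ (hl l' i - τ)) + weight θ k * ε := by
                ring
            _ ≤ C * (weight θ (k + τ) * weight θ (hl l' i - τ)) + 1 * ε := by
                gcongr
                · exact hw0 _
                · exact weight_mul_le hθ k τ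
                · exact weight_le_one hθ k
            _ = _ := by rw [one_mul]
        · refine ⟨by omega, ?_⟩
          rw [pairing_smul_sum_eq_zero k f (y i) fun l a ha hay => ?_, abs_zero]
          · have := mul_nonneg hC0 (mul_nonneg (hw0 (k + τ)) (hw0 (h i - (k + τ))))
            linarith
          · rcases eq_or_ne l l' with rfl | hne
            · exact hMi ⟨a, ha, hay⟩
            · exact hother l hne a ha hay
      · refine ⟨q, le_rfl, fun i hi => ?_⟩
        subst hi
        rcases hh i hp with ⟨l', hNl', -⟩ | ⟨hno, hv⟩
        · exact absurd ⟨l', hNl'⟩ hNp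
        refine ⟨by omega, ?_⟩
        rw [pairing_smul_sum_eq_zero k f (y i) fun l a ha hay => hno l (hMN l i ⟨a, ha, hay⟩),
          abs_zero]
        have := mul_nonneg hC0 (mul_nonneg (hw0 q) (hw0 (h i - q)))
        linarith
    · have hcase : ∀ i ∈ H, ∃ l, M l i ∧ h i = k + hl l i := by
        intro i hi
        have := (hH i hi).2
        rcases hh i (hH i hi).1 with ⟨l, -, ⟨hMl, hv⟩ | ⟨-, hv⟩⟩ | ⟨-, hv⟩
        · exact ⟨l, hMl, hv⟩
        · omega
        · omega
      rcases lt_or_ge r (k : ℕ) with hrk | hkr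
      · have : H = ∅ := Finset.eq_empty_of_forall_notMem fun i hi => by
          obtain ⟨l, -, hv⟩ := hcase i hi
          have := (hH i hi).2
          omega
        rw [this]; exact Covered.empty _ _
      -- Unlike in the previous analysis, no set is spent on split vectors: a vector met by two
      -- summands lies in a bad cell.
      have h2 : Covered (2 * (r - k) + 1) (k + (r - k)) ((Finset.univ.biUnion fun l =>
          H.filter fun i => M l i ∧ h i = k + hl l i).image t) := by
        refine Covered.iUnion_of_admissible hE hB.upper_strictMono ?_ ?_ ?_
        · intro l i hi
          obtain ⟨-, ⟨a, ha, hay⟩, -⟩ := Finset.mem_filter.1 hi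
          exact ⟨a, ha, hB.upper i a hay⟩
        · intro l l' hll i hi i' hi'
          obtain ⟨hiH, hMi, -⟩ := Finset.mem_filter.1 hi
          obtain ⟨-, hMi', -⟩ := Finset.mem_filter.1 hi'
          refine lt_of_le_of_ne ?_ ?_
          · obtain ⟨a, ha, hay⟩ := hMi
            obtain ⟨a', ha', hay'⟩ := hMi'
            exact hB.le_of_le hay hay' (hE.2.1 l l' hll a ha a' ha').le
          · rintro rfl
            exact (hH i hiH).1 (Or.inl ⟨l, l', hll, hMN l i hMi, hMN l' i hMi'⟩)
        · intro l
          refine hlc l (r - k) (by omega) _ fun i hi => ?_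
          obtain ⟨hiH, hMi, hhi⟩ := Finset.mem_filter.1 hi
          have := (hH i hiH).2
          refine ⟨fun hBl => (hH i hiH).1 ?_, by omega⟩
          by_cases hSi : S (κ i)
          · exact Or.inl hSi
          · exact Or.inr ⟨hSi, l, hMN l i hMi, hBl⟩
      refine (h2.mono (by omega) (by omega : k + (r - k) ≤ r)).subset ?_
      refine Finset.image_subset_image fun i hi => ?_
      obtain ⟨l, hMl, hv⟩ := hcase i hi
      exact Finset.mem_biUnion.2 ⟨l, Finset.mem_univ _, Finset.mem_filter.2 ⟨hi, hMl, hv⟩⟩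

end rapid

/-! ### Disjoint vectors with bounded sum -/

theorem exists_isRapid {θ : ℕ+ → ℝ} (hθ : RegularSequence θ)
    (hlim : Tendsto (fun n : ℕ+ => θ n ^ (1 / ((n : ℕ) : ℝ))) atTop (𝓝 1))
    {W : Submodule ℝ (ℕ+ →₀ ℝ)}
    (hW : ∀ p : ℕ+, ∃ w ∈ W, w ≠ 0 ∧ ∀ a ∈ w.support, p ≤ a) {ε : ℝ} (hε : 0 < ε) (p : ℕ+) :
    ∃ (y : ℕ → ℕ+ →₀ ℝ) (ℓ t : ℕ → ℕ+) (j : ℕ → ℕ), IsRapid hθ y ℓ t j 4 ε ∧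
      (∀ i, y i ∈ W) ∧ (∀ i, tnorm hθ (y i) = 1) ∧ ∀ i, p ≤ ℓ i := by
  obtain ⟨y₀, h₀W, h₀1, h₀p, h₀s⟩ := exists_splitBound hθ hlim hW one_pos p
  obtain ⟨s, ℓ, t, hs0, hR, hblk, hℓ⟩ := exists_isBlock
    (α := {x : (ℕ+ →₀ ℝ) × ℕ // x.1 ∈ W ∧ tnorm hθ x.1 = 1 ∧ SplitBound hθ x.2 4 x.1})
    (v := fun x => x.1.1)
    (R := fun x x' => x.1.2 < x'.1.2 ∧ weight θ x'.1.2 * ∑ a ∈ x.1.1.support, |x.1.1 a| ≤ ε)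
    (fun x hx => by have := x.2.2.1; rw [hx, tnorm_zero] at this; exact zero_ne_one this)
    (fun x q => by
      have hS : 0 ≤ ∑ a ∈ x.1.1.support, |x.1.1 a| := Finset.sum_nonneg fun _ _ => abs_nonneg _
      obtain ⟨j', hj', hw⟩ := exists_weight_lt hθ
        (show 0 < ε / (∑ a ∈ x.1.1.support, |x.1.1 a| + 1) by positivity) (x.1.2 + 1)
      obtain ⟨y, hyW, hy1, hyq, hys⟩ := exists_splitBound hθ hlim hW
        (show 0 < j' by omega) q
      refine ⟨⟨(y, j'), hyW, hy1, hys⟩, ⟨by exact hj', ?_⟩, hyq⟩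
      rw [lt_div_iff₀ (by positivity)] at hw
      have := weight_pos hθ j'
      dsimp only
      linarith)
    ⟨(y₀, 1), h₀W, h₀1, h₀s⟩
  refine ⟨_, ℓ, t, fun i => (s i).1.2, ⟨hblk, fun i => (s i).2.2.1.le, fun i => (s i).2.2.2,
    strictMono_nat_of_lt_succ fun i => (hR i).1, fun i => (hR i).2⟩, fun i => (s i).2.1,
    fun i => (s i).2.2.1, fun i => ?_⟩
  refine le_trans ?_ (hblk.lower_strictMono.monotone (Nat.zero_le i))
  have := hℓ 0
  rw [hs0] at this
  exact h₀p _ this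

/-! ### Interlaced averages with a common distribution on cells -/

theorem mapDomain_nonneg {ι κ : Type*} {b : ι →₀ ℝ} (hb : ∀ i, 0 ≤ b i) (t : ι → κ) (a : κ) :
    0 ≤ b.mapDomain t a := by
  classical
  rw [Finsupp.mapDomain, Finsupp.sum, Finsupp.finsetSum_apply]
  refine Finset.sum_nonneg fun i _ => ?_
  rw [Finsupp.single_apply]
  split_ifs
  · exact hb i
  · exact le_rfl

theorem sum_mapDomain_eq {t : ℕ → ℕ+} (ht : Function.Injective t) (b : ℕ →₀ ℝ) (A : Finset ℕ+) :
    ∑ a ∈ A, b.mapDomain t a = ∑ i ∈ b.support.filter fun i => t i ∈ A, b i := by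
  classical
  rw [← sum_image_mapDomain ht]
  symm
  refine Finset.sum_subset (fun a ha => ?_) fun a ha ha' => ?_
  · obtain ⟨i, hi, rfl⟩ := Finset.mem_image.1 ha
    exact (Finset.mem_filter.1 hi).2
  · by_contra h
    obtain ⟨i, hi, rfl⟩ := Finset.mem_image.1
      (Finsupp.mapDomain_support (Finsupp.mem_support_iff.2 h))
    exact ha' (Finset.mem_image_of_mem t (Finset.mem_filter.2 ⟨hi, ha⟩))

theorem sum_mapDomain_le {t : ℕ → ℕ+} (ht : Function.Injective t) {b : ℕ →₀ ℝ}
    (hb : ∀ i, 0 ≤ b i) (A : Finset ℕ+) : ∑ a ∈ A, b.mapDomain t a ≤ b.sum fun _ x => x := by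
  rw [sum_mapDomain_eq ht]
  exact Finset.sum_le_sum_of_subset_of_nonneg (Finset.filter_subset _ _) fun i _ _ => hb i

theorem mem_support_linearCombination {β : ℕ → ℕ →₀ ℝ} {c : ℕ →₀ ℝ} {i : ℕ}
    (hi : i ∈ (Finsupp.linearCombination ℝ β c).support) :
    ∃ p ∈ c.support, i ∈ (β p).support := by
  rw [Finsupp.mem_support_iff, Finsupp.linearCombination_apply, Finsupp.sum,
    Finsupp.finsetSum_apply] at hi
  obtain ⟨e, he, hea⟩ := Finset.exists_ne_zero_of_sum_ne_zero hi
  exact ⟨e, he, Finsupp.mem_support_iff.2 (right_ne_zero_of_mul hea)⟩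

/-- Simultaneous special convex combinations with the same distribution on successive cells. -/
theorem IsBlock.exists_cell_averages {y : ℕ → ℕ+ →₀ ℝ} {ℓ t : ℕ → ℕ+} (hB : IsBlock y ℓ t)
    {n : ℕ} (hn : 0 < n) (m : ℕ) (r : Fin n → ℕ) {η : ℝ} (hη : 0 < η) :
    ∃ (κ : ℕ → ℕ) (T : ℕ → ℕ+) (c : ℕ →₀ ℝ) (β : Fin n → ℕ → ℕ →₀ ℝ),
      Monotone κ ∧ StrictMono T ∧ (∀ i, t i ≤ T (κ i)) ∧ (∀ p, 0 ≤ c p) ∧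
      c.sum (fun _ x => x) = 1 ∧ (∀ s p i, 0 ≤ β s p i) ∧
      (∀ s p, (β s p).sum (fun _ x => x) = 1) ∧ (∀ s p, ∀ i ∈ (β s p).support, κ i = p) ∧
      (∀ s s' p p' i, i ∈ (β s p).support → i ∈ (β s' p').support → s = s') ∧
      SmallOn (c.mapDomain T) m η ∧
      ∀ s, SmallOn ((Finsupp.linearCombination ℝ (β s) c).mapDomain t) (m + r s) η ∧
        (Finsupp.linearCombination ℝ (β s) c).support.image ℓ ∈ schreier (m + r s) := by
  classical
  have hti := hB.upper_strictMono.injective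
  have hη' : ∀ g : ℕ, (0 : ℝ) < 1 / (g + 1) := fun g => by positivity
  -- The groups `g` run cyclically through the orders `r`, with tolerances `1 / (g + 1)`; `n`
  -- consecutive groups make up a cell, so each cell holds one average of every order.
  choose A hA0 hA1 hAP hAℓ hAs using fun (g P : ℕ) =>
    hB.exists_average (r ⟨g % n, Nat.mod_lt g hn⟩) (hη' g) P
  obtain ⟨P, hP0, hPs⟩ : ∃ P : ℕ → ℕ, P 0 = 0 ∧
      ∀ g, P (g + 1) = (A g (P g)).support.sup id + 1 :=
    ⟨fun g => Nat.rec 0 (fun g P => (A g P).support.sup id + 1) g, rfl, fun _ => rfl⟩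
  set b : ℕ → ℕ →₀ ℝ := fun g => A g (P g) with hb
  have hbs : ∀ g, ∀ i ∈ (b g).support, P g ≤ i ∧ i < P (g + 1) := fun g i hi =>
    ⟨hAP _ _ i hi, by rw [hPs]; exact Nat.lt_succ_of_le (Finset.le_sup (f := id) hi)⟩
  have hbne : ∀ g, (b g).support.Nonempty := fun g => by
    rw [Finsupp.support_nonempty_iff]
    intro h0
    have := hA1 g (P g)
    simp only [hb] at h0
    rw [h0] at this
    simp at this
  have hP : StrictMono P := strictMono_nat_of_lt_succ fun g => by
    obtain ⟨i, hi⟩ := hbne g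
    exact (hbs g i hi).1.trans_lt (hbs g i hi).2
  -- The group to which an index belongs; dividing it by `n` gives the cell.
  set γ : ℕ → ℕ := fun i => Nat.findGreatest (fun g => P g ≤ i) i with hγ
  have hγ1 : ∀ i, P (γ i) ≤ i := fun i =>
    Nat.findGreatest_spec (P := fun g => P g ≤ i) (Nat.zero_le i) (by simp [hP0])
  have hγ3 : ∀ i g, P g ≤ i → g ≤ γ i := fun i g h =>
    Nat.le_findGreatest (P := fun g => P g ≤ i) (hP.le_apply.trans h) h
  have hγ2 : ∀ i, i < P (γ i + 1) := fun i => not_le.1 fun h =>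
    absurd (hγ3 i _ h) (by omega)
  have hγb : ∀ g, ∀ i ∈ (b g).support, γ i = g := fun g i hi => by
    refine le_antisymm (Nat.lt_succ_iff.1 (hP.lt_iff_lt.1 ((hγ1 i).trans_lt (hbs g i hi).2)))
      (hγ3 i g (hbs g i hi).1)
  have hγm : Monotone γ := fun i i' h => hγ3 i' _ ((hγ1 i).trans h)
  have hPn : ∀ p, P (p * n) < P ((p + 1) * n) := fun p => hP (by rw [add_one_mul]; omega)
  set Λ : ℕ → ℕ+ := fun p => ℓ (P (p * n)) with hΛ
  set T : ℕ → ℕ+ := fun p => t (P ((p + 1) * n) - 1) with hT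
  have hΛT : ∀ p, Λ p ≤ T p := fun p =>
    (hB.lower_strictMono.monotone (by have := hPn p; omega)).trans (hB.le _)
  have hTΛ : ∀ p, T p < Λ (p + 1) := fun p =>
    hB.upper_lt_lower (by have := hPn p; omega)
  have hΛmono : StrictMono Λ := strictMono_nat_of_lt_succ fun p => (hΛT p).trans_lt (hTΛ p)
  have hTmono : StrictMono T := strictMono_nat_of_lt_succ fun p => (hTΛ p).trans_le (hΛT _)
  have hmod : ∀ (p : ℕ) (s : Fin n), (p * n + s) % n = s := fun p s => by
    rw [add_comm, Nat.add_mul_mod_self_right, Nat.mod_eq_of_lt s.2]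
  have hdiv : ∀ (p : ℕ) (s : Fin n), (p * n + s) / n = p := fun p s => by
    rw [mul_comm, Nat.mul_add_div hn, Nat.div_eq_of_lt s.2, add_zero]
  set β : Fin n → ℕ → ℕ →₀ ℝ := fun s p => b (p * n + s) with hβ
  have hβP : ∀ s p, ∀ i ∈ (β s p).support, P (p * n) ≤ i ∧ i < P ((p + 1) * n) := by
    intro s p i hi
    obtain ⟨h1, h2⟩ := hbs _ i hi
    refine ⟨(hP.monotone (Nat.le_add_right _ _)).trans h1, h2.trans_le (hP.monotone ?_)⟩
    have := s.2
    rw [add_one_mul]; omega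
  have hβr : ∀ (s : Fin n) (p : ℕ), r ⟨(p * n + (s : ℕ)) % n, Nat.mod_lt _ hn⟩ = r s := fun s p =>
    congrArg r (Fin.ext (hmod p s))
  have hβt : ∀ s p a, (β s p).mapDomain t a ≠ 0 → Λ p ≤ a ∧ a ≤ T p := by
    intro s p a ha
    obtain ⟨i, hi, rfl⟩ := Finset.mem_image.1
      (Finsupp.mapDomain_support (Finsupp.mem_support_iff.2 ha))
    obtain ⟨h1, h2⟩ := hβP s p i hi
    exact ⟨(hB.lower_strictMono.monotone h1).trans (hB.le i),
      hB.upper_strictMono.monotone (by omega)⟩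
  -- The extra index `none` carries the point mass at `T p`, so that the same `c` is itself small of
  -- order `m` on the cells.
  obtain ⟨c, hc0, hc1, -, hcΛ, hcs⟩ := Tsirelson.exists_average (ι := Option (Fin n)) hΛT hTΛ
    (fun o => o.elim 0 r)
    (fun o p => o.elim (Finsupp.single (T p) 1) fun s => (β s p).mapDomain t)
    (by
      rintro (_ | s) p a
      · simp only [Option.elim_none, Finsupp.single_apply]; split_ifs <;> norm_num
      · exact mapDomain_nonneg (hA0 _ _) t a)
    (by
      rintro (_ | s) p S
      · exact sum_single_le_one _ _
      · exact (sum_mapDomain_le hti (hA0 _ _) S).trans (hA1 _ _).le)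
    (by
      rintro (_ | s) p a ha
      · simp only [Option.elim_none] at ha
        rw [Finsupp.single_apply_ne_zero] at ha
        rw [ha.1]; exact ⟨hΛT p, le_rfl⟩
      · exact hβt s p a ha)
    (by
      intro δ hδ
      obtain ⟨p₀, hp₀⟩ := exists_nat_one_div_lt hδ
      refine ⟨p₀, fun p hp o k hk S hS => ?_⟩
      rcases o with _ | s
      · exact absurd hk (Nat.not_lt_zero k)
      · simp only [Option.elim_some] at hk ⊢
        rw [sum_mapDomain_eq hti]
        have hkr : k < r ⟨(p * n + (s : ℕ)) % n, Nat.mod_lt _ hn⟩ := by rw [hβr]; exact hk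
        refine (hAs (p * n + s) (P (p * n + s)) k hkr _
          (schreier_hereditary k S hS _ fun a ha => ?_)).trans ?_
        · obtain ⟨i, hi, rfl⟩ := Finset.mem_image.1 ha
          exact (Finset.mem_filter.1 hi).2
        · refine le_trans ?_ hp₀.le
          refine one_div_le_one_div_of_le (by positivity) ?_
          have : p₀ ≤ p * n + s := hp.trans ((Nat.le_mul_of_pos_right p hn).trans
            (Nat.le_add_right _ _))
          exact_mod_cast Nat.succ_le_succ this)
    m η hη 0
  refine ⟨fun i => γ i / n, T, c, β, fun i i' h => Nat.div_le_div_right (hγm h), hTmono,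
    fun i => ?_, hc0, hc1, fun s p => hA0 _ _, fun s p => hA1 _ _, fun s p i hi => ?_,
    fun s s' p p' i hi hi' => ?_, ?_, fun s => ⟨?_, ?_⟩⟩
  · refine hB.upper_strictMono.monotone (Nat.le_sub_one_of_lt ((hγ2 i).trans_le
      (hP.monotone ?_)))
    have := Nat.lt_div_mul_add (a := γ i) hn
    dsimp only
    rw [add_one_mul]; omega
  · dsimp only
    rw [hγb _ i hi, hdiv]
  · have h1 := (hγb _ i hi).symm.trans (hγb _ i hi')
    refine Fin.ext ?_
    rw [← hmod p s, h1, hmod]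
  · have := hcs none
    simp only [Option.elim_none, add_zero] at this
    rwa [linearCombination_single_eq_mapDomain] at this
  · have := hcs (some s)
    simp only [Option.elim_some] at this
    have hcomp : (Finsupp.linearCombination ℝ (β s) c).mapDomain t =
        Finsupp.linearCombination ℝ (fun p => (β s p).mapDomain t) c := by
      rw [← Finsupp.lmapDomain_apply ℝ ℝ t, Finsupp.apply_linearCombination]
      rfl
    rwa [hcomp]
  · refine schreier_hereditary _ _ (biUnion_mem_schreier_add_of_strictMono hΛmono hcΛ
      (G := fun p => (β s p).support.image ℓ) (r := r s) ?_ ?_ ?_) _ ?_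
    · intro p _
      have := hAℓ (p * n + s) (P (p * n + s))
      rwa [hβr] at this
    · intro p _ x hx
      obtain ⟨i, hi, rfl⟩ := Finset.mem_image.1 hx
      exact hB.lower_strictMono.monotone (hβP s p i hi).1
    · intro p _ q _ hpq x hx z hz
      obtain ⟨i, hi, rfl⟩ := Finset.mem_image.1 hx
      obtain ⟨i', hi', rfl⟩ := Finset.mem_image.1 hz
      refine hB.lower_strictMono ((hβP s p i hi).2.trans_le (le_trans ?_ (hβP s q i' hi').1))
      exact hP.monotone (Nat.mul_le_mul_right n hpq)
    · intro x hx
      obtain ⟨i, hi, rfl⟩ := Finset.mem_image.1 hx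
      obtain ⟨p, hp, hip⟩ := mem_support_linearCombination hi
      exact Finset.mem_biUnion.2 ⟨p, hp, Finset.mem_image_of_mem _ hip⟩

/-- A sequence of orders along which the weights decrease fast, but slowly before each of them. -/
theorem exists_orders {θ : ℕ+ → ℝ} (hθ : RegularSequence θ)
    (hlim : Tendsto (fun n : ℕ+ => θ n ^ (1 / ((n : ℕ) : ℝ))) atTop (𝓝 1)) {δ : ℝ} (hδ : 0 < δ) :
    ∃ σ : ℕ → ℕ, StrictMono σ ∧ 0 < σ 0 ∧ weight θ (σ 0) ≤ δ ∧ ∀ g,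
      weight θ (σ (g + 1)) ≤ weight θ (σ g) * δ ∧
      weight θ (σ (g + 1) - σ g) ≤ 2 * weight θ (σ (g + 1)) := by
  obtain ⟨m, hm, hmδ⟩ := exists_weight_lt hθ hδ 1
  obtain ⟨σ, hσ0, hσ⟩ := exists_seq_of_forall_exists (R := fun x y : ℕ => x < y ∧
    weight θ y ≤ weight θ x * δ ∧ weight θ (y - x) ≤ 2 * weight θ y) (fun x => by
      -- Smallness of the weight survives increasing the order, so the place of slow decrease can be
      -- sought afterwards.
      obtain ⟨N, hN, hNw⟩ := exists_weight_lt hθ (mul_pos (weight_pos hθ x) hδ) (x + 1)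
      obtain ⟨s, hs, hsw⟩ := exists_weight_sub_le hlim hθ x N
      exact ⟨s, by omega, (weight_antitone hθ hs).trans hNw.le, hsw⟩) m
  exact ⟨σ, strictMono_nat_of_lt_succ fun g => (hσ g).1, by omega, by rw [hσ0]; exact hmδ.le,
    fun g => (hσ g).2⟩

/-- Let `σ G ≤ τ < σ (G + 1)`. Each summand is at most 1 by regularity. For `g < G` the weight of
order `τ` is already at most `1 / n` times that of order `σ g`. For `g > G + 1` one has `τ ≤ σ (g -
1)`, so the slow decrease costs a factor 2 at most, while the weight of order `τ` supplies `1 / n`.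
Only `G` and `G + 1` are left, which gives `2 + 1 + 1`. -/
theorem sum_weight_div_le {θ : ℕ+ → ℝ} (hθ : RegularSequence θ) {n : ℕ} (hn : 0 < n)
    {σ : ℕ → ℕ} (hσ : StrictMono σ) (hσ0 : weight θ (σ 0) ≤ 1 / n)
    (hσs : ∀ g, weight θ (σ (g + 1)) ≤ weight θ (σ g) * (1 / n) ∧
      weight θ (σ (g + 1) - σ g) ≤ 2 * weight θ (σ (g + 1))) {τ : ℕ} (hτ : σ 0 ≤ τ) :
    ∑ g ∈ Finset.range n, (weight θ (σ g))⁻¹ * (weight θ τ * weight θ (σ g - τ)) ≤ 4 := by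
  have hn' : (0 : ℝ) < n := by exact_mod_cast hn
  have hw := weight_pos hθ
  have hw1 := weight_le_one hθ
  have hanti := weight_antitone hθ
  set G := Nat.findGreatest (fun g => σ g ≤ τ) τ with hG
  have hG1 : σ G ≤ τ := Nat.findGreatest_spec (P := fun g => σ g ≤ τ) (Nat.zero_le τ) hτ
  have hG2 : τ < σ (G + 1) := not_le.1 fun h =>
    absurd (Nat.le_findGreatest (P := fun g => σ g ≤ τ) (hσ.le_apply.trans h) h) (by omega)
  have hone : ∀ g, (weight θ (σ g))⁻¹ * (weight θ τ * weight θ (σ g - τ)) ≤ 1 := by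
    intro g
    rw [inv_mul_le_iff₀ (hw _), mul_one]
    exact (weight_mul_le hθ _ _).trans (hanti (by omega))
  have hsmall : ∀ g, g ≠ G → g ≠ G + 1 →
      (weight θ (σ g))⁻¹ * (weight θ τ * weight θ (σ g - τ)) ≤ 2 / n := by
    intro g hg hg'
    rw [inv_mul_le_iff₀ (hw _)]
    rcases lt_or_gt_of_ne hg with hlt | hlt
    · have h1 : weight θ τ ≤ weight θ (σ (g + 1)) := hanti ((hσ.monotone hlt).trans hG1)
      have h2 := (hσs g).1
      calc weight θ τ * weight θ (σ g - τ) ≤ weight θ τ := mul_le_of_le_one_right (hw _).le (hw1 _)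
        _ ≤ weight θ (σ g) * (1 / n) := h1.trans h2
        _ ≤ weight θ (σ g) * (2 / n) := by
          refine mul_le_mul_of_nonneg_left ?_ (hw _).le
          exact div_le_div_of_nonneg_right (by norm_num) hn'.le
    · obtain ⟨g, rfl⟩ : ∃ g', g = g' + 1 := ⟨g - 1, by omega⟩
      have h1 : τ ≤ σ g := hG2.le.trans (hσ.monotone (by omega))
      calc weight θ τ * weight θ (σ (g + 1) - τ)
          ≤ (1 / n) * (2 * weight θ (σ (g + 1))) := by
            refine mul_le_mul ((hanti hτ).trans hσ0) ?_ (hw _).le (by positivity)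
            exact (hanti (by omega)).trans (hσs g).2
        _ = weight θ (σ (g + 1)) * (2 / n) := by ring
  calc ∑ g ∈ Finset.range n, (weight θ (σ g))⁻¹ * (weight θ τ * weight θ (σ g - τ))
      ≤ ∑ g ∈ Finset.range n, (((2 : ℝ) / n + if g = G then 1 else 0) + if g = G + 1 then 1 else 0) := by
        refine Finset.sum_le_sum fun g _ => ?_
        have h2 : (0 : ℝ) < 2 / n := by positivity
        by_cases h1 : g = G
        · have := hone g
          rw [if_pos h1, if_neg (by omega)]; linarith
        · by_cases h3 : g = G + 1
          · have := hone g
            rw [if_neg h1, if_pos h3]; linarith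
          · have := hsmall g h1 h3
            rw [if_neg h1, if_neg h3]; linarith
    _ ≤ 2 + 1 + 1 := by
        rw [Finset.sum_add_distrib, Finset.sum_add_distrib, Finset.sum_ite_eq', Finset.sum_ite_eq']
        refine add_le_add (add_le_add ?_ ?_) ?_
        · simp [mul_div_cancel₀ _ hn'.ne']
        · split_ifs <;> norm_num
        · split_ifs <;> norm_num
    _ = 4 := by norm_num

/-! ### Assembly of the disjoint vectors with bounded sum -/

theorem linearCombination_real_apply (φ : ℕ → ℝ) (b : ℕ →₀ ℝ) :
    Finsupp.linearCombination ℝ φ b = ∑ i ∈ b.support, b i * φ i := by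
  simp [Finsupp.linearCombination_apply, Finsupp.sum]

theorem pairing_linearCombination_le (f : ℕ+ →₀ ℝ) (y : ℕ → ℕ+ →₀ ℝ) {b : ℕ →₀ ℝ}
    (hb : ∀ i, 0 ≤ b i) {ψ : ℕ → ℝ} (hψ : ∀ i ∈ b.support, |pairing f (y i)| ≤ ψ i) :
    pairing f (Finsupp.linearCombination ℝ y b) ≤ Finsupp.linearCombination ℝ ψ b := by
  rw [Finsupp.linearCombination_apply, Finsupp.sum, pairing_sum, linearCombination_real_apply]
  refine Finset.sum_le_sum fun i hi => ?_
  rw [pairing_smul]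
  exact mul_le_mul_of_nonneg_left ((le_abs_self _).trans (hψ i hi)) (hb i)

/-- A function that is constant on cells has the same mean for all the interlaced averages. This
allows the `n` vectors to be compared cell by cell. -/
theorem linearCombination_comp_cell {κ : ℕ → ℕ} {β : ℕ → ℕ →₀ ℝ}
    (hβ1 : ∀ p, (β p).sum (fun _ x => x) = 1) (hβκ : ∀ p, ∀ i ∈ (β p).support, κ i = p)
    (φ : ℕ → ℝ) (c : ℕ →₀ ℝ) :
    Finsupp.linearCombination ℝ (fun i => φ (κ i)) (Finsupp.linearCombination ℝ β c) =
      Finsupp.linearCombination ℝ φ c := by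
  rw [Finsupp.apply_linearCombination]
  congr 2
  ext p
  rw [Function.comp_apply, linearCombination_real_apply]
  rw [Finset.sum_congr rfl fun i hi => by rw [hβκ p i hi], ← Finset.sum_mul]
  have := hβ1 p
  rw [Finsupp.sum] at this
  rw [this, one_mul]

theorem IsBlock.weight_le_tnorm {θ : ℕ+ → ℝ} (hθ : RegularSequence θ) {y : ℕ → ℕ+ →₀ ℝ}
    {ℓ t : ℕ → ℕ+} (hB : IsBlock y ℓ t) (hy : ∀ i, tnorm hθ (y i) = 1) {k : ℕ} (hk : 0 < k)
    {b : ℕ →₀ ℝ} (hb : ∀ i, 0 ≤ b i) (hb1 : b.sum (fun _ x => x) = 1)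
    (hbℓ : b.support.image ℓ ∈ schreier k) :
    weight θ k ≤ tnorm hθ (Finsupp.linearCombination ℝ y b) := by
  classical
  let E : ℕ+ → Finset ℕ+ := Function.extend ℓ (fun i => (y i).support) fun _ => ∅
  have hE : ∀ i, E (ℓ i) = (y i).support := fun i =>
    hB.lower_strictMono.injective.extend_apply _ _ i
  have key := weight_mul_sum_tnorm_le_of_mem hθ hk hbℓ (E := E) ?_ ?_
    (Finsupp.linearCombination ℝ y b)
  · rw [Finset.sum_image fun _ _ _ _ h => hB.lower_strictMono.injective h] at key
    simp_rw [hE, hB.filter_mem_support b, tnorm_smul, hy, mul_one, abs_of_nonneg (hb _)] at key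
    rw [Finsupp.sum] at hb1
    rwa [hb1, mul_one] at key
  · intro a ha x hx
    obtain ⟨i, hi, rfl⟩ := Finset.mem_image.1 ha
    rw [hE] at hx
    exact hB.lower i x hx
  · intro a ha b hb hab x hx z hz
    obtain ⟨i, hi, rfl⟩ := Finset.mem_image.1 ha
    obtain ⟨i', hi', rfl⟩ := Finset.mem_image.1 hb
    rw [hE] at hx hz
    exact hB.lt_of_lt (hB.lower_strictMono.lt_iff_lt.1 hab) hx hz

/-- The space `c₀` is disjointly finitely representable in every subspace of the mixed Tsirelson
space that contains vectors with supports arbitrarily far out. -/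
theorem exists_disjoint_bounded {θ : ℕ+ → ℝ} (hθ : RegularSequence θ)
    (hlim : Tendsto (fun n : ℕ+ => θ n ^ (1 / ((n : ℕ) : ℝ))) atTop (𝓝 1))
    {W : Submodule ℝ (ℕ+ →₀ ℝ)}
    (hW : ∀ p : ℕ+, ∃ w ∈ W, w ≠ 0 ∧ ∀ a ∈ w.support, p ≤ a) {n : ℕ} (hn : 0 < n) (p : ℕ+) :
    ∃ u : Fin n → ℕ+ →₀ ℝ, (∀ s, u s ∈ W) ∧ (∀ s, ∀ a ∈ (u s).support, p ≤ a) ∧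
      (Pairwise fun s s' => Disjoint (u s).support (u s').support) ∧
      (∀ s, 1 ≤ tnorm hθ (u s)) ∧ tnorm hθ (∑ s, u s) ≤ 18 := by
  classical
  have hn' : (0 : ℝ) < n := by exact_mod_cast hn
  have hw := weight_pos hθ
  obtain ⟨σ, hσ, hσ0, hσ1, hσs⟩ := exists_orders hθ hlim (δ := 1 / n) (by positivity)
  set D : ℝ := ∑ g ∈ Finset.range n, (weight θ (σ g))⁻¹ with hD
  have hD0 : 0 ≤ D := Finset.sum_nonneg fun g _ => (inv_pos.2 (hw _)).le
  set D' : ℝ := ∑ g ∈ Finset.range n, (weight θ (σ g))⁻¹ * (3 * σ g) with hD'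
  have hD'0 : 0 ≤ D' := Finset.sum_nonneg fun g _ =>
    mul_nonneg (inv_pos.2 (hw _)).le (by positivity)
  -- The choices of `ε` and `η` keep the accumulated errors `D * ε` and `D' * η` below 1 after
  -- division by the weights.
  set ε : ℝ := 1 / (D + 1) with hε
  have hε0 : 0 < ε := by positivity
  set η : ℝ := 1 / (D' + 1) with hη
  have hη0 : 0 < η := by positivity
  obtain ⟨y, ℓ, t, j, hy, hyW, hy1, hyp⟩ := exists_isRapid hθ hlim hW hε0 p
  have hB := hy.toIsBlock
  obtain ⟨κ, T, c, β, hκ, hT, htT, hc0, hc1, hβ0, hβ1, hβκ, hβd, hcs, hβs⟩ :=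
    hB.exists_cell_averages hn (σ 0) (fun s : Fin n => σ s - σ 0) hη0
  have hσadd : ∀ s : Fin n, σ 0 + (σ s - σ 0) = σ s := fun s =>
    Nat.add_sub_cancel' (hσ.monotone (Nat.zero_le _))
  simp only [hσadd] at hβs
  set b : Fin n → ℕ →₀ ℝ := fun s => Finsupp.linearCombination ℝ (β s) c with hb
  have hb0 : ∀ s i, 0 ≤ b s i := fun s i => by
    rw [hb]; dsimp only
    rw [Finsupp.linearCombination_apply, Finsupp.sum, Finsupp.finsetSum_apply]
    exact Finset.sum_nonneg fun p _ => mul_nonneg (hc0 p) (hβ0 s p i)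
  have hsum1 : ∀ d : ℕ →₀ ℝ, d.sum (fun _ x => x) =
      Finsupp.linearCombination ℝ (fun _ => (1 : ℝ)) d := fun d => by
    simp [Finsupp.linearCombination_apply]
  have hb1 : ∀ s, (b s).sum (fun _ x => x) = 1 := fun s => by
    have := linearCombination_comp_cell (hβ1 s) (hβκ s) (fun _ => 1) c
    rw [← hsum1, ← hsum1, hc1] at this
    exact this
  set x : Fin n → ℕ+ →₀ ℝ := fun s => Finsupp.linearCombination ℝ y (b s) with hx
  have hxmem : ∀ s : Fin n, ∀ a ∈ ((weight θ (σ s))⁻¹ • x s).support,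
      ∃ i ∈ (b s).support, a ∈ (y i).support := fun s a ha =>
    IsBlock.exists_mem_of_ne_zero (Finsupp.support_smul ha)
  refine ⟨fun s => (weight θ (σ s))⁻¹ • x s, fun s => W.smul_mem _ ?_, fun s a ha => ?_,
    fun s s' hss => Finset.disjoint_left.2 fun a ha ha' => ?_, fun s => ?_,
    tnorm_le hθ fun f hf => ?_⟩
  · rw [hx]; dsimp only
    rw [Finsupp.linearCombination_apply]
    exact W.sum_mem fun i _ => W.smul_mem _ (hyW i)
  · obtain ⟨i, -, hi⟩ := hxmem s a ha
    exact (hyp i).trans (hB.lower i a hi)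
  · obtain ⟨i, hi, hai⟩ := hxmem s a ha
    obtain ⟨i', hi', hai'⟩ := hxmem s' a ha'
    obtain rfl := hB.eq_of_mem hai hai'
    obtain ⟨q, -, hq⟩ := mem_support_linearCombination hi
    obtain ⟨q', -, hq'⟩ := mem_support_linearCombination hi'
    exact hss (hβd s s' q q' i hq hq')
  · rw [tnorm_smul, abs_of_pos (inv_pos.2 (hw _)), ← div_eq_inv_mul, le_div_iff₀ (hw _), one_mul]
    exact hB.weight_le_tnorm hθ hy1 (hσ0.trans_le (hσ.monotone (Nat.zero_le _))) (hb0 s) (hb1 s)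
      (hβs s).2
  -- With `q = σ 0` the bad cells have order `σ 0 - 1`, hence small mass under `c`; the cut-off `σ
  -- n` exceeds all orders `σ s` in use.
  obtain ⟨h, B, hBc, hBb, hhr⟩ := hf.cellAnalysis hy (by norm_num : (1 : ℝ) ≤ 4) hε0.le (σ n)
    hκ hT htT (σ 0) hσ0
  choose! τ hτ hτb using hBb
  set φ : ℕ → ℕ → ℝ := fun g q => if q ∈ B then 0 else
    4 * (weight θ (τ q) * weight θ (σ g - τ q)) + ε with hφ
  have hφ0 : ∀ g q, 0 ≤ φ g q := fun g q => by
    simp only [hφ]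
    split_ifs
    · exact le_rfl
    · have := mul_pos (hw (τ q)) (hw (σ g - τ q)); linarith
  have hone : ∀ s : Fin n, pairing f (x s) ≤
      3 * σ s * η + Finsupp.linearCombination ℝ (φ s) c := by
    intro s
    set ψ₁ : ℕ → ℝ := fun q => if q ∈ B then 1 else 0 with hψ₁
    set ψ₂ : ℕ → ℝ := fun i => if κ i ∉ B ∧ h i < σ s then 1 else 0 with hψ₂
    have hσs0 : 0 < σ s := hσ0.trans_le (hσ.monotone (Nat.zero_le _))
    -- Indices in bad cells and indices of order below `σ s` are bounded trivially by 1. For the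
    -- rest `h i ≥ σ s`, so `h i` may be replaced by `σ s` and the bound depends on the cell only.
    have hbd : ∀ i ∈ (b s).support, |pairing f (y i)| ≤ ψ₁ (κ i) + ψ₂ i + φ s (κ i) := by
      intro i _
      have h1 := (abs_pairing_le_tnorm hθ hf (y i)).trans (hy.norm_le i)
      have h0 := hφ0 s (κ i)
      by_cases hκB : κ i ∈ B
      · simp only [hψ₁, hψ₂, if_pos hκB, if_neg (show ¬ (κ i ∉ B ∧ h i < σ s) from
          fun h => h.1 hκB)]
        linarith
      · by_cases hi : h i < σ s
        · simp only [hψ₁, hψ₂, if_neg hκB, if_pos (show κ i ∉ B ∧ h i < σ s from ⟨hκB, hi⟩)]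
          linarith
        · simp only [hψ₁, hψ₂, hφ, if_neg hκB, if_neg (show ¬ (κ i ∉ B ∧ h i < σ s) from
            fun h => hi h.2)]
          have h2 := (hτb (κ i) hκB i rfl).2
          have h3 : weight θ (h i - τ (κ i)) ≤ weight θ (σ s - τ (κ i)) :=
            weight_antitone hθ (by omega)
          have h4 := mul_le_mul_of_nonneg_left h3 (hw (τ (κ i))).le
          linarith
    refine (pairing_linearCombination_le f y (hb0 s) hbd).trans ?_
    have hsplit : Finsupp.linearCombination ℝ (fun i => ψ₁ (κ i) + ψ₂ i + φ s (κ i)) (b s) =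
        Finsupp.linearCombination ℝ ψ₁ c + Finsupp.linearCombination ℝ ψ₂ (b s) +
          Finsupp.linearCombination ℝ (φ s) c := by
      rw [← linearCombination_comp_cell (hβ1 s) (hβκ s) ψ₁,
        ← linearCombination_comp_cell (hβ1 s) (hβκ s) (φ s)]
      simp only [linearCombination_real_apply, mul_add, Finset.sum_add_distrib, hb]
    have h1 : Finsupp.linearCombination ℝ ψ₁ c ≤ σ 0 * η := by
      rw [linearCombination_real_apply]
      simp only [hψ₁, mul_ite, mul_one, mul_zero, ← Finset.sum_filter]
      rw [← sum_image_mapDomain hT.injective]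
      refine hcs.covered (mapDomain_nonneg hc0 T) (Nat.sub_lt hσ0 one_pos) (hBc _ fun q hq => ?_)
      exact (Finset.mem_filter.1 (Finset.mem_coe.1 hq)).2
    -- Orders below `σ s` occur on `2 * (σ s - 1) + 1` sets of order `σ s - 1`, and `b s` is small
    -- on each of them.
    have h2 : Finsupp.linearCombination ℝ ψ₂ (b s) ≤ (2 * (σ s - 1) + 1 : ℕ) * η := by
      rw [linearCombination_real_apply]
      simp only [hψ₂, mul_ite, mul_one, mul_zero, ← Finset.sum_filter]
      rw [← sum_image_mapDomain hB.upper_strictMono.injective]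
      refine (hβs s).1.covered (mapDomain_nonneg (hb0 s) t) (Nat.sub_lt hσs0 one_pos)
        (hhr _ ?_ _ fun i hi => ?_)
      · have := hσ.monotone s.2.le; omega
      · obtain ⟨-, hi1, hi2⟩ := Finset.mem_filter.1 hi
        exact ⟨hi1, by omega⟩
    have h3 : (σ 0 : ℝ) * η ≤ σ s * η :=
      mul_le_mul_of_nonneg_right (by exact_mod_cast hσ.monotone (Nat.zero_le _)) hη0.le
    have h4 : ((2 * (σ s - 1) + 1 : ℕ) : ℝ) * η ≤ (2 * σ s : ℕ) * η :=
      mul_le_mul_of_nonneg_right (by exact_mod_cast (by omega)) hη0.le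
    rw [hsplit]
    push_cast at h4
    push_cast at h2
    linarith
  have hcell : ∀ q, ∑ s : Fin n, (weight θ (σ s))⁻¹ * φ s q ≤ 17 := by
    intro q
    rw [← Finset.sum_range (fun g => (weight θ (σ g))⁻¹ * φ g q)]
    by_cases hq : q ∈ B
    · simp only [hφ, if_pos hq, mul_zero, Finset.sum_const_zero]; norm_num
    · simp only [hφ, if_neg hq]
      have h1 := sum_weight_div_le hθ hn hσ hσ1 hσs (hτ q hq)
      have h2 : D * ε ≤ 1 := by
        rw [hε, mul_one_div, div_le_one (by positivity)]; linarith
      calc ∑ g ∈ Finset.range n, (weight θ (σ g))⁻¹ *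
            (4 * (weight θ (τ q) * weight θ (σ g - τ q)) + ε)
          = 4 * ∑ g ∈ Finset.range n, (weight θ (σ g))⁻¹ *
              (weight θ (τ q) * weight θ (σ g - τ q)) + D * ε := by
            rw [Finset.mul_sum, hD, Finset.sum_mul, ← Finset.sum_add_distrib]
            exact Finset.sum_congr rfl fun g _ => by ring
        _ ≤ 4 * 4 + 1 := by linarith
        _ = 17 := by norm_num
  calc pairing f (∑ s : Fin n, (weight θ (σ s))⁻¹ • x s)
      = ∑ s : Fin n, (weight θ (σ s))⁻¹ * pairing f (x s) := by
        rw [pairing_sum]; simp only [pairing_smul]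
    _ ≤ ∑ s : Fin n, (weight θ (σ s))⁻¹ *
          (3 * σ s * η + Finsupp.linearCombination ℝ (φ s) c) :=
        Finset.sum_le_sum fun s _ => mul_le_mul_of_nonneg_left (hone s) (inv_pos.2 (hw _)).le
    _ = D' * η + ∑ q ∈ c.support, c q * ∑ s : Fin n, (weight θ (σ s))⁻¹ * φ s q := by
        rw [hD', Finset.sum_range, Finset.sum_mul]
        simp only [mul_add, Finset.sum_add_distrib, linearCombination_real_apply]
        congr 1
        · exact Finset.sum_congr rfl fun s _ => by ring
        · simp only [Finset.mul_sum]
          rw [Finset.sum_comm]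
          exact Finset.sum_congr rfl fun q _ => Finset.sum_congr rfl fun s _ => by ring
    _ ≤ 1 + ∑ q ∈ c.support, c q * 17 := by
        refine add_le_add ?_ (Finset.sum_le_sum fun q _ =>
          mul_le_mul_of_nonneg_left (hcell q) (hc0 q))
        rw [hη, mul_one_div, div_le_one (by positivity)]; linarith
    _ = 18 := by
        rw [← Finset.sum_mul]
        rw [Finsupp.sum] at hc1
        rw [hc1]; norm_num

/-! ### Lower `ℓ₁`-estimates in the modified spaces -/

section modified

variable {R : ℕ+ → ∀ n : ℕ, (Fin n → Finset ℕ+) → Prop} {θ : ℕ+ → ℝ}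

/-- Families may be replaced by non-empty subsets of the members of a subfamily. -/
def ShrinkClosed (R : ℕ+ → ∀ n : ℕ, (Fin n → Finset ℕ+) → Prop) : Prop :=
  ∀ (k : ℕ+) (n : ℕ) (E : Fin n → Finset ℕ+), R k n E → ∀ (m : ℕ) (e : Fin m → Fin n),
    StrictMono e → ∀ G : Fin m → Finset ℕ+, (∀ j, G j ⊆ E (e j)) → (∀ j, (G j).Nonempty) → R k m G

/-- Needed to choose norming functionals supported inside given disjoint sets. -/
theorem Norming.filter_of_shrinkClosed (hR : ShrinkClosed R) {f : ℕ+ →₀ ℝ}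
    (hf : Norming R θ f) (F : Finset ℕ+) :
    f.filter (· ∈ F) = 0 ∨ Norming R θ (f.filter (· ∈ F)) := by
  classical
  induction hf with
  | basis n =>
    by_cases h : n ∈ F
    · right; rw [Finsupp.filter_single_of_pos _ h]; exact .basis n
    · left; exact Finsupp.filter_single_of_neg _ h
  | neg_basis n =>
    by_cases h : n ∈ F
    · right; rw [Finsupp.filter_single_of_pos _ h]; exact .neg_basis n
    · left; exact Finsupp.filter_single_of_neg _ h
  | sum k n f hn _ hE ih =>
    have hfil : (θ k • ∑ i, f i).filter (· ∈ F) = θ k • ∑ i, (f i).filter (· ∈ F) := by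
      ext a
      by_cases ha : a ∈ F <;> simp [ha]
    rw [hfil]
    by_cases h0 : ∃ i, (f i).filter (· ∈ F) ≠ 0
    · obtain ⟨m, e, hm, he, h1, h2⟩ := exists_reindex (fun i => (f i).filter (· ∈ F) ≠ 0) h0
      have hsum : ∑ i, (f i).filter (· ∈ F) = ∑ j, (f (e j)).filter (· ∈ F) := by
        rw [← Finset.sum_image (f := fun i => (f i).filter (· ∈ F)) (s := Finset.univ) (g := e)
          fun _ _ _ _ h => he.injective h]
        symm
        refine Finset.sum_subset (Finset.subset_univ _) fun i _ hi => ?_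
        by_contra hne
        obtain ⟨j, rfl⟩ := h2 i hne
        exact hi (Finset.mem_image_of_mem _ (Finset.mem_univ _))
      rw [hsum]
      refine Or.inr (.sum k m _ hm (fun j => (ih _).resolve_left (h1 j))
        (hR k n _ hE m e he _ (fun j => ?_) fun j => Finsupp.support_nonempty_iff.2 (h1 j)))
      rw [Finsupp.support_filter]; exact Finset.filter_subset _ _
    · push Not at h0
      left
      rw [Finset.sum_eq_zero fun i _ => h0 i, smul_zero]

theorem card_filter_lt_orderEmbOfFin_le (A : Finset ℕ+) (i : Fin A.card) :
    (A.filter (· < A.orderEmbOfFin rfl i)).card ≤ i := by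
  classical
  have hsub : A.filter (· < A.orderEmbOfFin rfl i) ⊆
      (Finset.Iio i).image (A.orderEmbOfFin rfl) := by
    intro a ha
    obtain ⟨ha, hlt⟩ := Finset.mem_filter.1 ha
    have : a ∈ Set.range (A.orderEmbOfFin rfl) := by rw [Finset.range_orderEmbOfFin]; exact ha
    obtain ⟨i', rfl⟩ := this
    exact Finset.mem_image_of_mem _ (Finset.mem_Iio.2 ((A.orderEmbOfFin rfl).lt_iff_lt.1 hlt))
  calc _ ≤ _ := Finset.card_le_card hsub
    _ ≤ (Finset.Iio i).card := Finset.card_image_le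
    _ = i := Fin.card_Iio i

/-- Schreier families are closed under moving the elements of a set to the right, also when the
order is not preserved. -/
theorem image_mem_schreier_of_le {k m : ℕ} {p q : Fin m → ℕ+} (hp : Function.Injective p)
    (hq : Function.Injective q) (hpq : ∀ j, p j ≤ q j) (h : Finset.univ.image p ∈ schreier k) :
    Finset.univ.image q ∈ schreier k := by
  classical
  set A := Finset.univ.image p with hA
  set B := Finset.univ.image q with hB
  have hAc : A.card = m := by rw [hA, Finset.card_image_of_injective _ hp]; simp
  have hBc : B.card = m := by rw [hB, Finset.card_image_of_injective _ hq]; simp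
  set P := A.orderEmbOfFin rfl with hP
  set Q := B.orderEmbOfFin (hBc.trans hAc.symm) with hQ
  -- The `i`-th smallest elements compare. Otherwise the indices of the `i + 1` smallest values of
  -- `q` would give `i + 1` elements of `A` below its `i`-th element, counted from 0.
  have hPQ : ∀ i, P i ≤ Q i := by
    intro i
    by_contra hlt
    rw [not_le] at hlt
    have hex : ∀ i', ∃ j, q j = Q i' := fun i' => by
      have := B.orderEmbOfFin_mem (hBc.trans hAc.symm) i'
      obtain ⟨j, -, hj⟩ := Finset.mem_image.1 this
      exact ⟨j, hj⟩
    choose J hJ using hex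
    have hJi : Function.Injective J := fun a b hab => Q.injective (by rw [← hJ, ← hJ, hab])
    have hsub : (Finset.Iic i).image (p ∘ J) ⊆ A.filter (· < P i) := by
      intro a ha
      obtain ⟨i', hi', rfl⟩ := Finset.mem_image.1 ha
      refine Finset.mem_filter.2 ⟨Finset.mem_image_of_mem _ (Finset.mem_univ _), ?_⟩
      refine lt_of_le_of_lt ((hpq _).trans ?_) hlt
      rw [hJ]
      exact Q.monotone (Finset.mem_Iic.1 hi')
    have := (Finset.card_le_card hsub).trans (card_filter_lt_orderEmbOfFin_le A i)
    rw [Finset.card_image_of_injective _ (hp.comp hJi), Fin.card_Iic] at this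
    omega
  let φ : ℕ+ → ℕ+ := Function.extend P Q id
  have hφ : ∀ i, φ (P i) = Q i := fun i => P.injective.extend_apply Q id i
  have hrange : ∀ a ∈ A, ∃ i, P i = a := fun a ha => by
    have : a ∈ Set.range P := by rw [hP, Finset.range_orderEmbOfFin]; exact ha
    exact this
  have key := schreier_spreading k A h φ ?_ ?_
  · convert key using 1
    ext b
    constructor
    · intro hb
      have : b ∈ Set.range Q := by rw [hQ, Finset.range_orderEmbOfFin]; exact hb
      obtain ⟨i, rfl⟩ := this
      exact Finset.mem_image.2 ⟨P i, A.orderEmbOfFin_mem rfl i, hφ i⟩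
    · intro hb
      obtain ⟨a, ha, rfl⟩ := Finset.mem_image.1 hb
      obtain ⟨i, rfl⟩ := hrange a ha
      rw [hφ]; exact B.orderEmbOfFin_mem _ i
  · intro a ha b hb hab
    obtain ⟨i, rfl⟩ := hrange a ha
    obtain ⟨i', rfl⟩ := hrange b hb
    rw [hφ, hφ]
    exact Q.strictMono (P.lt_iff_lt.1 hab)
  · intro a ha
    obtain ⟨i, rfl⟩ := hrange a ha
    rw [hφ]; exact hPQ i

theorem Allowable.min'_injective {M : Set (Finset ℕ+)} {n : ℕ} {E : Fin n → Finset ℕ+}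
    (hE : Allowable M E) : Function.Injective fun i => (E i).min' (hE.1 i) := by
  intro i j hij
  by_contra hne
  refine Finset.disjoint_left.1 (hE.2.1 hne) (Finset.min'_mem _ (hE.1 i)) ?_
  have := Finset.min'_mem _ (hE.1 j)
  simp only at hij
  rwa [← hij] at this

/-- Shrinking disjoint sets moves their minima to the right but may permute them, so ordinary
spreading is not enough here. -/
theorem Allowable.sub {k n m : ℕ} {E : Fin n → Finset ℕ+} (hE : Allowable (schreier k) E)
    {e : Fin m → Fin n} (he : StrictMono e) {G : Fin m → Finset ℕ+} (hG : ∀ j, G j ⊆ E (e j))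
    (hne : ∀ j, (G j).Nonempty) : Allowable (schreier k) G := by
  have hdisj : Pairwise fun i j => Disjoint (G i) (G j) := fun i j hij =>
    (hE.2.1 (he.injective.ne hij)).mono (hG i) (hG j)
  refine ⟨hne, hdisj, image_mem_schreier_of_le (hE.min'_injective.comp he.injective)
    (fun i j hij => ?_) (fun j => Finset.min'_le _ _ (hG j (Finset.min'_mem _ _)))
    (schreier_hereditary k _ hE.2.2 _ fun a ha => ?_)⟩
  · by_contra hne'
    refine Finset.disjoint_left.1 (hdisj hne') (Finset.min'_mem _ (hne i)) ?_
    have := Finset.min'_mem _ (hne j)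
    rwa [← hij] at this
  · obtain ⟨j, -, rfl⟩ := Finset.mem_image.1 ha
    exact Finset.mem_image.2 ⟨e j, Finset.mem_univ _, rfl⟩

theorem shrinkClosed_allowable : ShrinkClosed fun k _ E => Allowable (schreier k) E :=
  fun _ _ _ hE _ _ he _ hG hne => hE.sub he hG hne

theorem shrinkClosed_boundedly (m : ℕ+) : ShrinkClosed fun k _ E =>
    (k ≤ m ∧ Allowable (schreier k) E) ∨ (m < k ∧ Admissible (schreier k) E) :=
  fun k _ _ hE _ _ he _ hG hne => hE.imp (fun h => ⟨h.1, h.2.sub he hG hne⟩) fun h =>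
    ⟨h.1, h.2.sub (schreier_hereditary k) (schreier_spreading k) he hG hne⟩

theorem mem_schreier_one {A : Finset ℕ+} (h : ∀ a ∈ A, A.card ≤ (a : ℕ)) : A ∈ schreier 1 := by
  have key := biUnion_mem_schreier_succ (k := 0) (n := A.card)
    (B := fun i => {A.orderEmbOfFin rfl i}) (fun i => singleton_mem_schreier_zero _)
    (fun i a ha => by
      rw [Finset.mem_singleton.1 ha]; exact h _ (A.orderEmbOfFin_mem rfl i))
    (fun i j hij a ha b hb => by
      rw [Finset.mem_singleton.1 ha, Finset.mem_singleton.1 hb]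
      exact (A.orderEmbOfFin rfl).strictMono hij)
  convert key using 1
  ext a
  have : a ∈ A ↔ a ∈ Set.range (A.orderEmbOfFin rfl) := by
    rw [Finset.range_orderEmbOfFin]; rfl
  simp only [this, Set.mem_range, Finset.mem_biUnion, Finset.mem_univ, true_and,
    Finset.mem_singleton, eq_comm]

/-- `n` disjointly supported vectors with supports beyond `n` satisfy a lower `ℓ₁`-estimate with
constant `ρ`. -/
def DisjointLower (K : NormingSet) (ρ : ℝ) : Prop :=
  ∀ n, 0 < n → ∀ u : Fin n → ℕ+ →₀ ℝ, (∀ s, u s ≠ 0) →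
    (Pairwise fun s s' => Disjoint (u s).support (u s').support) →
    (∀ s, ∀ a ∈ (u s).support, n ≤ (a : ℕ)) → ρ * ∑ s, K.norm (u s) ≤ K.norm (∑ s, u s)

theorem NormingSet.norm_pos (K : NormingSet) {x : ℕ+ →₀ ℝ} (hx : x ≠ 0) : 0 < K.norm x := by
  obtain ⟨n, hn⟩ := Finsupp.ne_iff.1 hx
  exact (abs_pos.2 hn).trans_le (K.abs_apply_le x n)

/-- The minima of `n` disjoint sets beyond `n` form a set of order 1. Almost norming functionals
supported in these sets can therefore be added with weight `θ 1`, and they do not interact. -/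
theorem disjointLower_normingSet (hθ : ∀ k, θ k ∈ Set.Ioo (0 : ℝ) 1)
    (hdis : ∀ k n E, R k n E → Pairwise fun i j => Disjoint (E i) (E j)) (hR : ShrinkClosed R)
    (hR1 : ∀ n E, Allowable (schreier 1) E → R 1 n E) :
    DisjointLower (normingSet R θ hθ hdis) (θ 1) := by
  classical
  intro n hn u hu hd hge
  set K := normingSet R θ hθ hdis with hK
  have hn' : (0 : ℝ) < n := by exact_mod_cast hn
  refine le_of_forall_pos_le_add fun δ hδ => ?_
  have hex : ∀ s, ∃ g, Norming R θ g ∧ g.support ⊆ (u s).support ∧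
      K.norm (u s) - δ / n ≤ pairing g (u s) := by
    intro s
    have hpos := K.norm_pos (hu s)
    have : Nonempty K.carrier := ⟨⟨_, K.basis_mem 1⟩⟩
    -- The maximum with 0 makes the pairing positive, so the restriction of `f` is nonzero and thus
    -- stays in the norming set.
    obtain ⟨f, hf⟩ := exists_lt_of_lt_ciSup
      (show max (K.norm (u s) - δ / n) 0 < ⨆ f : K.carrier, pairing f (u s) from
        max_lt (sub_lt_self _ (div_pos hδ hn')) hpos)
    have hpair : pairing ((f : ℕ+ →₀ ℝ).filter (· ∈ (u s).support)) (u s) = pairing f (u s) := by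
      rw [pairing_filter, filter_mem_support_self]
    have hfN : Norming R θ (f : ℕ+ →₀ ℝ) := f.2
    refine ⟨(f : ℕ+ →₀ ℝ).filter (· ∈ (u s).support),
      (hfN.filter_of_shrinkClosed hR _).resolve_left fun h0 => ?_, ?_, ?_⟩
    · rw [h0] at hpair
      have := (le_max_right (K.norm (u s) - δ / n) 0).trans_lt hf
      rw [← hpair] at this
      simp [pairing] at this
    · rw [Finsupp.support_filter]
      exact fun a ha => (Finset.mem_filter.1 ha).2
    · rw [hpair]
      exact (le_max_left _ _).trans hf.le
  choose g hg hgs hgu using hex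
  have hg0 : ∀ s, (g s).support.Nonempty := fun s => by
    by_contra h
    rw [Finset.not_nonempty_iff_eq_empty, Finsupp.support_eq_empty] at h
    -- Zero is not in the norming set, because sums of disjointly supported nonzero functionals
    -- cannot cancel.
    have hz : ∀ {f : ℕ+ →₀ ℝ}, Norming R θ f → f ≠ 0 := by
      intro f hf
      induction hf with
      | basis n => simp
      | neg_basis n => simp
      | sum k n f hn hf hE ih =>
        intro h0
        have hsum : ∑ i, f i = 0 := (smul_eq_zero.1 h0).resolve_left (hθ k).1.ne'
        obtain ⟨a, ha⟩ := Finsupp.ne_iff.1 (ih ⟨0, hn⟩)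
        have h1 := DFunLike.congr_fun hsum a
        rw [Finsupp.finsetSum_apply, Finset.sum_eq_single ⟨0, hn⟩] at h1
        · exact ha h1
        · intro i _ hi
          exact Finsupp.notMem_support_iff.1 (Finset.disjoint_left.1 (hdis _ _ _ hE hi.symm)
            (Finsupp.mem_support_iff.2 ha))
        · simp
    exact hz (hg s) h
  have hall : Allowable (schreier 1) fun s => (g s).support := by
    refine ⟨hg0, fun s s' hss => (hd hss).mono (hgs s) (hgs s'), mem_schreier_one fun a ha => ?_⟩
    obtain ⟨s, -, rfl⟩ := Finset.mem_image.1 ha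
    refine le_trans ?_ (hge s _ (hgs s (Finset.min'_mem _ _)))
    exact Finset.card_image_le.trans (by simp)
  have hF : θ 1 • ∑ s, g s ∈ K.carrier := Norming.sum 1 n g hn hg (hR1 n _ hall)
  have h1 := K.pairing_le hF (∑ s, u s)
  have h2 : ∀ s, pairing (g s) (∑ s', u s') = pairing (g s) (u s) := by
    intro s
    rw [pairing_sum, Finset.sum_eq_single s]
    · intro s' _ hs'
      exact pairing_eq_zero ((hd hs'.symm).mono_left (hgs s))
    · simp
  rw [pairing_smul_sum] at h1
  simp only [h2] at h1
  have h3 : ∑ s, K.norm (u s) - δ ≤ ∑ s, pairing (g s) (u s) := by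
    calc ∑ s, K.norm (u s) - δ = ∑ s : Fin n, (K.norm (u s) - δ / n) := by
          rw [Finset.sum_sub_distrib]; simp [mul_div_cancel₀ _ hn'.ne']
      _ ≤ _ := Finset.sum_le_sum fun s _ => hgu s
  have h4 := mul_le_mul_of_nonneg_left h3 (hθ 1).1.le
  have h5 := mul_le_of_le_one_left hδ.le (hθ 1).2.le
  linarith

end modified

/-! ### Coordinates and approximation in the completions -/

section completion

open UniformSpace

variable (K : NormingSet)

/-- The coordinate functionals on the finitely supported sequences. -/
noncomputable def C00.coord (n : ℕ+) : C00 K →L[ℝ] ℝ :=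
  LinearMap.mkContinuous (E := C00 K)
    { toFun := fun x : ℕ+ →₀ ℝ => x n
      map_add' := fun _ _ => rfl
      map_smul' := fun _ _ => rfl } 1 fun x => by
    rw [one_mul]; exact K.abs_apply_le x n

/-- The coordinate functionals on the completion. -/
noncomputable def coord (n : ℕ+) : Completion (C00 K) →L[ℝ] ℝ :=
  (C00.coord K n).extend (Completion.toComplL (𝕜 := ℝ))

theorem coord_coe (n : ℕ+) (x : C00 K) : coord K n (x : Completion (C00 K)) =
    (show ℕ+ →₀ ℝ from x) n :=
  ContinuousLinearMap.extend_eq (C00.coord K n) (e := Completion.toComplL (𝕜 := ℝ))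
    Completion.denseRange_coe (Completion.isUniformInducing_coe _) x

theorem abs_coord_le (n : ℕ+) (v : Completion (C00 K)) : |coord K n v| ≤ ‖v‖ := by
  induction v using Completion.induction_on with
  | hp => exact isClosed_le (coord K n).continuous.abs continuous_norm
  | ih x =>
    rw [coord_coe, Completion.norm_coe]
    exact K.abs_apply_le x n

theorem NormingSet.norm_le_sum_abs (x : ℕ+ →₀ ℝ) : K.norm x ≤ ∑ a ∈ x.support, |x a| :=
  K.norm_le fun _ hf => (le_abs_self _).trans (K.abs_pairing_le hf x)

/-- An element of the completion whose first coordinates vanish is close to finitely supported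
sequences whose first coordinates vanish. -/
theorem exists_norm_sub_lt {v : Completion (C00 K)} {p : ℕ+} (hv : ∀ a < p, coord K a v = 0)
    {δ : ℝ} (hδ : 0 < δ) : ∃ x : ℕ+ →₀ ℝ, (∀ a ∈ x.support, p ≤ a) ∧
      ‖v - ((show C00 K from x : C00 K) : Completion (C00 K))‖ < δ := by
  set c : ℝ := ((Finset.Iio p).card : ℝ) with hc
  have hc0 : 0 ≤ c := by positivity
  -- One share of the error is for the approximation and one for each of the `c` coordinates to be
  -- removed.
  have hδ' : 0 < δ / (c + 1) := by positivity
  obtain ⟨x₀, hx₀⟩ := Metric.denseRange_iff.1 (Completion.denseRange_coe (α := C00 K)) v _ hδ'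
  rw [dist_eq_norm] at hx₀
  let y : ℕ+ →₀ ℝ := x₀
  have hy : ∀ a < p, |y a| ≤ δ / (c + 1) := by
    intro a ha
    have := abs_coord_le K a (v - x₀)
    rw [map_sub, hv a ha, zero_sub, abs_neg, coord_coe] at this
    exact this.trans hx₀.le
  refine ⟨y.filter (p ≤ ·), fun a ha => ?_, ?_⟩
  · rw [Finsupp.support_filter] at ha
    exact (Finset.mem_filter.1 ha).2
  have hsplit : y.filter (p ≤ ·) + y.filter (fun a => ¬ p ≤ a) = y :=
    Finsupp.filter_add_filter_not ..
  have hsmall : K.norm (y.filter (fun a => ¬ p ≤ a)) ≤ c * (δ / (c + 1)) := by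
    refine (K.norm_le_sum_abs _).trans ?_
    have hsub : (y.filter (fun a => ¬ p ≤ a)).support ⊆ Finset.Iio p := by
      intro a ha
      rw [Finsupp.support_filter] at ha
      exact Finset.mem_Iio.2 (not_le.1 (Finset.mem_filter.1 ha).2)
    refine (Finset.sum_le_card_nsmul _ _ (δ / (c + 1)) fun a ha => ?_).trans ?_
    · have := Finset.mem_Iio.1 (hsub ha)
      rw [Finsupp.filter_apply_pos (fun a => ¬ p ≤ a) _ (not_le.2 this)]
      exact hy a this
    · rw [nsmul_eq_mul]
      refine mul_le_mul_of_nonneg_right ?_ hδ'.le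
      rw [hc]
      exact_mod_cast Finset.card_le_card hsub
  have hdec : v - ((show C00 K from y.filter (p ≤ ·) : C00 K) : Completion (C00 K)) =
      (v - x₀) + ((show C00 K from y.filter (fun a => ¬ p ≤ a) : C00 K) : Completion (C00 K)) := by
    have : x₀ = (show C00 K from y.filter (p ≤ ·)) +
        (show C00 K from y.filter (fun a => ¬ p ≤ a)) :=
      hsplit.symm
    conv_rhs => rw [this, Completion.coe_add]
    abel
  rw [hdec]
  calc _ ≤ ‖v - x₀‖ + ‖((show C00 K from y.filter (fun a => ¬ p ≤ a) : C00 K) :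
        Completion (C00 K))‖ := norm_add_le _ _
    _ < δ / (c + 1) + c * (δ / (c + 1)) := by
        rw [Completion.norm_coe]
        exact add_lt_add_of_lt_of_le hx₀ hsmall
    _ = δ := by field_simp; ring

/-- An infinite-dimensional subspace contains a nonzero vector on which finitely many given
functionals vanish. -/
theorem exists_ne_zero_of_infinite {E : Type*} [AddCommGroup E] [Module ℝ E]
    (hE : ¬ FiniteDimensional ℝ E) {ι : Type*} [Finite ι] (g : ι → E →ₗ[ℝ] ℝ) :
    ∃ v : E, v ≠ 0 ∧ ∀ i, g i v = 0 := by
  by_contra! h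
  refine hE (Module.Finite.of_injective (LinearMap.pi g) ?_)
  rw [← LinearMap.ker_eq_bot, LinearMap.ker_eq_bot']
  intro v hv
  by_contra hne
  obtain ⟨i, hi⟩ := h v hne
  exact hi (congrFun hv i)

end completion

open UniformSpace

/-! ### Total incomparability -/

/-- The embedding of the finitely supported sequences into the completion. -/
noncomputable def ofFinsupp (K : NormingSet) : (ℕ+ →₀ ℝ) →ₗ[ℝ] Completion (C00 K) where
  toFun x := ((show C00 K from x : C00 K) : Completion (C00 K))
  map_add' x y := Completion.coe_add (α := C00 K) x y
  map_smul' c x := Completion.coe_smul (X := C00 K) c x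

theorem norm_ofFinsupp (K : NormingSet) (x : ℕ+ →₀ ℝ) : ‖ofFinsupp K x‖ = K.norm x :=
  Completion.norm_coe (E := C00 K) x

theorem norm_linearCombination_sub_le {E : Type*} [NormedAddCommGroup E] [NormedSpace ℝ E]
    {p q : ℕ → E} {η : ℕ → ℝ} (h : ∀ i, ‖p i - q i‖ ≤ η i) {ε : ℝ}
    (hη : ∀ s : Finset ℕ, ∑ i ∈ s, η i ≤ ε) (a : ℕ →₀ ℝ) {b : ℝ} (hb : 0 ≤ b)
    (ha : ∀ i, |a i| ≤ b) :
    ‖Finsupp.linearCombination ℝ p a - Finsupp.linearCombination ℝ q a‖ ≤ b * ε := by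
  rw [Finsupp.linearCombination_apply, Finsupp.linearCombination_apply, Finsupp.sum, Finsupp.sum,
    ← Finset.sum_sub_distrib]
  calc ‖∑ i ∈ a.support, (a i • p i - a i • q i)‖ ≤ ∑ i ∈ a.support, b * η i := by
        refine norm_sum_le_of_le _ fun i _ => ?_
        rw [← smul_sub, norm_smul, Real.norm_eq_abs]
        exact mul_le_mul (ha i) (h i) (norm_nonneg _) hb
    _ = b * ∑ i ∈ a.support, η i := (Finset.mul_sum ..).symm
    _ ≤ b * ε := mul_le_mul_of_nonneg_left (hη _) hb

section blocks

variable {θ : ℕ+ → ℝ} {hθ : RegularSequence θ} {K : NormingSet}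
  {V : Submodule ℝ (Completion (C00 K))}
  {W : Submodule ℝ (Mixed (fun k => schreier k) θ hθ.mem_Ioo)}

/-- Corresponding vectors of isomorphic subspaces can be approximated by finitely supported
sequences far out. -/
theorem exists_approx (hV : ¬ FiniteDimensional ℝ V) (Φ : V ≃L[ℝ] W) {δ : ℝ} (hδ : 0 < δ)
    (p : ℕ+) : ∃ (v : V) (x z : ℕ+ →₀ ℝ), (∀ a ∈ x.support, p ≤ a) ∧ (∀ a ∈ z.support, p ≤ a) ∧
      ‖Φ v‖ = 1 ∧ ‖ofFinsupp K x - v‖ < δ ∧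
      ‖ofFinsupp _ z - (Φ v : Mixed (fun k : ℕ+ => schreier k) θ hθ.mem_Ioo)‖ < δ := by
  -- The early coordinates of both `v₀` and its image are killed together, being finitely many
  -- functionals on `V`.
  obtain ⟨v₀, hv₀, h⟩ := exists_ne_zero_of_infinite hV
    (ι := Finset.Iio p ⊕ Finset.Iio p) (Sum.elim
      (fun a => (coord K a).toLinearMap ∘ₗ V.subtype)
      (fun a => ((coord _ a).toLinearMap ∘ₗ W.subtype) ∘ₗ Φ.toLinearEquiv.toLinearMap))
  have hΦ : ‖Φ v₀‖ ≠ 0 := fun h0 => hv₀ (by simpa using h0)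
  obtain ⟨v, hv⟩ : ∃ v, v = ‖Φ v₀‖⁻¹ • v₀ := ⟨_, rfl⟩
  have h1 : ∀ a < p, coord K a v = 0 := fun a ha => by
    have : coord K a v₀ = 0 := h (Sum.inl ⟨a, Finset.mem_Iio.2 ha⟩)
    rw [hv, Submodule.coe_smul, map_smul, this, smul_zero]
  have h2 : ∀ a < p, coord _ a (Φ v : Mixed (fun k : ℕ+ => schreier k) θ hθ.mem_Ioo) = 0 := by
    intro a ha
    have : coord _ a (Φ v₀ : Mixed (fun k : ℕ+ => schreier k) θ hθ.mem_Ioo) = 0 :=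
      h (Sum.inr ⟨a, Finset.mem_Iio.2 ha⟩)
    rw [hv, map_smul, Submodule.coe_smul, map_smul, this, smul_zero]
  obtain ⟨x, hx, hxv⟩ := exists_norm_sub_lt K h1 hδ
  obtain ⟨z, hz, hzv⟩ := exists_norm_sub_lt _ h2 hδ
  refine ⟨v, x, z, hx, hz, ?_, ?_, ?_⟩
  · rw [hv, map_smul, norm_smul, norm_inv, norm_norm, inv_mul_cancel₀ hΦ]
  · rw [norm_sub_rev]; exact hxv
  · rw [norm_sub_rev]; exact hzv

/-- Gliding hump in both spaces at once: the same intervals contain the supports of `x i` and `z i`.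
-/
theorem exists_block_approx (hV : ¬ FiniteDimensional ℝ V) (Φ : V ≃L[ℝ] W) {η : ℕ → ℝ}
    (hη : ∀ i, 0 < η i) : ∃ (v : ℕ → V) (x z : ℕ → ℕ+ →₀ ℝ) (ℓ t : ℕ → ℕ+),
      IsBlock x ℓ t ∧ IsBlock z ℓ t ∧ (∀ i, ‖Φ (v i)‖ = 1) ∧
      (∀ i, ‖ofFinsupp K (x i) - v i‖ ≤ η i) ∧
      ∀ i, ‖ofFinsupp _ (z i) -
        (Φ (v i) : Mixed (fun k : ℕ+ => schreier k) θ hθ.mem_Ioo)‖ ≤ η i := by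
  choose v x z hx hz hv hxv hzv using fun i => exists_approx (hθ := hθ) hV Φ (hη i)
  have hex : ∀ i p, ∃ t : ℕ+, p ≤ t ∧ (∀ a ∈ (x i p).support, a ≤ t) ∧
      ∀ a ∈ (z i p).support, a ≤ t := by
    intro i p
    obtain ⟨b, hb⟩ := (insert p ((x i p).support ∪ (z i p).support)).exists_le
    exact ⟨b, hb _ (by simp), fun a ha => hb _ (Finset.mem_insert_of_mem
      (Finset.mem_union_left _ ha)), fun a ha => hb _ (Finset.mem_insert_of_mem
      (Finset.mem_union_right _ ha))⟩
  choose t ht htx htz using hex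
  let P : ℕ → ℕ+ := fun n => Nat.rec 1 (fun i p => t i p + 1) n
  have hP : ∀ i, t i (P i) < P (i + 1) := fun i => PNat.lt_add_right _ _
  exact ⟨fun i => v i (P i), fun i => x i (P i), fun i => z i (P i), P, fun i => t i (P i),
    ⟨fun i => hx i _, fun i => htx i _, fun i => ht i _, hP⟩,
    ⟨fun i => hz i _, fun i => htz i _, fun i => ht i _, hP⟩,
    fun i => hv i _, fun i => (hxv i _).le, fun i => (hzv i _).le⟩

/-- Isomorphic infinite-dimensional subspaces contain equivalent block sequences, up to a small
perturbation. -/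
theorem exists_equivalent_blocks (hV : ¬ FiniteDimensional ℝ V) (Φ : V ≃L[ℝ] W) :
    ∃ (x z : ℕ → ℕ+ →₀ ℝ) (ℓ t : ℕ → ℕ+) (D : ℝ), 0 < D ∧ IsBlock x ℓ t ∧ IsBlock z ℓ t ∧
      (∀ i, z i ≠ 0) ∧ ∀ a : ℕ →₀ ℝ,
        K.norm (Finsupp.linearCombination ℝ x a) ≤
          D * tnorm hθ (Finsupp.linearCombination ℝ z a) ∧
        tnorm hθ (Finsupp.linearCombination ℝ z a) ≤
          D * K.norm (Finsupp.linearCombination ℝ x a) := by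
  set A : ℝ := ‖(Φ : V →L[ℝ] W)‖ with hA
  set B : ℝ := ‖(Φ.symm : W →L[ℝ] V)‖ with hB
  have hA0 : 0 ≤ A := ContinuousLinearMap.opNorm_nonneg _
  have hB0 : 0 ≤ B := ContinuousLinearMap.opNorm_nonneg _
  -- Chosen so that the perturbation error `2 * Z * ε * (A + 1)` is half of `Z` and can be absorbed.
  set ε : ℝ := 1 / (4 * (A + 1)) with hε
  have hε0 : 0 < ε := by positivity
  have hε1 : 4 * ε * (A + 1) = 1 := by rw [hε]; field_simp
  have hε2 : 4 * ε ≤ 1 := by nlinarith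
  obtain ⟨η, hη, c, hηc, hcε⟩ := posSumOfEncodable hε0 ℕ
  have hηs : ∀ s : Finset ℕ, ∑ i ∈ s, η i ≤ ε := fun s =>
    (sum_le_hasSum s (fun i _ => (hη i).le) hηc).trans hcε
  obtain ⟨v, x, z, ℓ, t, hx, hz, hv, hxv, hzv⟩ := exists_block_approx (hθ := hθ) hV Φ hη
  have hz1 : ∀ i, 1 / 2 ≤ tnorm hθ (z i) := by
    intro i
    have h1 := hηs {i}
    rw [Finset.sum_singleton] at h1
    have h2 := norm_sub_norm_le (Φ (v i) : Mixed (fun k : ℕ+ => schreier k) θ hθ.mem_Ioo)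
      (ofFinsupp _ (z i))
    rw [norm_sub_rev, norm_ofFinsupp] at h2
    have h3 := hzv i
    change ‖Φ (v i)‖ - tnorm hθ (z i) ≤ _ at h2
    rw [hv] at h2
    linarith
  refine ⟨x, z, ℓ, t, 2 * A + 2 * B + 1, by positivity, hx, hz, fun i h0 => ?_, fun a => ?_⟩
  · have := hz1 i
    rw [h0, tnorm_zero] at this
    linarith
  set Z := tnorm hθ (Finsupp.linearCombination ℝ z a) with hZ
  set X := K.norm (Finsupp.linearCombination ℝ x a) with hX
  have hZ0 : 0 ≤ Z := tnorm_nonneg hθ _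
  have hX0 : 0 ≤ X := K.norm_nonneg _
  -- Coefficients are controlled on the side of T alone, where restriction to the support of `z i`
  -- does not increase the norm; no such property of `K` is needed.
  have ha : ∀ i, |a i| ≤ 2 * Z := fun i => by
    have h1 := tnorm_filter_le hθ (Finsupp.linearCombination ℝ z a) (z i).support
    rw [hz.filter_mem_support, tnorm_smul] at h1
    have h2 := mul_le_mul_of_nonneg_left (hz1 i) (abs_nonneg (a i))
    linarith
  set y : V := Finsupp.linearCombination ℝ v a with hy
  have h1 := norm_linearCombination_sub_le hxv hηs a (by positivity) ha
  have h2 := norm_linearCombination_sub_le hzv hηs a (by positivity) ha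
  have e1 : Finsupp.linearCombination ℝ (fun i => ofFinsupp K (x i)) a =
      ofFinsupp K (Finsupp.linearCombination ℝ x a) := by
    rw [Finsupp.apply_linearCombination]; rfl
  have e2 : Finsupp.linearCombination ℝ (fun i => (v i : Completion (C00 K))) a = y := by
    rw [hy, ← Submodule.subtype_apply, Finsupp.apply_linearCombination]; rfl
  have e3 : Finsupp.linearCombination ℝ (fun i => ofFinsupp _ (z i)) a =
      ofFinsupp (mixedNormingSet (fun k : ℕ+ => schreier k) θ hθ.mem_Ioo)
        (Finsupp.linearCombination ℝ z a) := by
    rw [Finsupp.apply_linearCombination]; rfl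
  have e4 : Finsupp.linearCombination ℝ
      (fun i => (Φ (v i) : Mixed (fun k : ℕ+ => schreier k) θ hθ.mem_Ioo)) a =
      (Φ y : Mixed (fun k : ℕ+ => schreier k) θ hθ.mem_Ioo) := by
    have : Φ y = Finsupp.linearCombination ℝ (Φ ∘ v) a :=
      Finsupp.apply_linearCombination ℝ (Φ.toLinearEquiv : V →ₗ[ℝ] W) v a
    rw [this, ← Submodule.subtype_apply, Finsupp.apply_linearCombination]; rfl
  rw [e1, e2] at h1
  rw [e3, e4] at h2
  have hΦ : ‖Φ y‖ ≤ A * ‖y‖ := (Φ : V →L[ℝ] W).le_opNorm y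
  have hΨ : ‖y‖ ≤ B * ‖Φ y‖ := by simpa using (Φ.symm : W →L[ℝ] V).le_opNorm (Φ y)
  have h3 : X ≤ ‖y‖ + 2 * Z * ε := by
    have := norm_le_norm_add_norm_sub' (ofFinsupp K (Finsupp.linearCombination ℝ x a)) y
    rw [norm_ofFinsupp] at this
    exact this.trans (add_le_add_right h1 _)
  have h4 : ‖y‖ ≤ X + 2 * Z * ε := by
    have := norm_le_norm_add_norm_sub (ofFinsupp K (Finsupp.linearCombination ℝ x a)) y
    rw [norm_ofFinsupp] at this
    exact this.trans (add_le_add_right h1 _)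
  have h5 : Z ≤ ‖Φ y‖ + 2 * Z * ε := by
    have := norm_le_norm_add_norm_sub' (ofFinsupp
      (mixedNormingSet (fun k : ℕ+ => schreier k) θ hθ.mem_Ioo)
      (Finsupp.linearCombination ℝ z a)) (Φ y : Mixed (fun k : ℕ+ => schreier k) θ hθ.mem_Ioo)
    rw [norm_ofFinsupp] at this
    exact this.trans (add_le_add_right h2 _)
  have h6 : ‖Φ y‖ ≤ Z + 2 * Z * ε := by
    have := norm_le_norm_add_norm_sub (ofFinsupp
      (mixedNormingSet (fun k : ℕ+ => schreier k) θ hθ.mem_Ioo)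
      (Finsupp.linearCombination ℝ z a)) (Φ y : Mixed (fun k : ℕ+ => schreier k) θ hθ.mem_Ioo)
    rw [norm_ofFinsupp] at this
    exact this.trans (add_le_add_right h2 _)
  have h7 : 4 * (Z * ε) ≤ Z := by nlinarith
  have h8 := mul_le_mul_of_nonneg_left h6 hB0
  have h9 := mul_le_mul_of_nonneg_left h4 hA0
  have h10 := mul_le_mul_of_nonneg_left h7 hB0
  have h11 : A * (4 * (Z * ε)) + 4 * (Z * ε) = Z := by linear_combination Z * hε1
  have h12 := mul_nonneg hA0 hZ0
  have h13 := mul_nonneg hB0 hX0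
  have h14 := mul_nonneg hB0 hZ0
  constructor <;> nlinarith

end blocks

/-- Disjointness and position of vectors in the span of a block sequence can be read off from their
coefficients, so both pass to the equivalent block sequence. There the sum has norm at most `18 *
D`, while the lower estimate makes it at least `ρ * n / D`. -/
theorem totallyIncomparable_of_disjointLower {θ : ℕ+ → ℝ} (hθ : RegularSequence θ)
    (hlim : Tendsto (fun n : ℕ+ => θ n ^ (1 / ((n : ℕ) : ℝ))) atTop (𝓝 1)) {K : NormingSet}
    {ρ : ℝ} (hρ : 0 < ρ) (hK : DisjointLower K ρ) :
    TotallyIncomparable (Completion (C00 K)) (Mixed (fun k => schreier k) θ hθ.mem_Ioo) := by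
  intro V W _ _ hV
  refine ⟨fun Φ => ?_⟩
  obtain ⟨x, z, ℓ, t, D, hD, hx, hz, hz0, hxz⟩ := exists_equivalent_blocks (hθ := hθ) hV Φ
  have hℓ : ∀ i, i < (ℓ i : ℕ) := fun i => by
    induction i with
    | zero => exact (ℓ 0).pos
    | succ i ih => exact lt_of_le_of_lt ih (hz.lower_strictMono (Nat.lt_succ_self i))
  obtain ⟨n, hn⟩ := exists_nat_gt (18 * D * D / ρ)
  have hn0 : 0 < n := by
    have : (0 : ℝ) < n := lt_of_le_of_lt (by positivity) hn
    exact_mod_cast this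
  -- Supports beyond `ℓ n` involve only blocks with index at least `n`, whose counterparts in the
  -- other space lie beyond `n` as well.
  obtain ⟨u, hu, hup, hud, hu1, husum⟩ := exists_disjoint_bounded hθ hlim
    (W := LinearMap.range (Finsupp.linearCombination ℝ z)) (fun p => by
      refine ⟨z p, ⟨Finsupp.single p 1, by simp⟩, hz0 _, fun a ha => ?_⟩
      have h1 : p ≤ ℓ p := PNat.coe_le_coe _ _ |>.1 (hℓ p).le
      exact h1.trans (hz.lower _ _ ha)) hn0 (ℓ n)
  choose a ha using hu
  have hmem : ∀ s, ∀ e ∈ (a s).support, ∃ b, b ∈ (z e).support ∧ b ∈ (u s).support := by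
    intro s e he
    obtain ⟨b, hb⟩ := Finsupp.support_nonempty_iff.2 (hz0 e)
    refine ⟨b, hb, Finsupp.mem_support_iff.2 ?_⟩
    rw [← ha s, hz.linearCombination_apply _ hb]
    exact mul_ne_zero (Finsupp.mem_support_iff.1 he) (Finsupp.mem_support_iff.1 hb)
  have hu0 : ∀ s, 0 < tnorm hθ (u s) := fun s => one_pos.trans_le (hu1 s)
  have key := hK n hn0 (fun s => Finsupp.linearCombination ℝ x (a s)) ?_ ?_ ?_
  · rw [← map_sum] at key
    have h1 := (hxz (∑ s, a s)).1
    rw [map_sum (Finsupp.linearCombination ℝ z), Finset.sum_congr rfl fun s _ => ha s] at h1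
    have h2 : (n : ℝ) ≤ D * ∑ s, K.norm (Finsupp.linearCombination ℝ x (a s)) := by
      rw [Finset.mul_sum]
      calc (n : ℝ) = ∑ s : Fin n, 1 := by simp
        _ ≤ _ := Finset.sum_le_sum fun s _ =>
          (hu1 s).trans (by simpa only [ha] using (hxz (a s)).2)
    have h3 := mul_le_mul_of_nonneg_left h2 hρ.le
    have h4 := mul_le_mul_of_nonneg_left (key.trans (h1.trans
      (mul_le_mul_of_nonneg_left husum hD.le))) hD.le
    rw [div_lt_iff₀ hρ] at hn
    linarith
  · intro s h0
    have h1 := (hxz (a s)).2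
    rw [ha, h0] at h1
    have : K.norm 0 = 0 := by simpa using K.norm_smul 0 0
    rw [this, mul_zero] at h1
    exact absurd (hu0 s) (not_lt.2 h1)
  · intro s s' hss
    refine Finset.disjoint_left.2 fun b hb hb' => ?_
    obtain ⟨e, he, hbe⟩ := IsBlock.exists_mem_of_ne_zero hb
    obtain ⟨e', he', hbe'⟩ := IsBlock.exists_mem_of_ne_zero hb'
    obtain rfl := hx.eq_of_mem hbe hbe'
    obtain ⟨d, hd⟩ := Finsupp.support_nonempty_iff.2 (hz0 e)
    have hmem' : ∀ s, e ∈ (a s).support → d ∈ (u s).support := fun s he => by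
      rw [Finsupp.mem_support_iff, ← ha, hz.linearCombination_apply _ hd]
      exact mul_ne_zero (Finsupp.mem_support_iff.1 he) (Finsupp.mem_support_iff.1 hd)
    exact Finset.disjoint_left.1 (hud hss) (hmem' s he) (hmem' s' he')
  · intro s b hb
    obtain ⟨e, he, hbe⟩ := IsBlock.exists_mem_of_ne_zero hb
    obtain ⟨d, hd, hdu⟩ := hmem s e he
    have h1 : n ≤ e := by
      by_contra hlt
      exact absurd ((hup s d hdu).trans (hz.upper e d hd))
        (not_le.2 (hz.upper_lt_lower (not_le.1 hlt)))
    have h2 : (ℓ e : ℕ) ≤ b := hx.lower e b hbe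
    exact h1.trans ((hℓ e).le.trans h2)

end Tsirelson

theorem corollary1p26 (θ : ℕ+ → ℝ) (hθ : Tsirelson.RegularSequence θ)
    (hlim : Filter.Tendsto (fun n : ℕ+ => θ n ^ (1 / ((n : ℕ) : ℝ))) Filter.atTop (nhds 1)) :
    Tsirelson.TotallyIncomparable
        (Tsirelson.Modified (fun k => Tsirelson.schreier k) θ hθ.mem_Ioo)
        (Tsirelson.Mixed (fun k => Tsirelson.schreier k) θ hθ.mem_Ioo) ∧
      ∀ m : ℕ+, Tsirelson.TotallyIncomparable
        (Tsirelson.BoundedlyModified m (fun k => Tsirelson.schreier k) θ hθ.mem_Ioo)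
        (Tsirelson.Mixed (fun k => Tsirelson.schreier k) θ hθ.mem_Ioo) := by
  refine ⟨Tsirelson.totallyIncomparable_of_disjointLower hθ hlim (hθ.mem_Ioo 1).1
    (Tsirelson.disjointLower_normingSet hθ.mem_Ioo _ Tsirelson.shrinkClosed_allowable
      fun _ _ h => h), fun m => ?_⟩
  -- Only the family of order 1 has to be allowable, and `1 ≤ m`.
  exact Tsirelson.totallyIncomparable_of_disjointLower hθ hlim (hθ.mem_Ioo 1).1
    (Tsirelson.disjointLower_normingSet hθ.mem_Ioo _ (Tsirelson.shrinkClosed_boundedly m)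
      fun _ _ h => Or.inl ⟨one_le, h⟩)
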